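/- Let $M$ be a compact connected smooth $7$-manifold (without boundary) with a $G_2$ structure $\varphi$, i.e. a smooth $3$-form that at every point is identified, by a linear isomorphism of the tangent space with $\mathbb R^7$, with $$\varphi_0 = e^{127}+e^{135}-e^{146}-e^{236}-e^{245}+e^{347}+e^{567}.$$ Let $g_\varphi$ and $\mathrm{vol}_\varphi$ be the metric and volume form determined by $g_\varphi(X,Y)\,\mathrm{vol}_\varphi=\tfrac16 (X\lrcorner\varphi)\wedge(Y\lrcorner\varphi)\wedge\varphi$, let $dV_{g_\varphi}$ be the Riemannian measure and $\star_\varphi$ the Hodge star. Assume that $\varphi$ is a strong torsion $G_2$ structure: there is a (necessarily unique) connection $\nabla$ with $\nabla g_\varphi=0$, $\nabla\varphi=0$ whose torsion $H_\varphi(X,Y,Z)=g_\varphi(T^\nabla(X,Y),Z)$ is a $3$-form, and $dH_\varphi=0$. Let $\tau_0,\dots,\tau_3$ be the torsion forms of $\varphi$, defined by $$d\varphi=\tau_0\star_\varphi\varphi+3\tau_1\wedge\varphi+\star_\varphi\tau_3,\qquad d\star_\varphi\varphi=4\tau_1\wedge\star_\varphi\varphi+\tau_2\wedge\varphi,$$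 where $\tau_2\wedge\varphi=-\star_\varphi\tau_2$, $\tau_3\wedge\varphi=0$ and $\tau_3\wedge\star_\varphi\varphi=0$, and let $\theta_\varphi=4\tau_1$ be the Lee form. Let $f$ be the unique smooth function with $\int_M e^{-f}dV_{g_\varphi}=1$ and $\mathrm{Rc}^\nabla+\nabla df=0$, and let $V=\theta_\varphi^\sharp-\nabla f$. If $V=0$, then $\tau_0$ is constant, $$\int_M e^{-f}|H_\varphi|^2\,dV_{g_\varphi}=\tfrac{49}{36}\,\tau_0^2\int_M e^{-f}\,dV_{g_\varphi},$$ where $|H_\varphi|^2\,\mathrm{vol}_\varphi=H_\varphi\wedge\star_\varphi H_\varphi$, and moreover $\tau_0=0$ if and only if $H_\varphi=0$ and $\varphi$ is a parallel $G_2$ structure (i.e. $\varphi$ is parallel for the Levi-Civita connection of $g_\varphi$). -/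

import Mathlib

open scoped Manifold ContDiff Topology
open MeasureTheory

noncomputable section

namespace StrongG2

/-! ### Exterior algebra on `ℝ⁷` -/

/-- The model space `ℝ⁷`. -/
abbrev E7 := EuclideanSpace ℝ (Fin 7)

/-- Alternating `k`-forms on `ℝ⁷`. -/
abbrev Form (k : ℕ) := E7 [⋀^Fin k]→L[ℝ] ℝ

/-- The standard basis `e₁, …, e₇` of `ℝ⁷` (indexed from `0`). -/
def stdVec (i : Fin 7) : E7 := EuclideanSpace.single i (1 : ℝ)

/-- The multilinear tensor product `(α ⊗ β)(v₁,…,v_{k+l}) = α(v₁,…,v_k) β(v_{k+1},…,v_{k+l})`. -/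
def tensor {k l : ℕ} (α : Form k) (β : Form l) :
    ContinuousMultilinearMap ℝ (fun _ : Fin (k + l) => E7) ℝ where
  toMultilinearMap :=
    ((LinearMap.mul' ℝ ℝ).compMultilinearMap
      (α.toMultilinearMap.domCoprod β.toMultilinearMap)).domDomCongr finSumFinEquiv
  cont := by
    change Continuous fun v : Fin (k + l) → E7 =>
      α (fun i => v (finSumFinEquiv (Sum.inl i))) * β (fun j => v (finSumFinEquiv (Sum.inr j)))
    exact (α.cont.comp (by fun_prop)).mul (β.cont.comp (by fun_prop))

theorem tensor_apply {k l : ℕ} (α : Form k) (β : Form l) (v : Fin (k + l) → E7) :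
    tensor α β v = α (fun i => v (Fin.castAdd l i)) * β (fun j => v (Fin.natAdd k j)) := rfl

/-- The wedge product
`(α ∧ β)(v) = (1/(k! l!)) ∑_σ sgn(σ) α(v_{σ(1)},…,v_{σ(k)}) β(v_{σ(k+1)},…,v_{σ(k+l)})`,
normalised so that `e¹ ∧ ⋯ ∧ eᵏ` is the determinant. -/
def wedge {k l : ℕ} (α : Form k) (β : Form l) : Form (k + l) :=
  ((k.factorial : ℝ) * (l.factorial : ℝ))⁻¹ •
    ContinuousMultilinearMap.alternatization (tensor α β)

/-- A covector as a `1`-form. -/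
def oneForm (a : E7 →L[ℝ] ℝ) : Form 1 :=
  ContinuousAlternatingMap.ofSubsingleton ℝ E7 ℝ (0 : Fin 1) a

/-- The dual basis `e¹, …, e⁷` of `ℝ⁷`, as `1`-forms. -/
def dualForm (i : Fin 7) : Form 1 := oneForm (EuclideanSpace.proj i)

/-- `e^{ijk} = eⁱ ∧ eʲ ∧ eᵏ`. -/
def e3 (i j k : Fin 7) : Form 3 := wedge (wedge (dualForm i) (dualForm j)) (dualForm k)

/-- The model `G₂` form
`φ₀ = e¹²⁷ + e¹³⁵ - e¹⁴⁶ - e²³⁶ - e²⁴⁵ + e³⁴⁷ + e⁵⁶⁷` (indices shifted by one). -/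
def phi0 : Form 3 :=
  e3 0 1 6 + e3 0 2 4 - e3 0 3 5 - e3 1 2 5 - e3 1 3 4 + e3 2 3 6 + e3 4 5 6

/-- The standard determinant form `e¹ ∧ ⋯ ∧ eⁿ` on `ℝⁿ`. -/
def detFormN (n : ℕ) : EuclideanSpace ℝ (Fin n) [⋀^Fin n]→L[ℝ] ℝ where
  toMultilinearMap := ((Matrix.detRowAlternating (R := ℝ) (n := Fin n)).compLinearMap
    (EuclideanSpace.equiv (Fin n) ℝ).toLinearEquiv.toLinearMap).toMultilinearMap
  map_eq_zero_of_eq' v i j h hij :=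
    ((Matrix.detRowAlternating (R := ℝ) (n := Fin n)).compLinearMap
      (EuclideanSpace.equiv (Fin n) ℝ).toLinearEquiv.toLinearMap).map_eq_zero_of_eq' v i j h hij
  cont := by
    have h : Continuous fun v : Fin n → EuclideanSpace ℝ (Fin n) =>
        Matrix.det (Matrix.of fun i j => v i j) :=
      Continuous.matrix_det (continuous_matrix fun i j => by simp only [Matrix.of_apply]; fun_prop)
    exact h

theorem detFormN_apply (n : ℕ) (v : Fin n → EuclideanSpace ℝ (Fin n)) :
    detFormN n v = Matrix.det (Matrix.of fun i j => v i j) := rfl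

/-- The standard determinant form `e¹ ∧ ⋯ ∧ e⁷` on `ℝ⁷`. -/
def detForm : Form 7 := detFormN 7

/-! ### The metric, volume form and Hodge star of a `G₂` form, pointwise -/

/-- The coefficient with respect to `e¹ ∧ ⋯ ∧ e⁷` of `(1/6) (X ⌟ φ) ∧ (Y ⌟ φ) ∧ φ`. -/
def hitchinForm (φ : Form 3) (X Y : E7) : ℝ :=
  (1 / 6 : ℝ) * (wedge (wedge (φ.curryLeft X) (φ.curryLeft Y)) φ : Form 7) stdVec

/-- The value `vol_φ(e₁,…,e₇)`.  Since `g_φ · vol_φ(e₁,…,e₇)` is the bilinear form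
`hitchinForm φ` and `det (g_φ(e_i,e_j)) = vol_φ(e₁,…,e₇)²`, it is the real ninth root of
`det (hitchinForm φ)`. -/
def volCoeff (φ : Form 3) : ℝ :=
  let d := (Matrix.of fun i j : Fin 7 => hitchinForm φ (stdVec i) (stdVec j)).det
  SignType.sign d * |d| ^ (1 / 9 : ℝ)

/-- The volume form `vol_φ`. -/
def volForm (φ : Form 3) : Form 7 := volCoeff φ • detForm

/-- The metric `g_φ`, determined by `g_φ(X,Y) vol_φ = (1/6) (X ⌟ φ) ∧ (Y ⌟ φ) ∧ φ`. -/
def metric (φ : Form 3) (X Y : E7) : ℝ := hitchinForm φ X Y / volCoeff φ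

/-- The Gram matrix of `g_φ` in the standard basis. -/
def gram (φ : Form 3) : Matrix (Fin 7) (Fin 7) ℝ :=
  Matrix.of fun i j => metric φ (stdVec i) (stdVec j)

/-- The inner product of `k`-forms induced by `g_φ`,
`⟨α, β⟩ = (1/k!) g^{i₁j₁} ⋯ g^{i_kj_k} α_{i₁…i_k} β_{j₁…j_k}`. -/
def formInner (φ : Form 3) {k : ℕ} (α β : Form k) : ℝ :=
  (k.factorial : ℝ)⁻¹ * ∑ I : Fin k → Fin 7, ∑ J : Fin k → Fin 7,
    (∏ a, (gram φ)⁻¹ (I a) (J a)) * α (fun a => stdVec (I a)) * β (fun a => stdVec (J a))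

/-- Insertion of `k` vectors in the first `k` slots of a form:
`(insertVecs w η)(v₁,…,v_l) = η(w₁,…,w_k,v₁,…,v_l)`. -/
def insertVecs {l : ℕ} : (k : ℕ) → (Fin k → E7) → Form (l + k) → Form l
  | 0, _, η => η
  | k + 1, w, η => insertVecs k (fun i => w i.succ) (η.curryLeft (w 0))

/-- The Hodge star of `g_φ` and `vol_φ` on `k`-forms, `k + l = 7`:
`(⋆α)(v) = (1/k!) g^{i₁j₁} ⋯ g^{i_kj_k} α_{i₁…i_k} vol_φ(e_{j₁},…,e_{j_k},v₁,…,v_l)`,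
so that `α ∧ ⋆β = ⟨α, β⟩ vol_φ`. -/
def star (φ : Form 3) {k : ℕ} (l : ℕ) (h : 7 = l + k) (α : Form k) : Form l :=
  (k.factorial : ℝ)⁻¹ • ∑ I : Fin k → Fin 7, ∑ J : Fin k → Fin 7,
    ((∏ a, (gram φ)⁻¹ (I a) (J a)) * α (fun a => stdVec (I a))) •
      insertVecs k (fun a => stdVec (J a)) (h ▸ volForm φ)

/-- The vector `a^♯`, with `g_φ(a^♯, ·) = a`. -/
def sharp (φ : Form 3) (a : Form 1) : E7 :=
  ∑ i : Fin 7, ∑ j : Fin 7, ((gram φ)⁻¹ i j * a (fun _ => stdVec j)) • stdVec i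

/-! ### Differential forms and connections on a `7`-manifold -/

section Manifold

variable {M : Type*} [TopologicalSpace M] [ChartedSpace E7 M]

/-- Differential `k`-forms on `M`, not necessarily smooth. Each tangent space is, by definition in
Mathlib, a copy of the model `ℝ⁷`, so the pointwise constructions above apply to them. -/
abbrev DForm (M : Type*) [TopologicalSpace M] [ChartedSpace E7 M] (k : ℕ) :=
  Π x : M, (TangentSpace (𝓡 7) x) [⋀^Fin k]→L[ℝ] ℝ

/-- Vector fields on `M`, not necessarily smooth. -/
abbrev VField (M : Type*) [TopologicalSpace M] [ChartedSpace E7 M] :=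
  Π x : M, TangentSpace (𝓡 7) x

/-- Affine connections on `M`; `D Y x (X x)` is `(D_X Y)(x)`. -/
abbrev Connection (M : Type*) [TopologicalSpace M] [ChartedSpace E7 M]
    [IsManifold (𝓡 7) ∞ M] :=
  CovariantDerivative (𝓡 7) E7 (TangentSpace (𝓡 7) : M → Type)

/-- The coordinate expression of a differential form in the chart centred at `p`. -/
def formInChart {k : ℕ} (p : M) (α : DForm M k) (y : E7) : Form k :=
  (α ((extChartAt (𝓡 7) p).symm y)).compContinuousLinearMap
    (mfderiv 𝓘(ℝ, E7) (𝓡 7) (extChartAt (𝓡 7) p).symm y)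

/-- A differential form is smooth if all its coordinate expressions are. -/
def IsSmoothForm {k : ℕ} (α : DForm M k) : Prop :=
  ∀ p : M, ContDiffOn ℝ ∞ (formInChart p α) (extChartAt (𝓡 7) p).target

/-- The exterior derivative, computed at `x` in the chart centred at `x`. -/
def extD {k : ℕ} (α : DForm M k) : DForm M (k + 1) := fun x =>
  (extDeriv (formInChart x α) (extChartAt (𝓡 7) x x)).compContinuousLinearMap
    (mfderiv (𝓡 7) 𝓘(ℝ, E7) (extChartAt (𝓡 7) x) x)

/-- The differential of a function, as a `1`-form. -/
def dFun (f : M → ℝ) : DForm M 1 := fun x => oneForm (mvfderiv (𝓡 7) f x)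

/-- The form `φ` is a `G₂` structure: smooth and pointwise identified with `φ₀` by a linear
isomorphism from the tangent space to `ℝ⁷`. -/
structure IsG2Structure (φ : DForm M 3) : Prop where
  smooth : IsSmoothForm φ
  pointwise : ∀ x : M, ∃ L : TangentSpace (𝓡 7) x ≃L[ℝ] E7,
    φ x = phi0.compContinuousLinearMap (L : TangentSpace (𝓡 7) x →L[ℝ] E7)

/-- The Riemannian metric `g_φ`. -/
def gMetric (φ : DForm M 3) (x : M) (u v : TangentSpace (𝓡 7) x) : ℝ := metric (φ x) u v

/-- The `4`-form `⋆_φ φ`. -/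
def starPhi (φ : DForm M 3) : DForm M 4 := fun x => star (φ x) 4 rfl (φ x)

/-- The Riemannian measure restricted to the chart centred at `p`: the image under the inverse
chart of `√det(g_φ(∂_i, ∂_j)) dy₁ ⋯ dy₇`. -/
def chartVolume [MeasurableSpace M] (φ : DForm M 3) (p : M) : Measure M :=
  Measure.map (extChartAt (𝓡 7) p).symm
    (((volume : Measure E7).restrict (extChartAt (𝓡 7) p).target).withDensity fun y =>
      ENNReal.ofReal (Real.sqrt (Matrix.of fun i j : Fin 7 =>
        gMetric φ ((extChartAt (𝓡 7) p).symm y)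
          (mfderiv 𝓘(ℝ, E7) (𝓡 7) (extChartAt (𝓡 7) p).symm y (stdVec i))
          (mfderiv 𝓘(ℝ, E7) (𝓡 7) (extChartAt (𝓡 7) p).symm y (stdVec j))).det))

/-- The Riemannian measure `dV_{g_φ}`: the least measure on `M` that dominates the Riemannian
measure of every chart.  (These measures agree on overlaps of charts, so that it restricts to each
of them on the domain of the chart.) -/
def riemVolume [MeasurableSpace M] (φ : DForm M 3) : Measure M := ⨆ p : M, chartVolume φ p

variable [IsManifold (𝓡 7) ∞ M]

/-- The vector field `Y` is differentiable at `x`. -/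
def IsDiffFieldAt (Y : VField M) (x : M) : Prop :=
  MDifferentiableAt (𝓡 7) ((𝓡 7).prod 𝓘(ℝ, E7))
    (fun y => (Bundle.TotalSpace.mk y (Y y) :
      Bundle.TotalSpace E7 (TangentSpace (𝓡 7) : M → Type))) x

/-- `D g_φ = 0`, that is `X(g(Y, Z)) = g(D_X Y, Z) + g(Y, D_X Z)`. -/
def PreservesMetric (φ : DForm M 3) (D : Connection M) : Prop :=
  ∀ (x : M) (u : TangentSpace (𝓡 7) x) (Y Z : VField M),
    IsDiffFieldAt Y x → IsDiffFieldAt Z x →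
    mvfderiv (𝓡 7) (fun y => gMetric φ y (Y y) (Z y)) x u =
      gMetric φ x (D Y x u) (Z x) + gMetric φ x (Y x) (D Z x u)

/-- `D α = 0`, that is `X(α(Y₁,…,Y_k)) = ∑ᵢ α(Y₁,…,D_X Yᵢ,…,Y_k)`. -/
def PreservesForm {k : ℕ} (α : DForm M k) (D : Connection M) : Prop :=
  ∀ (x : M) (u : TangentSpace (𝓡 7) x) (Y : Fin k → VField M),
    (∀ i, IsDiffFieldAt (Y i) x) →
    mvfderiv (𝓡 7) (fun y => α y (fun i => Y i y)) x u =
      ∑ i, α x (Function.update (fun j => Y j x) i (D (Y i) x u))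

/-- `D` is a smooth connection with `D g_φ = 0`, `D φ = 0`, whose torsion is skew-symmetric and
given by the `3`-form `H`: `g_φ(T(X,Y),Z) = H(X,Y,Z)`. -/
structure IsSkewTorsionConnection (φ : DForm M 3) (D : Connection M) (H : DForm M 3) : Prop where
  smooth : CovariantDerivative.ContMDiffCovariantDerivative D ∞
  metric_parallel : PreservesMetric φ D
  form_parallel : PreservesForm φ D
  torsion_eq : ∀ (x : M) (u v w : TangentSpace (𝓡 7) x),
    gMetric φ x (D.torsion x u v) w = H x ![u, v, w]

/-- `φ` is a strong torsion `G₂` structure, with connection `D` and torsion form `H`. -/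
structure IsStrongTorsionG2 (φ : DForm M 3) (D : Connection M) (H : DForm M 3) : Prop where
  isG2 : IsG2Structure φ
  skewTorsion : IsSkewTorsionConnection φ D H
  closed : ∀ x, extD H x = 0

/-- `φ` is a parallel `G₂` structure: `φ` is parallel for the Levi-Civita connection of `g_φ`. -/
def IsParallelG2 (φ : DForm M 3) : Prop :=
  ∃ D : Connection M, CovariantDerivative.ContMDiffCovariantDerivative D ∞ ∧ PreservesMetric φ D ∧
    (∀ x, D.torsion x = 0) ∧ PreservesForm φ D

/-- The torsion forms `τ₀, τ₁, τ₂, τ₃` of `φ`: the components of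
`dφ = τ₀ ⋆φ + 3 τ₁ ∧ φ + ⋆τ₃` and `d⋆φ = 4 τ₁ ∧ ⋆φ + τ₂ ∧ φ`, with `τ₂ ∈ Λ²₁₄`, `τ₃ ∈ Λ³₂₇`. -/
structure IsTorsionForms (φ : DForm M 3) (τ₀ : M → ℝ) (τ₁ : DForm M 1) (τ₂ : DForm M 2)
    (τ₃ : DForm M 3) : Prop where
  mem14 : ∀ (x : M) (v : Fin 5 → E7),
    wedge (τ₂ x) (φ x) v = -star (φ x) 5 rfl (τ₂ x) v
  mem27 : ∀ x : M, (∀ v : Fin 6 → E7, wedge (τ₃ x) (φ x) v = 0) ∧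
    (∀ v : Fin 7 → E7, wedge (τ₃ x) (starPhi φ x) v = 0)
  d_phi : ∀ (x : M) (v : Fin 4 → E7), extD φ x v =
    τ₀ x * starPhi φ x v + 3 * wedge (τ₁ x) (φ x) v + star (φ x) 4 rfl (τ₃ x) v
  d_starPhi : ∀ (x : M) (v : Fin 5 → E7), extD (starPhi φ) x v =
    4 * wedge (τ₁ x) (starPhi φ x) v + wedge (τ₂ x) (φ x) v

/-- The curvature `R(X,Y)Z = D_X D_Y Z - D_Y D_X Z - D_{[X,Y]} Z`. -/
def curvature (D : Connection M) (X Y Z : VField M) (x : M) : TangentSpace (𝓡 7) x :=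
  D (fun y => D Z y (Y y)) x (X x) - D (fun y => D Z y (X y)) x (Y x)
    - D Z x (VectorField.mlieBracket (𝓡 7) X Y x)

/-- The Ricci tensor `Rc(v,w) = tr (u ↦ R(u,v)w)`.  Tangent vectors at `x` are extended to vector
fields by constants in the local trivialization at `x`. -/
def ricci (D : Connection M) (x : M) (v w : TangentSpace (𝓡 7) x) : ℝ :=
  ∑ i : Fin 7, EuclideanSpace.proj (𝕜 := ℝ) i
    (show E7 from curvature D (FiberBundle.extend E7 (show TangentSpace (𝓡 7) x from stdVec i))
      (FiberBundle.extend E7 v) (FiberBundle.extend E7 w) x)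

/-- The tensor `(D df)(v,w) = v(df(W)) - df(D_v W)`. -/
def covHessian (D : Connection M) (f : M → ℝ) (x : M) (v w : TangentSpace (𝓡 7) x) : ℝ :=
  mvfderiv (𝓡 7) (fun y => mvfderiv (𝓡 7) f y (FiberBundle.extend E7 w y)) x v
    - mvfderiv (𝓡 7) f x (D (FiberBundle.extend E7 w) x v)

/-- `f` is the soliton potential: smooth, `∫ e^{-f} dV = 1` and `Rc^D + D df = 0`. -/
structure IsSolitonPotential [MeasurableSpace M] (φ : DForm M 3) (D : Connection M)
    (f : M → ℝ) : Prop where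
  smooth : ContMDiff (𝓡 7) 𝓘(ℝ, ℝ) ∞ f
  normalized : ∫ x, Real.exp (-f x) ∂(riemVolume φ) = 1
  soliton : ∀ (x : M) (v w : TangentSpace (𝓡 7) x), ricci D x v w + covHessian D f x v w = 0

/-- The Lee form `θ_φ = 4 τ₁`. -/
def leeForm (τ₁ : DForm M 1) : DForm M 1 := fun x => (4 : ℝ) • τ₁ x

/-- The canonical vector field `V = θ_φ^♯ - ∇f`. -/
def canonicalField (φ : DForm M 3) (τ₁ : DForm M 1) (f : M → ℝ) : VField M := fun x =>
  sharp (φ x) (leeForm τ₁ x) - sharp (φ x) (dFun f x)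

end Manifold

end StrongG2

end

/-!
On a strong torsion `G₂` structure the connection `D` preserves `φ`, so that `dφ` is algebraic in
the torsion `H`. Contraction with `⋆φ` and with `φ` gives `τ₀ = (6/7) ⟨H, φ⟩`, and the Lee form
`4 τ₁` as a multiple `θ` of the contraction of `H` with `⋆φ`
(`IsStrongTorsionG2.torsion_forms`).

Two consequences of `dH = 0` carry the proof. First, the curvature of `D` lies in `𝔤₂` in its
endomorphism part, hence is annihilated by contraction with `φ`; the first Bianchi identity, whose
torsion terms are those of `dH = 0`, then shows that the contraction of `DH` with `φ` vanishes
(`sum_nabla_mul_phiC`). Since `Dφ = 0`, this says that `⟨H, φ⟩` is locally constant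
(`IsLocalG2.fderiv_scalar`), hence so is `τ₀`. Secondly, contraction of `dH = 0` with `⋆φ`
(`sum_leeC_nabla`) and an algebraic identity for `3`-forms (`sum_contrPhi_sq`) give
`div θ = |θ|² + ⟨H, φ⟩² - |H|²`.

If `V = 0`, then `θ = df`, and the second identity reads
`div (e^{-f} ∇f) = e^{-f} (⟨H, φ⟩² - |H|²)` (`IsLocalG2.div_lee`). As the torsion is skew, the
divergence of `D` is the Riemannian one, and its integral over the compact manifold vanishes
(`integral_divergence`, by a partition of unity). With `⟨H, φ⟩ = (7/6) τ₀` this is the integral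
formula. If `τ₀ = 0`, the formula forces `H = 0`, whence `D` is torsion-free and is the Levi-Civita
connection. The remaining implication is immediate from `τ₀ = (6/7) ⟨H, φ⟩`.

The pointwise identities are proved in components with respect to a basis in which `φ` is `φ₀`
(`adBasis`). The differential ones are proved for an open set of `ℝ⁷` with Christoffel operators
(`IsLocalG2`), by means of a frame that is parallel at the given point (`parFrame`), and transferred
to the manifold by `IsStrongTorsionG2.isLocalG2`. The volume is finite by the
normalisation of `f`.
-/

noncomputable section

namespace StrongG2

/-! ### Wedge products of coordinate forms -/

theorem stdVec_apply (i j : Fin 7) : stdVec i j = if j = i then 1 else 0 := by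
  simp [stdVec]

theorem wedge_apply {k l : ℕ} (α : Form k) (β : Form l) (v : Fin (k + l) → E7) :
    wedge α β v = ((k.factorial : ℝ) * (l.factorial : ℝ))⁻¹ *
      ∑ σ : Equiv.Perm (Fin (k + l)), ((Equiv.Perm.sign σ : ℤ) : ℝ) *
        (α (fun i => v (σ (Fin.castAdd l i))) * β (fun j => v (σ (Fin.natAdd k j)))) := by
  simp only [wedge, ContinuousAlternatingMap.smul_apply,
    ContinuousMultilinearMap.alternatization_apply_apply, tensor_apply, Function.comp_apply,
    smul_eq_mul, Units.smul_def, zsmul_eq_mul]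

theorem wedge_add_left {k l : ℕ} (α α' : Form k) (β : Form l) :
    wedge (α + α') β = wedge α β + wedge α' β := by
  ext v
  simp only [wedge_apply, ContinuousAlternatingMap.add_apply, add_mul, mul_add,
    Finset.sum_add_distrib]

theorem wedge_add_right {k l : ℕ} (α : Form k) (β β' : Form l) :
    wedge α (β + β') = wedge α β + wedge α β' := by
  ext v
  simp only [wedge_apply, ContinuousAlternatingMap.add_apply, mul_add, Finset.sum_add_distrib]

theorem wedge_smul_left {k l : ℕ} (c : ℝ) (α : Form k) (β : Form l) :
    wedge (c • α) β = c • wedge α β := by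
  ext v
  simp only [wedge_apply, ContinuousAlternatingMap.smul_apply, smul_eq_mul, Finset.mul_sum]
  exact Finset.sum_congr rfl fun σ _ => by ring

theorem wedge_smul_right {k l : ℕ} (c : ℝ) (α : Form k) (β : Form l) :
    wedge α (c • β) = c • wedge α β := by
  ext v
  simp only [wedge_apply, ContinuousAlternatingMap.smul_apply, smul_eq_mul, Finset.mul_sum]
  exact Finset.sum_congr rfl fun σ _ => by ring

/-- The wedge product as a bilinear map, for the sake of the `map_sum` lemmas. -/
def wedgeL (k l : ℕ) : Form k →ₗ[ℝ] Form l →ₗ[ℝ] Form (k + l) :=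
  LinearMap.mk₂ ℝ wedge wedge_add_left wedge_smul_left wedge_add_right wedge_smul_right

theorem wedgeL_apply {k l : ℕ} (α : Form k) (β : Form l) : wedgeL k l α β = wedge α β := rfl

theorem wedge_sum_left {ι : Type*} (s : Finset ι) {k l : ℕ} (α : ι → Form k) (β : Form l) :
    wedge (∑ i ∈ s, α i) β = ∑ i ∈ s, wedge (α i) β := by
  simp only [← wedgeL_apply, map_sum, LinearMap.sum_apply]

theorem wedge_sum_right {ι : Type*} (s : Finset ι) {k l : ℕ} (α : Form k) (β : ι → Form l) :
    wedge α (∑ i ∈ s, β i) = ∑ i ∈ s, wedge α (β i) := by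
  simp only [← wedgeL_apply, map_sum]

theorem wedge_comp {k l : ℕ} (α : Form k) (β : Form l) (L : E7 →L[ℝ] E7) :
    wedge (α.compContinuousLinearMap L) (β.compContinuousLinearMap L) =
      (wedge α β).compContinuousLinearMap L := by
  ext v
  simp only [wedge_apply, ContinuousAlternatingMap.compContinuousLinearMap_apply]
  rfl

/-- The coordinate form `e^{I₁} ∧ ⋯ ∧ e^{I_k}`. -/
def eForm {k : ℕ} (I : Fin k → Fin 7) : Form k :=
  ContinuousMultilinearMap.alternatization
    ((ContinuousMultilinearMap.mkPiAlgebra ℝ (Fin k) ℝ).compContinuousLinearMap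
      fun a => EuclideanSpace.proj (𝕜 := ℝ) (I a))

theorem eForm_apply {k : ℕ} (I : Fin k → Fin 7) (v : Fin k → E7) :
    eForm I v = ∑ σ : Equiv.Perm (Fin k), ((Equiv.Perm.sign σ : ℤ) : ℝ) * ∏ a, v (σ a) (I a) := by
  simp [eForm, ContinuousMultilinearMap.alternatization_apply_apply, Units.smul_def]

/-- The coordinate forms multiply by concatenation of their indices. -/
theorem wedge_eForm {k l : ℕ} (I : Fin k → Fin 7) (J : Fin l → Fin 7) :
    wedge (eForm I) (eForm J) = eForm (Fin.append I J) := by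
  ext v
  have key : ∀ (ρ : Equiv.Perm (Fin k)) (τ : Equiv.Perm (Fin l)),
      ∑ σ : Equiv.Perm (Fin (k + l)), ((Equiv.Perm.sign σ : ℤ) : ℝ) *
        ((((Equiv.Perm.sign ρ : ℤ) : ℝ) * ∏ a, v (σ (Fin.castAdd l (ρ a))) (I a)) *
        (((Equiv.Perm.sign τ : ℤ) : ℝ) * ∏ b, v (σ (Fin.natAdd k (τ b))) (J b))) =
      eForm (Fin.append I J) v := by
    intro ρ τ
    rw [eForm_apply]
    refine Fintype.sum_equiv
      (Equiv.mulRight (finSumFinEquiv.permCongr (Equiv.Perm.sumCongr ρ τ))) _ _ fun σ => ?_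
    simp only [Equiv.coe_mulRight, Equiv.Perm.sign_mul, Equiv.Perm.sign_permCongr,
      Equiv.Perm.sign_sumCongr, Units.val_mul, Int.cast_mul]
    rw [Fin.prod_univ_add]
    have h1 : ∀ a, (σ * finSumFinEquiv.permCongr (Equiv.Perm.sumCongr ρ τ)) (Fin.castAdd l a) =
        σ (Fin.castAdd l (ρ a)) := by
      intro a; simp [Equiv.permCongr_apply]
    have h2 : ∀ b, (σ * finSumFinEquiv.permCongr (Equiv.Perm.sumCongr ρ τ)) (Fin.natAdd k b) =
        σ (Fin.natAdd k (τ b)) := by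
      intro a; simp [Equiv.permCongr_apply]
    simp only [h1, h2, Fin.append_left, Fin.append_right]
    ring
  rw [wedge_apply]
  simp only [eForm_apply (k := k), eForm_apply (k := l), Finset.sum_mul_sum]
  simp only [Finset.mul_sum]
  rw [Finset.sum_comm]
  conv_lhs => enter [2, ρ]; rw [Finset.sum_comm]
  simp only [← Finset.mul_sum, key]
  simp only [Finset.sum_const, Finset.card_univ, Fintype.card_perm, Fintype.card_fin, nsmul_eq_mul]
  field_simp

theorem form_apply_eq_sum {k : ℕ} (α : Form k) (v : Fin k → E7) :
    α v = ∑ I : Fin k → Fin 7, (∏ a, v a (I a)) * α (fun a => stdVec (I a)) := by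
  have hv : v = fun a => ∑ i : Fin 7, v a i • stdVec i := by
    ext a i
    simp [stdVec_apply]
  conv_lhs => rw [hv]
  rw [← ContinuousAlternatingMap.coe_toContinuousMultilinearMap,
    ContinuousMultilinearMap.map_sum]
  refine Finset.sum_congr rfl fun I _ => ?_
  rw [ContinuousMultilinearMap.map_smul_univ, smul_eq_mul]

/-- The expansion of a form in coordinate forms. -/
theorem form_eq_sum_eForm {k : ℕ} (α : Form k) :
    α = (k.factorial : ℝ)⁻¹ • ∑ I : Fin k → Fin 7, α (fun a => stdVec (I a)) • eForm I := by
  ext v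
  have h : ∀ σ : Equiv.Perm (Fin k),
      ((Equiv.Perm.sign σ : ℤ) : ℝ) * α (fun a => v (σ a)) = α v := by
    intro σ
    have := α.toAlternatingMap.map_perm v σ
    have h2 : α (fun a => v (σ a)) = Equiv.Perm.sign σ • α v := this
    rw [h2, Units.smul_def, zsmul_eq_mul, ← mul_assoc, ← Int.cast_mul]
    simp
  have hk : (k.factorial : ℝ) ≠ 0 := by positivity
  have h3 : (k.factorial : ℝ) * α v =
      ∑ σ : Equiv.Perm (Fin k), ((Equiv.Perm.sign σ : ℤ) : ℝ) * α (fun a => v (σ a)) := by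
    simp [h, Fintype.card_perm]
  rw [eq_comm]
  simp only [ContinuousAlternatingMap.smul_apply, ContinuousAlternatingMap.sum_apply, smul_eq_mul]
  rw [inv_mul_eq_iff_eq_mul₀ hk, h3]
  simp only [eForm_apply, Finset.mul_sum]
  rw [Finset.sum_comm]
  refine Finset.sum_congr rfl fun σ _ => ?_
  rw [form_apply_eq_sum α (fun a => v (σ a)), Finset.mul_sum]
  exact Finset.sum_congr rfl fun I _ => by ring

/-- The sign of `j - i`. -/
def cmpSign (i j : ℕ) : ℤ := if i < j then 1 else if j < i then -1 else 0

/-- The sign of the permutation that sorts a list, `0` if the list has a repetition.  The recursion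
is one that the kernel evaluates quickly. -/
def sgnList : List ℕ → ℤ
  | [] => 1
  | a :: l => l.foldr (fun b s => cmpSign a b * s) (sgnList l)

/-- The Levi-Civita symbol of seven indices. -/
def eps (a b c d e f g : Fin 7) : ℤ := sgnList [a, b, c, d, e, f, g]

/-- The recursion for the Levi-Civita symbol, written as the product over pairs that computes
the sign of a permutation in Mathlib. -/
theorem eps_eq_prod (I : Fin 7 → Fin 7) : eps (I 0) (I 1) (I 2) (I 3) (I 4) (I 5) (I 6) =
    ∏ j, ∏ i ∈ Finset.Iio j, cmpSign (I i) (I j) := by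
  have h : ∀ j : Fin 7, ∏ i ∈ Finset.Iio j, cmpSign (I i) (I j) =
      ∏ i, if i < j then cmpSign (I i) (I j) else 1 := by
    intro j
    rw [Finset.prod_ite]
    simp [Finset.filter_gt_eq_Iio]
  simp only [h, Fin.prod_univ_seven]
  simp [eps, sgnList]
  ring

theorem eps_eq_det (I : Fin 7 → Fin 7) :
    ((eps (I 0) (I 1) (I 2) (I 3) (I 4) (I 5) (I 6) : ℤ) : ℝ) =
      Matrix.det (Matrix.of fun a b => if I a = b then (1 : ℝ) else 0) := by
  rw [eps_eq_prod]
  by_cases hI : Function.Injective I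
  · have hb : Function.Bijective I := Finite.injective_iff_bijective.1 hI
    let σ : Equiv.Perm (Fin 7) := Equiv.ofBijective I hb
    have h1 : (Matrix.of fun a b => if I a = b then (1 : ℝ) else 0) = σ.permMatrix ℝ := by
      ext a b
      simp [Equiv.Perm.permMatrix, PEquiv.toMatrix_apply, σ, Equiv.toPEquiv_apply]
    rw [h1, Matrix.det_permutation, Equiv.Perm.sign_eq_prod_prod_Iio]
    push_cast
    refine Finset.prod_congr rfl fun j _ => Finset.prod_congr rfl fun i hi => ?_
    have hne : I i ≠ I j := fun h => (Finset.mem_Iio.1 hi).ne (hI h)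
    have e1 : ∀ i, σ i = I i := fun i => rfl
    simp only [e1, cmpSign, Fin.val_fin_lt]
    rcases lt_or_gt_of_ne hne with h | h
    · simp [h]
    · simp [h, h.not_gt]
  · rw [Function.not_injective_iff] at hI
    obtain ⟨a, b, hab, hne⟩ := hI
    have hdet : Matrix.det (Matrix.of fun a b => if I a = b then (1 : ℝ) else 0) = 0 :=
      Matrix.det_zero_of_row_eq hne (by ext c; simp [hab])
    rw [hdet, Int.cast_eq_zero]
    rcases lt_or_gt_of_ne hne with h | h
    · exact Finset.prod_eq_zero (Finset.mem_univ b)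
        (Finset.prod_eq_zero (Finset.mem_Iio.2 h) (by simp [hab, cmpSign]))
    · exact Finset.prod_eq_zero (Finset.mem_univ a)
        (Finset.prod_eq_zero (Finset.mem_Iio.2 h) (by simp [hab, cmpSign]))

theorem eForm_stdVec (I : Fin 7 → Fin 7) : eForm I stdVec =
    eps (I 0) (I 1) (I 2) (I 3) (I 4) (I 5) (I 6) := by
  rw [eForm_apply, eps_eq_det, ← Matrix.det_transpose, Matrix.det_apply']
  refine Finset.sum_congr rfl fun σ _ => ?_
  congr 1
  refine Finset.prod_congr rfl fun a _ => ?_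
  simp [stdVec_apply, eq_comm]

theorem detForm_stdVec (I : Fin 7 → Fin 7) : detForm (fun a => stdVec (I a)) =
    eps (I 0) (I 1) (I 2) (I 3) (I 4) (I 5) (I 6) := by
  rw [detForm, detFormN_apply, eps_eq_det]
  congr 1
  ext a b
  simp [stdVec_apply, eq_comm]

theorem dualForm_eq (i : Fin 7) : dualForm i = eForm ![i] := by
  ext v
  rw [eForm_apply]
  simp [dualForm, oneForm]

theorem e3_eq (i j k : Fin 7) : e3 i j k = eForm ![i, j, k] := by
  rw [e3, dualForm_eq, dualForm_eq, dualForm_eq, wedge_eForm, wedge_eForm]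
  congr 1
  ext a; fin_cases a <;> rfl

/-! ### Components of the model form -/

/-- The sign of the cross product `eᵢ × eⱼ = ± e_k`. -/
def crossSign : Fin 7 → Fin 7 → ℤ :=
  ![![0, 1, 1, -1, -1, 1, -1],
    ![-1, 0, -1, -1, 1, 1, 1],
    ![-1, 1, 0, 1, 1, -1, -1],
    ![1, 1, -1, 0, -1, -1, 1],
    ![1, -1, -1, 1, 0, 1, -1],
    ![-1, -1, 1, 1, -1, 0, 1],
    ![1, -1, 1, -1, 1, -1, 0]]

/-- The index `k` of the cross product `eᵢ × eⱼ = ± e_k` (immaterial for `i = j`). -/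
def crossIdx : Fin 7 → Fin 7 → Fin 7 :=
  ![![0, 6, 4, 5, 2, 3, 1],
    ![6, 0, 5, 4, 3, 2, 0],
    ![4, 5, 0, 6, 0, 1, 3],
    ![5, 4, 6, 0, 1, 0, 2],
    ![2, 3, 0, 1, 0, 6, 5],
    ![3, 2, 1, 0, 6, 0, 4],
    ![1, 0, 3, 2, 5, 4, 0]]

/-- The components of `φ₀`, as integers. -/
def phiZ (i j k : Fin 7) : ℤ := if k = crossIdx i j then crossSign i j else 0

/-- The components of `φ₀`. -/
def phiC (i j k : Fin 7) : ℝ := (phiZ i j k : ℝ)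

/-- The coefficients of `φ₀` in `lineIdx`. -/
def lineSign : Fin 7 → ℤ := ![1, 1, -1, -1, -1, 1, 1]

/-- The index triples of the seven terms of `φ₀`. -/
def lineIdx : Fin 7 → Fin 3 → Fin 7 :=
  ![![0, 1, 6], ![0, 2, 4], ![0, 3, 5], ![1, 2, 5], ![1, 3, 4], ![2, 3, 6], ![4, 5, 6]]

theorem phi0_eq_sum : phi0 = ∑ w : Fin 7, (lineSign w : ℝ) • eForm (lineIdx w) := by
  simp only [phi0, e3_eq, Fin.sum_univ_seven]
  simp [lineSign, lineIdx]
  module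

/-- The integer Kronecker delta. -/
def dZ (i j : Fin 7) : ℤ := if i = j then 1 else 0

theorem stdVec_apply_dZ (i j : Fin 7) : stdVec i j = (dZ j i : ℝ) := by
  simp [stdVec_apply, dZ]

theorem eForm_three (I J : Fin 3 → Fin 7) : eForm I (fun a => stdVec (J a)) =
    ((Matrix.det (Matrix.of fun a b => dZ (I b) (J a)) : ℤ) : ℝ) := by
  rw [eForm_apply, Matrix.det_apply']
  push_cast
  simp [stdVec_apply_dZ]

theorem eForm_two (I J : Fin 2 → Fin 7) : eForm I (fun a => stdVec (J a)) =
    ((Matrix.det (Matrix.of fun a b => dZ (I b) (J a)) : ℤ) : ℝ) := by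
  rw [eForm_apply, Matrix.det_apply']
  push_cast
  simp [stdVec_apply_dZ]

theorem phi0_stdVec (I : Fin 3 → Fin 7) :
    phi0 (fun a => stdVec (I a)) = phiC (I 0) (I 1) (I 2) := by
  have key : ∀ i j k : Fin 7, ∑ w : Fin 7, lineSign w *
      (dZ (lineIdx w 0) i * dZ (lineIdx w 1) j * dZ (lineIdx w 2) k
        - dZ (lineIdx w 0) i * dZ (lineIdx w 2) j * dZ (lineIdx w 1) k
        - dZ (lineIdx w 1) i * dZ (lineIdx w 0) j * dZ (lineIdx w 2) k
        + dZ (lineIdx w 1) i * dZ (lineIdx w 2) j * dZ (lineIdx w 0) k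
        + dZ (lineIdx w 2) i * dZ (lineIdx w 0) j * dZ (lineIdx w 1) k
        - dZ (lineIdx w 2) i * dZ (lineIdx w 1) j * dZ (lineIdx w 0) k) = phiZ i j k := by
    decide +kernel
  rw [phi0_eq_sum, phiC, ← key]
  simp only [ContinuousAlternatingMap.sum_apply, ContinuousAlternatingMap.smul_apply, eForm_three,
    smul_eq_mul, Matrix.det_fin_three, Matrix.of_apply]
  push_cast
  rfl

/-- The pairs `(j, k)` with `e_a ⌟ φ₀ = ∑ eʲ ∧ eᵏ`. -/
def contrIdx : Fin 7 → Fin 3 → Fin 2 → Fin 7 :=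
  ![![![1, 6], ![2, 4], ![5, 3]],
    ![![4, 3], ![5, 2], ![6, 0]],
    ![![1, 5], ![3, 6], ![4, 0]],
    ![![0, 5], ![1, 4], ![6, 2]],
    ![![0, 2], ![3, 1], ![5, 6]],
    ![![2, 1], ![3, 0], ![6, 4]],
    ![![0, 1], ![2, 3], ![4, 5]]]

theorem form_ext_stdVec {k : ℕ} {α β : Form k}
    (h : ∀ I : Fin k → Fin 7, α (fun a => stdVec (I a)) = β (fun a => stdVec (I a))) : α = β := by
  ext v
  rw [form_apply_eq_sum, form_apply_eq_sum β]
  simp only [h]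

theorem curryLeft_phi0 (a : Fin 7) :
    phi0.curryLeft (stdVec a) = ∑ t : Fin 3, eForm (contrIdx a t) := by
  have key : ∀ a j k : Fin 7, ∑ t : Fin 3,
      (dZ (contrIdx a t 0) j * dZ (contrIdx a t 1) k
        - dZ (contrIdx a t 1) j * dZ (contrIdx a t 0) k) = phiZ a j k := by
    decide +kernel
  refine form_ext_stdVec fun I => ?_
  have h1 : phi0.curryLeft (stdVec a) (fun b => stdVec (I b)) =
      phi0 (fun b => stdVec ((Matrix.vecCons a I : Fin 3 → Fin 7) b)) := by
    rw [ContinuousAlternatingMap.curryLeft_apply_apply]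
    congr 1
    ext b : 1
    refine Fin.cases ?_ (fun b => ?_) b <;> simp [Matrix.vecCons]
  rw [h1, phi0_stdVec, phiC]
  have h2 := key a (I 0) (I 1)
  simp only [Matrix.cons_val_zero]
  have e : phiZ a ((Matrix.vecCons a I : Fin 3 → Fin 7) 1) ((Matrix.vecCons a I : Fin 3 → Fin 7) 2)
    = phiZ a (I 0) (I 1) := rfl
  rw [e, ← h2]
  simp only [ContinuousAlternatingMap.sum_apply, eForm_two, Matrix.det_fin_two, Matrix.of_apply]
  push_cast
  rfl

/-- The metric of `φ₀` is the Euclidean one, its volume form being `e¹ ∧ ⋯ ∧ e⁷`; checked on the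
basis, by evaluation of integers. -/
theorem hitchinForm_phi0_stdVec (a b : Fin 7) :
    hitchinForm phi0 (stdVec a) (stdVec b) = if a = b then 1 else 0 := by
  have key : ∀ a b : Fin 7, ∑ t : Fin 3, ∑ u : Fin 3, ∑ w : Fin 7, lineSign w *
      eps (contrIdx a t 0) (contrIdx a t 1) (contrIdx b u 0) (contrIdx b u 1)
        (lineIdx w 0) (lineIdx w 1) (lineIdx w 2) =
      if a = b then 6 else 0 := by
    decide +kernel
  have h : (wedge (wedge (phi0.curryLeft (stdVec a)) (phi0.curryLeft (stdVec b))) phi0 : Form 7)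
      stdVec = ((if a = b then 6 else 0 : ℤ) : ℝ) := by
    rw [← key, curryLeft_phi0, curryLeft_phi0, wedge_sum_left, wedge_sum_left,
      ContinuousAlternatingMap.sum_apply]
    push_cast
    refine Finset.sum_congr rfl fun t _ => ?_
    rw [wedge_sum_right, wedge_sum_left, ContinuousAlternatingMap.sum_apply]
    refine Finset.sum_congr rfl fun u _ => ?_
    rw [phi0_eq_sum, wedge_sum_right, ContinuousAlternatingMap.sum_apply]
    refine Finset.sum_congr rfl fun w _ => ?_
    rw [wedge_eForm, wedge_smul_right, wedge_eForm, ContinuousAlternatingMap.smul_apply,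
      eForm_stdVec, smul_eq_mul]
    rfl
  rw [hitchinForm, h]
  split_ifs <;> norm_num

/-! ### Adapted bases: metric, volume and Hodge star in components -/

theorem hitchinForm_add_left (φ : Form 3) (X X' Y : E7) :
    hitchinForm φ (X + X') Y = hitchinForm φ X Y + hitchinForm φ X' Y := by
  simp only [hitchinForm, map_add, wedge_add_left,
    ContinuousAlternatingMap.add_apply, mul_add]

theorem hitchinForm_smul_left (φ : Form 3) (c : ℝ) (X Y : E7) :
    hitchinForm φ (c • X) Y = c * hitchinForm φ X Y := by
  simp only [hitchinForm, map_smul, wedge_smul_left,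
    ContinuousAlternatingMap.smul_apply, smul_eq_mul]
  ring

theorem hitchinForm_add_right (φ : Form 3) (X Y Y' : E7) :
    hitchinForm φ X (Y + Y') = hitchinForm φ X Y + hitchinForm φ X Y' := by
  simp only [hitchinForm, map_add, wedge_add_left, wedge_add_right,
    ContinuousAlternatingMap.add_apply, mul_add]

theorem hitchinForm_smul_right (φ : Form 3) (c : ℝ) (X Y : E7) :
    hitchinForm φ X (c • Y) = c * hitchinForm φ X Y := by
  simp only [hitchinForm, map_smul, wedge_smul_left, wedge_smul_right,
    ContinuousAlternatingMap.smul_apply, smul_eq_mul]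
  ring

/-- `g_φ · vol_φ(e₁, …, e₇)` as a bilinear map. -/
def hitchinL (φ : Form 3) : E7 →ₗ[ℝ] E7 →ₗ[ℝ] ℝ :=
  LinearMap.mk₂ ℝ (hitchinForm φ) (hitchinForm_add_left φ) (hitchinForm_smul_left φ)
    (hitchinForm_add_right φ) (hitchinForm_smul_right φ)

/-- `g_φ` as a bilinear map. -/
def metricL (φ : Form 3) : E7 →ₗ[ℝ] E7 →ₗ[ℝ] ℝ := (volCoeff φ)⁻¹ • hitchinL φ

theorem metricL_apply (φ : Form 3) (X Y : E7) : metricL φ X Y = metric φ X Y := by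
  simp [metricL, metric, hitchinL, div_eq_inv_mul]

theorem eq_sum_stdVec (v : E7) : v = ∑ i : Fin 7, v i • stdVec i := by
  ext i
  simp [stdVec_apply]

theorem hitchinForm_phi0 (X Y : E7) : hitchinForm phi0 X Y = ∑ k, X k * Y k := by
  have h : hitchinL phi0 X Y = ∑ k, X k * Y k := by
    conv_lhs => rw [eq_sum_stdVec X, eq_sum_stdVec Y]
    simp only [map_sum, map_smul, LinearMap.sum_apply, LinearMap.smul_apply]
    have e : ∀ i j, hitchinL phi0 (stdVec i) (stdVec j) = if i = j then 1 else 0 :=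
      hitchinForm_phi0_stdVec
    simp [e]
    exact Finset.sum_congr rfl fun i _ => mul_comm _ _
  exact h

/-- The standard basis as a `Basis`. -/
def stdBasis : Module.Basis (Fin 7) ℝ E7 := (EuclideanSpace.basisFun (Fin 7) ℝ).toBasis

theorem stdBasis_apply (i : Fin 7) : stdBasis i = stdVec i := by
  simp [stdBasis, stdVec]

/-- A form of top degree is multiplied by the determinant. -/
theorem top_form_comp (η : Form 7) (L : E7 →L[ℝ] E7) (v : Fin 7 → E7) :
    η (fun i => L (v i)) = LinearMap.det (L : E7 →ₗ[ℝ] E7) * η v := by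
  have h := AlternatingMap.eq_smul_basis_det stdBasis η.toAlternatingMap
  have h1 : ∀ u : Fin 7 → E7, η u = η.toAlternatingMap stdBasis * stdBasis.det u := by
    intro u
    have := congrArg (fun F => F u) h
    simpa using this
  rw [h1, h1 v]
  have h2 := Module.Basis.det_comp stdBasis (L : E7 →ₗ[ℝ] E7) v
  have h3 : ((L : E7 →ₗ[ℝ] E7) : E7 → E7) ∘ v = fun i => L (v i) := rfl
  rw [h3] at h2
  rw [h2]
  ring

theorem curryLeft_comp (φ : Form 3) (L : E7 →L[ℝ] E7) (X : E7) :
    (φ.compContinuousLinearMap L).curryLeft X =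
      (φ.curryLeft (L X)).compContinuousLinearMap L := by
  ext v
  simp only [ContinuousAlternatingMap.curryLeft_apply_apply,
    ContinuousAlternatingMap.compContinuousLinearMap_apply]
  congr 1
  ext i : 1
  refine Fin.cases ?_ (fun j => ?_) i <;> simp [Matrix.vecCons]

theorem hitchinForm_comp (φ : Form 3) (L : E7 →L[ℝ] E7) (X Y : E7) :
    hitchinForm (φ.compContinuousLinearMap L) X Y =
      LinearMap.det (L : E7 →ₗ[ℝ] E7) * hitchinForm φ (L X) (L Y) := by
  rw [hitchinForm, hitchinForm, curryLeft_comp, curryLeft_comp, wedge_comp, wedge_comp,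
    ContinuousAlternatingMap.compContinuousLinearMap_apply]
  have := top_form_comp (wedge (wedge (φ.curryLeft (L X)) (φ.curryLeft (L Y))) φ) L stdVec
  have h2 : (L ∘ stdVec) = fun i => L (stdVec i) := rfl
  rw [h2, this]
  ring

/-- The matrix of `L`: its columns are the images of the standard basis. -/
def mat (L : E7 →L[ℝ] E7) : Matrix (Fin 7) (Fin 7) ℝ := Matrix.of fun k i => L (stdVec i) k

theorem det_mat (L : E7 →L[ℝ] E7) : (mat L).det = LinearMap.det (L : E7 →ₗ[ℝ] E7) := by
  rw [← LinearMap.det_toMatrix stdBasis]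
  congr 1

theorem det_hitchin_comp (L : E7 →L[ℝ] E7) :
    (Matrix.of fun i j : Fin 7 =>
      hitchinForm (phi0.compContinuousLinearMap L) (stdVec i) (stdVec j)).det =
        (LinearMap.det (L : E7 →ₗ[ℝ] E7)) ^ 9 := by
  have h : (Matrix.of fun i j : Fin 7 =>
      hitchinForm (phi0.compContinuousLinearMap L) (stdVec i) (stdVec j)) =
      LinearMap.det (L : E7 →ₗ[ℝ] E7) • ((mat L).transpose * mat L) := by
    ext i j
    simp [hitchinForm_comp, hitchinForm_phi0, mat, Matrix.mul_apply]
  rw [h, Matrix.det_smul, Matrix.det_mul, Matrix.det_transpose, det_mat]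
  simp
  ring

/-- The volume coefficient of `L^* φ₀`: the matrix of `hitchinForm` is `det L · LᵀL`, whose
determinant is `(det L)⁹`. -/
theorem volCoeff_comp (L : E7 →L[ℝ] E7) :
    volCoeff (phi0.compContinuousLinearMap L) = LinearMap.det (L : E7 →ₗ[ℝ] E7) := by
  rw [volCoeff, det_hitchin_comp]
  generalize LinearMap.det (L : E7 →ₗ[ℝ] E7) = d
  have h1 : |d ^ 9| ^ (1 / 9 : ℝ) = |d| := by
    rw [abs_pow, ← Real.rpow_natCast, ← Real.rpow_mul (abs_nonneg d)]
    norm_num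
  simp only [h1]
  rcases lt_trichotomy d 0 with h | h | h
  · have : d ^ 9 < 0 := Odd.pow_neg (by decide) h
    simp [sign_neg this, abs_of_neg h]
  · simp [h]
  · have : 0 < d ^ 9 := by positivity
    simp [sign_pos this, abs_of_pos h]

theorem det_equiv_ne_zero (L : E7 ≃L[ℝ] E7) :
    LinearMap.det ((L : E7 →L[ℝ] E7) : E7 →ₗ[ℝ] E7) ≠ 0 :=
  (LinearEquiv.isUnit_det' L.toLinearEquiv).ne_zero

theorem metric_comp (L : E7 ≃L[ℝ] E7) (X Y : E7) :
    metric (phi0.compContinuousLinearMap (L : E7 →L[ℝ] E7)) X Y = ∑ k, L X k * L Y k := by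
  rw [metric, volCoeff_comp, hitchinForm_comp, hitchinForm_phi0,
    mul_div_cancel_left₀ _ (det_equiv_ne_zero L)]
  rfl

/-- The inverse metric of `L^* φ₀` is the sum of `b_m ⊗ b_m` over the adapted basis. -/
theorem gram_inv_comp (L : E7 ≃L[ℝ] E7) (i j : Fin 7) :
    (gram (phi0.compContinuousLinearMap (L : E7 →L[ℝ] E7)))⁻¹ i j =
      ∑ m, L.symm (stdVec m) i * L.symm (stdVec m) j := by
  have hA : mat (L : E7 →L[ℝ] E7) * mat (L.symm : E7 →L[ℝ] E7) = 1 := by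
    ext i j
    have h : L (L.symm (stdVec j)) i = stdVec j i := by rw [L.apply_symm_apply]
    rw [eq_sum_stdVec (L.symm (stdVec j))] at h
    simp only [map_sum, map_smul] at h
    rw [Matrix.mul_apply, Matrix.one_apply, ← stdVec_apply, ← h]
    simp only [mat, Matrix.of_apply, WithLp.ofLp_sum, Finset.sum_apply, PiLp.smul_apply,
      smul_eq_mul]
    exact Finset.sum_congr rfl fun k _ => mul_comm _ _
  have hg : gram (phi0.compContinuousLinearMap (L : E7 →L[ℝ] E7)) =
      (mat (L : E7 →L[ℝ] E7)).transpose * mat (L : E7 →L[ℝ] E7) := by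
    ext i j
    simp [gram, metric_comp, mat, Matrix.mul_apply]
  have hi : (gram (phi0.compContinuousLinearMap (L : E7 →L[ℝ] E7)))⁻¹ =
      mat (L.symm : E7 →L[ℝ] E7) * (mat (L.symm : E7 →L[ℝ] E7)).transpose := by
    apply Matrix.inv_eq_right_inv
    rw [hg]
    have h2 := congrArg Matrix.transpose (mul_eq_one_comm.1 hA)
    rw [Matrix.transpose_mul, Matrix.transpose_one] at h2
    calc _ = (mat (L : E7 →L[ℝ] E7)).transpose *
          ((mat (L : E7 →L[ℝ] E7)) * mat (L.symm : E7 →L[ℝ] E7)) *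
          (mat (L.symm : E7 →L[ℝ] E7)).transpose := by simp only [Matrix.mul_assoc]
      _ = 1 := by rw [hA, Matrix.mul_one, h2]
  rw [hi]
  simp [Matrix.mul_apply, mat]

/-- If `∑ cⁱʲ eᵢ ⊗ eⱼ = ∑ b_m ⊗ b_m`, then contracting two multilinear maps with `c` amounts to
summing over the basis `b`. -/
theorem contract_eq {k : ℕ} {W : Type*} [AddCommGroup W] [Module ℝ W]
    (c : Matrix (Fin 7) (Fin 7) ℝ) (b : Fin 7 → E7) (hc : ∀ i j, c i j = ∑ m, b m i * b m j)
    (F : (Fin k → E7) → ℝ) (G : (Fin k → E7) → W)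
    (hF : ∀ v, F v = ∑ I : Fin k → Fin 7, (∏ a, v a (I a)) * F (fun a => stdVec (I a)))
    (hG : ∀ v, G v = ∑ I : Fin k → Fin 7, (∏ a, v a (I a)) • G (fun a => stdVec (I a))) :
    ∑ I : Fin k → Fin 7, ∑ J : Fin k → Fin 7,
      ((∏ a, c (I a) (J a)) * F (fun a => stdVec (I a))) • G (fun a => stdVec (J a)) =
    ∑ K : Fin k → Fin 7, F (fun a => b (K a)) • G (fun a => b (K a)) := by
  have h : ∀ I J : Fin k → Fin 7, ∏ a, c (I a) (J a) =
      ∑ K : Fin k → Fin 7, (∏ a, b (K a) (I a)) * ∏ a, b (K a) (J a) := by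
    intro I J
    simp only [hc]
    rw [Finset.prod_univ_sum]
    simp [Finset.prod_mul_distrib]
  have e : ∀ K : Fin k → Fin 7, F (fun a => b (K a)) • G (fun a => b (K a)) =
      ∑ I : Fin k → Fin 7, ∑ J : Fin k → Fin 7, (((∏ a, b (K a) (I a)) * ∏ a, b (K a) (J a)) *
        F (fun a => stdVec (I a))) • G (fun a => stdVec (J a)) := by
    intro K
    rw [hF (fun a => b (K a)), hG (fun a => b (K a)), Finset.sum_smul]
    refine Finset.sum_congr rfl fun I _ => ?_
    rw [Finset.smul_sum]
    refine Finset.sum_congr rfl fun J _ => ?_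
    rw [smul_smul]
    congr 1
    ring
  simp only [e, h]
  rw [eq_comm, Finset.sum_comm]
  refine Finset.sum_congr rfl fun I _ => ?_
  rw [Finset.sum_comm]
  refine Finset.sum_congr rfl fun J _ => ?_
  rw [Finset.sum_mul, Finset.sum_smul]

theorem insertVecs_add {l : ℕ} (k : ℕ) (w : Fin k → E7) (η η' : Form (l + k)) :
    insertVecs k w (η + η') = insertVecs k w η + insertVecs k w η' := by
  induction k with
  | zero => rfl
  | succ k ih => exact ih _ (η.curryLeft (w 0)) (η'.curryLeft (w 0))

theorem insertVecs_smul {l : ℕ} (k : ℕ) (w : Fin k → E7) (c : ℝ) (η : Form (l + k)) :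
    insertVecs k w (c • η) = c • insertVecs k w η := by
  induction k with
  | zero => rfl
  | succ k ih => exact ih _ (η.curryLeft (w 0))

/-- `insertVecs` as a linear map in the form. -/
def insertVecsL {l : ℕ} (k : ℕ) (w : Fin k → E7) : Form (l + k) →ₗ[ℝ] Form l where
  toFun := insertVecs k w
  map_add' := insertVecs_add k w
  map_smul' := insertVecs_smul k w

theorem insertVecs_eq_sum {l : ℕ} (k : ℕ) (w : Fin k → E7) (η : Form (l + k)) :
    insertVecs k w η = ∑ I : Fin k → Fin 7, (∏ a, w a (I a)) •
      insertVecs k (fun a => stdVec (I a)) η := by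
  induction k with
  | zero => simp [insertVecs]
  | succ k ih =>
    have h0 : η.curryLeft (w 0) = ∑ i, w 0 i • η.curryLeft (stdVec i) := by
      conv_lhs => rw [eq_sum_stdVec (w 0)]
      simp only [map_sum, map_smul]
    have h1 : insertVecs (k + 1) w η =
        ∑ i, w 0 i • insertVecs k (fun i => w i.succ) (η.curryLeft (stdVec i)) := by
      change insertVecsL k (fun i => w i.succ) (η.curryLeft (w 0)) = _
      rw [h0, map_sum]
      simp only [map_smul]
      rfl
    rw [h1, ← (Fin.consEquiv (fun _ : Fin (k + 1) => Fin 7)).sum_comp, Fintype.sum_prod_type]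
    refine Finset.sum_congr rfl fun i _ => ?_
    rw [ih, Finset.smul_sum]
    refine Finset.sum_congr rfl fun I _ => ?_
    rw [smul_smul, Fin.prod_univ_succ]
    simp [Fin.consEquiv, insertVecs]

/-- The basis of vectors that `L` maps to the standard basis: if `φ = L^* φ₀`, then it is
orthonormal for `g_φ`. -/
def adBasis (L : E7 ≃L[ℝ] E7) (i : Fin 7) : E7 := L.symm (stdVec i)

theorem formInner_comp (L : E7 ≃L[ℝ] E7) {k : ℕ} (α β : Form k) :
    formInner (phi0.compContinuousLinearMap (L : E7 →L[ℝ] E7)) α β =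
      (k.factorial : ℝ)⁻¹ * ∑ K : Fin k → Fin 7,
        α (fun a => adBasis L (K a)) * β (fun a => adBasis L (K a)) := by
  rw [formInner]
  congr 1
  exact contract_eq _ (adBasis L) (gram_inv_comp L) (fun v => α v) (fun v => β v)
    (form_apply_eq_sum α) (form_apply_eq_sum β)

theorem insertVecs_three {l : ℕ} (w : Fin 3 → E7) (η : Form (l + 3)) (v : Fin l → E7) :
    insertVecs 3 w η v =
      η (Matrix.vecCons (w 0) (Matrix.vecCons (w 1) (Matrix.vecCons (w 2) v))) := by
  simp only [insertVecs, ContinuousAlternatingMap.curryLeft_apply_apply]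
  rfl

/-- Transport of a form along an equality of degrees. -/
def castForm {m n : ℕ} (h : m = n) (η : Form m) : Form n := h ▸ η

theorem star_eq_sum (φ : Form 3) (b : Fin 7 → E7)
    (hc : ∀ i j, (gram φ)⁻¹ i j = ∑ m, b m i * b m j) {k l : ℕ} (h : 7 = l + k) (α : Form k) :
    star φ l h α = (k.factorial : ℝ)⁻¹ • ∑ K : Fin k → Fin 7, α (fun a => b (K a)) •
        insertVecs k (fun a => b (K a)) (castForm h (volForm φ)) := by
  rw [star]
  change (k.factorial : ℝ)⁻¹ • ∑ I : Fin k → Fin 7, ∑ J : Fin k → Fin 7,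
    ((∏ a, (gram φ)⁻¹ (I a) (J a)) * α (fun a => stdVec (I a))) •
      insertVecs k (fun a => stdVec (J a)) (castForm h (volForm φ)) = _
  generalize castForm h (volForm φ) = η
  exact congrArg _ (contract_eq _ b hc (fun v => α v)
    (fun v => insertVecs k v η) (form_apply_eq_sum α)
    (fun v => insertVecs_eq_sum k v η))

theorem castForm_apply {m n : ℕ} (h : m = n) (η : Form m) (v : Fin n → E7) :
    castForm h η v = η (fun i => v (Fin.cast h i)) := by
  subst h
  rfl

theorem top_form_adBasis (η : Form 7) (L : E7 ≃L[ℝ] E7) (I : Fin 7 → Fin 7) :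
    LinearMap.det ((L : E7 →L[ℝ] E7) : E7 →ₗ[ℝ] E7) * η (fun i => adBasis L (I i)) =
      η (fun i => stdVec (I i)) := by
  have h1 : (fun i => (L : E7 →L[ℝ] E7) (adBasis L (I i))) = fun i => stdVec (I i) :=
    funext fun i => L.apply_symm_apply (stdVec (I i))
  rw [← h1]
  exact (top_form_comp η L (fun i => adBasis L (I i))).symm

theorem volForm_adBasis (L : E7 ≃L[ℝ] E7) (I : Fin 7 → Fin 7) :
    volForm (phi0.compContinuousLinearMap (L : E7 →L[ℝ] E7)) (fun i => adBasis L (I i)) =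
      (eps (I 0) (I 1) (I 2) (I 3) (I 4) (I 5) (I 6) : ℝ) := by
  rw [volForm, volCoeff_comp, ContinuousAlternatingMap.smul_apply, smul_eq_mul, top_form_adBasis,
    detForm_stdVec]

theorem cons_three_cast {X : Type*} (f : Fin 7 → X) (K : Fin 3 → Fin 7) (J : Fin 4 → Fin 7)
    (h : 7 = 4 + 3) :
    (fun i : Fin 7 => (Matrix.vecCons (f (K 0)) (Matrix.vecCons (f (K 1))
      (Matrix.vecCons (f (K 2)) fun a => f (J a))) : Fin (4 + 3) → X) (Fin.cast h i)) =
    fun i => f (![K 0, K 1, K 2, J 0, J 1, J 2, J 3] i) := by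
  ext i
  fin_cases i <;> rfl

theorem insertVecs_castForm (η : Form 7) (f : Fin 7 → E7) (h : 7 = 4 + 3) (K : Fin 3 → Fin 7)
    (J : Fin 4 → Fin 7) :
    insertVecs 3 (fun a => f (K a)) (castForm h η) (fun a => f (J a)) =
      η (fun i => f (![K 0, K 1, K 2, J 0, J 1, J 2, J 3] i)) := by
  rw [insertVecs_three, castForm_apply, cons_three_cast]

theorem volForm_adBasis' (L : E7 ≃L[ℝ] E7) (K : Fin 3 → Fin 7) (J : Fin 4 → Fin 7) :
    volForm (phi0.compContinuousLinearMap (L : E7 →L[ℝ] E7))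
      (fun i => adBasis L (![K 0, K 1, K 2, J 0, J 1, J 2, J 3] i)) =
      (eps (K 0) (K 1) (K 2) (J 0) (J 1) (J 2) (J 3) : ℝ) := by
  rw [volForm_adBasis]
  rfl

/-- The Hodge star of a `3`-form in an adapted basis, computed with the Levi-Civita symbol. -/
theorem star_comp (L : E7 ≃L[ℝ] E7) (α : Form 3) (h : 7 = 4 + 3) (J : Fin 4 → Fin 7) :
    star (phi0.compContinuousLinearMap (L : E7 →L[ℝ] E7)) 4 h α (fun a => adBasis L (J a)) =
      (1 / 6) * ∑ K : Fin 3 → Fin 7, α (fun a => adBasis L (K a)) *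
        (eps (K 0) (K 1) (K 2) (J 0) (J 1) (J 2) (J 3) : ℝ) := by
  rw [star_eq_sum _ (adBasis L) (gram_inv_comp L), ContinuousAlternatingMap.smul_apply, smul_eq_mul,
    ContinuousAlternatingMap.sum_apply]
  congr 1
  · norm_num [Nat.factorial]
  refine Finset.sum_congr rfl fun K _ => ?_
  rw [ContinuousAlternatingMap.smul_apply, insertVecs_castForm, smul_eq_mul,
    volForm_adBasis']

/-! ### The torsion forms in terms of the torsion of the connection -/

theorem eForm_eq_det {k : ℕ} (I : Fin k → Fin 7) (v : Fin k → E7) :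
    eForm I v = (Matrix.of fun a b => v a (I b)).det := by
  rw [eForm_apply, Matrix.det_apply']
  rfl

/-- The first-row expansion of `α ∧ β` for a `1`-form `α`. -/
theorem wedge_one_three (α : Form 1) (β : Form 3) (v : Fin 4 → E7) :
    (wedge α β : Form (1 + 3)) v =
      ∑ i : Fin 4, (-1) ^ (i : ℕ) * α (fun _ => v i) * β (fun j => v (i.succAbove j)) := by
  have hα := form_eq_sum_eForm α
  have hβ := form_eq_sum_eForm β
  have key : ∀ (I : Fin 1 → Fin 7) (J : Fin 3 → Fin 7),
      (eForm (Fin.append I J) : Form (1 + 3)) v =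
      ∑ i : Fin 4, (-1) ^ (i : ℕ) * eForm I (fun _ => v i) *
        eForm J (fun j => v (i.succAbove j)) := by
    intro I J
    rw [eForm_eq_det]
    refine (Matrix.det_succ_column_zero (n := 3) _).trans ?_
    refine Finset.sum_congr rfl fun i _ => ?_
    rw [eForm_eq_det, eForm_eq_det, Matrix.det_fin_one]
    rfl
  have key2 : ∀ I : Fin 1 → Fin 7, (wedge (eForm I) β : Form (1 + 3)) v =
      ∑ i : Fin 4, (-1) ^ (i : ℕ) * eForm I (fun _ => v i) * β (fun j => v (i.succAbove j)) := by
    intro I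
    conv_lhs => rw [hβ]
    conv_rhs => rw [hβ]
    rw [wedge_smul_right, wedge_sum_right, ContinuousAlternatingMap.smul_apply,
      ContinuousAlternatingMap.sum_apply]
    simp only [ContinuousAlternatingMap.smul_apply, ContinuousAlternatingMap.sum_apply,
      wedge_smul_right, wedge_eForm, key, smul_eq_mul, Finset.mul_sum]
    rw [Finset.sum_comm]
    exact Finset.sum_congr rfl fun i _ => Finset.sum_congr rfl fun J _ => by ring
  conv_lhs => rw [hα]
  conv_rhs => rw [hα]
  rw [wedge_smul_left, wedge_sum_left, ContinuousAlternatingMap.smul_apply,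
    ContinuousAlternatingMap.sum_apply]
  simp only [ContinuousAlternatingMap.smul_apply, ContinuousAlternatingMap.sum_apply,
    wedge_smul_left, key2, smul_eq_mul, Finset.mul_sum, Finset.sum_mul]
  rw [Finset.sum_comm]
  exact Finset.sum_congr rfl fun i _ => Finset.sum_congr rfl fun J _ => by ring

/-- A product of two Levi-Civita symbols is a generalised Kronecker delta. -/
theorem eps_mul_eps (I J : Fin 7 → Fin 7) :
    (eps (I 0) (I 1) (I 2) (I 3) (I 4) (I 5) (I 6) : ℝ) *
      eps (J 0) (J 1) (J 2) (J 3) (J 4) (J 5) (J 6) =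
      (Matrix.of fun a b => if I a = J b then (1 : ℝ) else 0).det := by
  rw [eps_eq_det, eps_eq_det J, ← Matrix.det_transpose (Matrix.of fun a b => if J a = b then _ else _),
    ← Matrix.det_mul]
  congr 1
  ext a b
  simp [Matrix.mul_apply]

/-- A product of two Levi-Civita symbols with three common indices, all distinct from the
remaining indices `Q`. -/
theorem eps_mul_eps_three (K : Fin 3 → Fin 7) (J Q : Fin 4 → Fin 7) (hK : Function.Injective K)
    (hKQ : ∀ a b, K a ≠ Q b) :
    (eps (K 0) (K 1) (K 2) (J 0) (J 1) (J 2) (J 3) : ℝ) *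
      eps (K 0) (K 1) (K 2) (Q 0) (Q 1) (Q 2) (Q 3) = eForm Q (fun a => stdVec (J a)) := by
  have h := eps_mul_eps (Fin.append K J) (Fin.append K Q)
  refine h.trans ?_
  rw [eForm_eq_det, ← Matrix.det_reindex_self (finSumFinEquiv (m := 3) (n := 4)).symm]
  have h2 : Matrix.reindex (finSumFinEquiv (m := 3) (n := 4)).symm finSumFinEquiv.symm
      (Matrix.of fun a b => if Fin.append K J a = Fin.append K Q b then (1 : ℝ) else 0) =
      Matrix.fromBlocks 1 0 (Matrix.of fun a b => if J a = K b then (1 : ℝ) else 0)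
        (Matrix.of fun a b => stdVec (J a) (Q b)) := by
    have hl : ∀ (J : Fin 4 → Fin 7) (a : Fin 3),
        Fin.append K J (finSumFinEquiv (m := 3) (n := 4) (Sum.inl a)) = K a := Fin.append_left K
    have hr : ∀ (J : Fin 4 → Fin 7) (a : Fin 4),
        Fin.append K J (finSumFinEquiv (m := 3) (n := 4) (Sum.inr a)) = J a := Fin.append_right K
    ext a b
    rcases a with a | a <;> rcases b with b | b <;>
      simp only [Matrix.reindex_apply, Matrix.submatrix_apply, Equiv.symm_symm, Matrix.of_apply,
        hl, hr, Matrix.fromBlocks_apply₁₁, Matrix.fromBlocks_apply₁₂, Matrix.fromBlocks_apply₂₁,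
        Matrix.fromBlocks_apply₂₂, Matrix.one_apply, Matrix.zero_apply, hK.eq_iff, hKQ, if_false,
        stdVec_apply, eq_comm]
  rw [h2, Matrix.det_fromBlocks_zero₁₂, Matrix.det_one, one_mul]

theorem wedge_eForm_stdVec (α : Form 3) (J : Fin 4 → Fin 7) :
    (wedge α (eForm J) : Form (3 + 4)) stdVec = (1 / 6) * ∑ K : Fin 3 → Fin 7,
      α (fun a => stdVec (K a)) * (eps (K 0) (K 1) (K 2) (J 0) (J 1) (J 2) (J 3) : ℝ) := by
  conv_lhs => rw [form_eq_sum_eForm α]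
  rw [wedge_smul_left, wedge_sum_left, ContinuousAlternatingMap.smul_apply,
    ContinuousAlternatingMap.sum_apply, smul_eq_mul]
  congr 1
  · norm_num [Nat.factorial]
  refine Finset.sum_congr rfl fun K _ => ?_
  rw [wedge_smul_left, wedge_eForm, ContinuousAlternatingMap.smul_apply, smul_eq_mul, eForm_stdVec]
  rfl

/-- The index quadruples complementary to the seven triples of `φ₀`. -/
def quadIdx : Fin 7 → Fin 4 → Fin 7 :=
  ![![2, 3, 4, 5], ![1, 3, 5, 6], ![1, 2, 4, 6], ![0, 3, 4, 6], ![0, 2, 5, 6], ![0, 1, 4, 5],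
    ![0, 1, 2, 3]]

/-- The coefficients of `⋆φ₀` in `quadIdx`. -/
def quadSign : Fin 7 → ℤ := ![1, -1, 1, 1, 1, 1, 1]

/-- The model `4`-form `⋆φ₀`. -/
def psi0 : Form 4 := ∑ w : Fin 7, (quadSign w : ℝ) • eForm (quadIdx w)

theorem psi0_stdVec (J : Fin 4 → Fin 7) :
    psi0 (fun a => stdVec (J a)) = (wedge phi0 (eForm J) : Form (3 + 4)) stdVec := by
  rw [phi0_eq_sum, wedge_sum_left, psi0, ContinuousAlternatingMap.sum_apply,
    ContinuousAlternatingMap.sum_apply]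
  refine Finset.sum_congr rfl fun w _ => ?_
  rw [wedge_smul_left, ContinuousAlternatingMap.smul_apply, ContinuousAlternatingMap.smul_apply,
    wedge_eForm, eForm_stdVec]
  have h1 : Function.Injective (lineIdx w) := by
    revert w; decide
  have h2 : ∀ a b, lineIdx w a ≠ quadIdx w b := by
    revert w; decide
  have h3 : lineSign w * eps (lineIdx w 0) (lineIdx w 1) (lineIdx w 2) (quadIdx w 0) (quadIdx w 1)
      (quadIdx w 2) (quadIdx w 3) = quadSign w := by
    revert w; decide +kernel
  have h4 : lineSign w * lineSign w = 1 := by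
    revert w; decide
  have h5 : quadSign w * eps (lineIdx w 0) (lineIdx w 1) (lineIdx w 2) (quadIdx w 0) (quadIdx w 1)
      (quadIdx w 2) (quadIdx w 3) = lineSign w := by
    revert w; decide +kernel
  have h6 := eps_mul_eps_three (lineIdx w) J (quadIdx w) h1 h2
  rw [← h6, smul_eq_mul, smul_eq_mul]
  have h7 : (quadSign w : ℝ) * eps (lineIdx w 0) (lineIdx w 1) (lineIdx w 2) (quadIdx w 0)
      (quadIdx w 1) (quadIdx w 2) (quadIdx w 3) = lineSign w := by exact_mod_cast h5
  rw [mul_comm (eps (lineIdx w 0) (lineIdx w 1) (lineIdx w 2) (J 0) _ _ _ : ℝ), ← mul_assoc, h7]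
  rfl

/-! ### Quadratic identities for a `3`-form in seven dimensions -/

/-- The array is totally antisymmetric in its three indices. -/
def IsAlt3 (h : Fin 7 → Fin 7 → Fin 7 → ℝ) : Prop :=
  (∀ i j k, h i j k = -h j i k) ∧ (∀ i j k, h i j k = -h i k j)

/-- The totally antisymmetric array with the same entries as `t` at increasing indices. -/
def alt3 (t : Fin 7 → Fin 7 → Fin 7 → ℝ) (i j k : Fin 7) : ℝ :=
  if i < j ∧ j < k then t i j k else if j < k ∧ k < i then t j k i else
  if k < i ∧ i < j then t k i j else if j < i ∧ i < k then -t j i k else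
  if i < k ∧ k < j then -t i k j else if k < j ∧ j < i then -t k j i else 0

/-- An antisymmetric array is determined by its `35` independent entries; this reduces identities
in its entries to `ring`. -/
theorem IsAlt3.eq_alt3 {h : Fin 7 → Fin 7 → Fin 7 → ℝ} (hh : IsAlt3 h) : h = alt3 h := by
  have h0 : ∀ i k, h i i k = 0 := fun i k => by linarith [hh.1 i i k]
  have h1 : ∀ i k, h k i i = 0 := fun i k => by linarith [hh.2 k i i]
  have h2 : ∀ i k, h i k i = 0 := fun i k => by rw [hh.1, h1, neg_zero]
  funext i j k
  unfold alt3
  split_ifs with c1 c2 c3 c4 c5 c6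
  · rfl
  · rw [hh.1, hh.2, neg_neg]
  · rw [hh.2, hh.1, neg_neg]
  · exact hh.1 i j k
  · exact hh.2 i j k
  · rw [hh.1, hh.2, neg_neg, hh.1]
  · rcases eq_or_ne i j with rfl | hij
    · exact h0 _ _
    rcases eq_or_ne j k with rfl | hjk
    · exact h1 _ _
    rcases eq_or_ne i k with rfl | hik
    · exact h2 _ _
    exfalso
    rw [Ne, Fin.ext_iff] at hij hjk hik
    simp only [Fin.lt_def] at c1 c2 c3 c4 c5 c6
    omega

/-- Contraction of a skew matrix with `φ₀`: each `e_p ⌟ φ₀` has three terms. -/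
theorem sum_mul_phiC (X : Fin 7 → Fin 7 → ℝ) (hX : ∀ i j, X i j = -X j i) (p : Fin 7) :
    ∑ i, ∑ j, X i j * phiC i j p =
      2 * ∑ t : Fin 3, X (contrIdx p t 0) (contrIdx p t 1) := by
  simp only [Fin.sum_univ_seven, Fin.sum_univ_three]
  fin_cases p <;>
  · simp [phiC, phiZ, crossIdx, crossSign, contrIdx]
    linarith [hX 0 1, hX 0 2, hX 0 3, hX 0 4, hX 0 5, hX 0 6, hX 1 2, hX 1 3, hX 1 4, hX 1 5,
      hX 1 6, hX 2 3, hX 2 4, hX 2 5, hX 2 6, hX 3 4, hX 3 5, hX 3 6, hX 4 5, hX 4 6, hX 5 6]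

/-- The contraction `A_{kp} = ∑ h_{ijk} φ_{ijp}`. -/
def contrPhi (h : Fin 7 → Fin 7 → Fin 7 → ℝ) (k p : Fin 7) : ℝ := ∑ i, ∑ j, h i j k * phiC i j p

/-- The Lee form of the `3`-form with components `h`. -/
def leeC (h : Fin 7 → Fin 7 → Fin 7 → ℝ) (m : Fin 7) : ℝ :=
  (1 / 6) * ∑ k, ∑ p, contrPhi h k p * phiC k m p

theorem contrPhi_eq {h : Fin 7 → Fin 7 → Fin 7 → ℝ} (hh : IsAlt3 h) (k p : Fin 7) :
    contrPhi h k p = 2 * ∑ t : Fin 3, h (contrIdx p t 0) (contrIdx p t 1) k :=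
  sum_mul_phiC (fun i j => h i j k) (fun i j => hh.1 i j k) p

set_option maxHeartbeats 2000000 in
/-- The quadratic identity `¼ |A|² = 2 |h|² + |θ|² + ⟨h, φ₀⟩²` for the contraction `A` and the Lee
form `θ` of a `3`-form `h`; the trace of `A` is `6 ⟨h, φ₀⟩`. -/
theorem sum_contrPhi_sq {h : Fin 7 → Fin 7 → Fin 7 → ℝ} (hh : IsAlt3 h) :
    (1 / 4) * ∑ k, ∑ p, contrPhi h k p ^ 2 =
      2 * ((1 / 6) * ∑ i, ∑ j, ∑ k, h i j k ^ 2) + ∑ m, leeC h m ^ 2 +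
        ((1 / 6) * ∑ m, contrPhi h m m) ^ 2 := by
  simp only [leeC, contrPhi_eq hh]
  rw [hh.eq_alt3]
  generalize h = t
  simp only [Fin.sum_univ_seven, Fin.sum_univ_three]
  simp [phiC, phiZ, crossIdx, crossSign, contrIdx, alt3]
  ring

/-! ### The torsion forms `τ₀` and `τ₁` in components -/

/-- The components of `dφ`, where `φ` is parallel for a connection with torsion
`T_{ij}^n = h_{ijn}`. -/
def dphiC (h : Fin 7 → Fin 7 → Fin 7 → ℝ) (i j k l : Fin 7) : ℝ :=
  ∑ n, (h i j n * phiC n k l - h i k n * phiC n j l + h i l n * phiC n j k +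
    h j k n * phiC n i l - h j l n * phiC n i k + h k l n * phiC n i j)

theorem psi0_stdVec_eq (J : Fin 4 → Fin 7) : psi0 (fun a => stdVec (J a)) =
    ((∑ w : Fin 7, lineSign w * eps (lineIdx w 0) (lineIdx w 1) (lineIdx w 2)
      (J 0) (J 1) (J 2) (J 3) : ℤ) : ℝ) := by
  rw [psi0_stdVec, phi0_eq_sum, wedge_sum_left, ContinuousAlternatingMap.sum_apply]
  push_cast
  refine Finset.sum_congr rfl fun w _ => ?_
  rw [wedge_smul_left, ContinuousAlternatingMap.smul_apply, wedge_eForm, eForm_stdVec]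
  rfl

theorem psi0_quadIdx (w : Fin 7) : psi0 (fun a => stdVec (quadIdx w a)) = quadSign w := by
  rw [psi0_stdVec_eq]
  congr 1
  revert w
  decide +kernel

theorem psi0_cons_lineIdx (m w : Fin 7) :
    psi0 (fun a => stdVec ((Matrix.vecCons m (lineIdx w) : Fin 4 → Fin 7) a)) = 0 := by
  rw [psi0_stdVec_eq, Int.cast_eq_zero]
  revert m w
  decide +kernel

theorem wedge_phi0_quadIdx (α : Form 1) (w : Fin 7) :
    (wedge α phi0 : Form (1 + 3)) (fun a => stdVec (quadIdx w a)) = 0 := by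
  have h : ∀ w i, phiZ (quadIdx w (Fin.succAbove i 0)) (quadIdx w (Fin.succAbove i 1))
      (quadIdx w (Fin.succAbove i 2)) = 0 := by decide
  rw [wedge_one_three]
  refine Finset.sum_eq_zero fun i _ => ?_
  have h1 := phi0_stdVec fun j => quadIdx w (i.succAbove j)
  rw [h1, phiC, h]
  simp

theorem sum_lineSign_wedge_phi0 (α : Form 1) (m : Fin 7) :
    ∑ w, (lineSign w : ℝ) * (wedge α phi0 : Form (1 + 3))
      (fun a => stdVec ((Matrix.vecCons m (lineIdx w) : Fin 4 → Fin 7) a)) =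
      4 * α (fun _ => stdVec m) := by
  have h1 : ∀ w i, phi0 (fun j => stdVec ((Matrix.vecCons m (lineIdx w) : Fin 4 → Fin 7)
      (Fin.succAbove i j))) = phiC ((Matrix.vecCons m (lineIdx w) : Fin 4 → Fin 7)
      (Fin.succAbove i 0)) ((Matrix.vecCons m (lineIdx w) : Fin 4 → Fin 7)
      (Fin.succAbove i 1)) ((Matrix.vecCons m (lineIdx w) : Fin 4 → Fin 7)
      (Fin.succAbove i 2)) := fun w i =>
    phi0_stdVec fun j => (Matrix.vecCons m (lineIdx w) : Fin 4 → Fin 7) (i.succAbove j)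
  simp only [wedge_one_three, h1]
  generalize hA : (fun n => α fun _ => stdVec n) = A
  have hA' : ∀ n, (α fun _ => stdVec n) = A n := fun n => by rw [← hA]
  simp only [hA']
  clear hA hA' h1
  simp only [Fin.sum_univ_seven, Fin.sum_univ_four]
  fin_cases m <;>
  · simp [phiC, phiZ, crossIdx, crossSign, lineIdx, lineSign, Fin.succAbove]
    ring

theorem cmpSign_swap (i j : ℕ) : cmpSign i j = -cmpSign j i := by
  unfold cmpSign
  split_ifs <;> first | rfl | omega

theorem eps_move (a b c m x y z : Fin 7) : eps a b c m x y z = -eps a b c x y z m := by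
  simp only [eps, sgnList, List.foldr]
  rw [cmpSign_swap m x, cmpSign_swap m y, cmpSign_swap m z]
  ring

/-- If `α ∧ φ₀ = 0`, then `⋆α` has vanishing contraction with `φ₀`, because
`α ∧ φ₀ ∧ e^m = 0`. -/
theorem sum_lineSign_wedge_cons (α : Form 3) (hα : wedge α phi0 = 0) (m : Fin 7) :
    ∑ w, (lineSign w : ℝ) *
      (wedge α (eForm (Matrix.vecCons m (lineIdx w) : Fin 4 → Fin 7)) : Form (3 + 4)) stdVec = 0 := by
  -- expand `α ∧ φ₀ ∧ e^m = 0` and move the index `m` in front of `φ₀`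
  have h1 : (wedge (wedge α phi0) (eForm ![m]) : Form (3 + 3 + 1)) stdVec = 0 := by
    rw [hα]
    simp [← wedgeL_apply]
  have h2 : (wedge (wedge α phi0) (eForm ![m]) : Form (3 + 3 + 1)) stdVec =
      ∑ w, (lineSign w : ℝ) * ((1 / 6) * ∑ K : Fin 3 → Fin 7, α (fun a => stdVec (K a)) *
        (eps (K 0) (K 1) (K 2) (lineIdx w 0) (lineIdx w 1) (lineIdx w 2) m : ℝ)) := by
    rw [phi0_eq_sum, wedge_sum_right, wedge_sum_left, ContinuousAlternatingMap.sum_apply]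
    refine Finset.sum_congr rfl fun w _ => ?_
    rw [wedge_smul_right, wedge_smul_left, ContinuousAlternatingMap.smul_apply, smul_eq_mul]
    congr 1
    conv_lhs => rw [form_eq_sum_eForm α]
    rw [wedge_smul_left, wedge_sum_left, wedge_smul_left, wedge_sum_left,
      ContinuousAlternatingMap.smul_apply, ContinuousAlternatingMap.sum_apply, smul_eq_mul]
    congr 1
    · norm_num [Nat.factorial]
    refine Finset.sum_congr rfl fun K _ => ?_
    rw [wedge_smul_left, wedge_smul_left, wedge_eForm, wedge_eForm,
      ContinuousAlternatingMap.smul_apply, smul_eq_mul, eForm_stdVec]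
    rfl
  rw [h2] at h1
  rw [← neg_eq_zero, ← h1, ← Finset.sum_neg_distrib]
  refine Finset.sum_congr rfl fun w _ => ?_
  rw [wedge_eForm_stdVec, ← mul_neg, ← mul_neg, ← Finset.sum_neg_distrib]
  congr 2
  refine Finset.sum_congr rfl fun K _ => ?_
  rw [← mul_neg]
  congr 1
  have h3 := eps_move (K 0) (K 1) (K 2) m (lineIdx w 0) (lineIdx w 1) (lineIdx w 2)
  have h4 : -(eps (K 0) (K 1) (K 2) m (lineIdx w 0) (lineIdx w 1) (lineIdx w 2) : ℝ) =
      (eps (K 0) (K 1) (K 2) (lineIdx w 0) (lineIdx w 1) (lineIdx w 2) m : ℝ) := by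
    rw [h3, Int.cast_neg, neg_neg]
  exact h4

theorem sum_phiC_fst (X : Fin 7 → ℝ) (k l : Fin 7) :
    ∑ n, X n * phiC n k l = crossSign k l * X (crossIdx k l) := by
  have h : ∀ n k l, phiZ n k l = if n = crossIdx k l then crossSign k l else 0 := by
    decide
  simp [phiC, h, mul_comm]

theorem dphiC_eq (h : Fin 7 → Fin 7 → Fin 7 → ℝ) (i j k l : Fin 7) : dphiC h i j k l =
    crossSign k l * h i j (crossIdx k l) - crossSign j l * h i k (crossIdx j l) +
    crossSign j k * h i l (crossIdx j k) + crossSign i l * h j k (crossIdx i l) -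
    crossSign i k * h j l (crossIdx i k) + crossSign i j * h k l (crossIdx i j) := by
  simp only [dphiC, Finset.sum_add_distrib, Finset.sum_sub_distrib, sum_phiC_fst]

/-- Contraction of `dφ` with `⋆φ`. -/
theorem sum_quadSign_dphiC {h : Fin 7 → Fin 7 → Fin 7 → ℝ} (hh : IsAlt3 h) :
    ∑ w, (quadSign w : ℝ) *
      dphiC h (quadIdx w 0) (quadIdx w 1) (quadIdx w 2) (quadIdx w 3) =
      ∑ m, contrPhi h m m := by
  simp only [dphiC_eq, contrPhi_eq hh]
  rw [hh.eq_alt3]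
  simp only [Fin.sum_univ_seven, Fin.sum_univ_three]
  simp [crossIdx, crossSign, contrIdx, alt3, quadIdx, quadSign]
  ring

theorem sum_contrPhi_mul_phiC {h : Fin 7 → Fin 7 → Fin 7 → ℝ} (m : Fin 7) :
    leeC h m = (1 / 6) * ∑ k, crossSign k m * contrPhi h k (crossIdx k m) := by
  have h1 : ∀ p k m, phiZ k m p = if p = crossIdx k m then crossSign k m else 0 := by
    decide
  simp [leeC, phiC, h1, mul_comm]

set_option maxHeartbeats 1000000 in
/-- Contraction of `dφ` with `φ`. -/
theorem leeC_eq_dphiC {h : Fin 7 → Fin 7 → Fin 7 → ℝ} (hh : IsAlt3 h) (m : Fin 7) :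
    leeC h m = (1 / 3) * ∑ w, (lineSign w : ℝ) *
        dphiC h m (lineIdx w 0) (lineIdx w 1) (lineIdx w 2) := by
  rw [sum_contrPhi_mul_phiC]
  simp only [dphiC_eq, contrPhi_eq hh]
  rw [hh.eq_alt3]
  simp only [Fin.sum_univ_seven, Fin.sum_univ_three]
  fin_cases m <;>
  · simp [crossIdx, crossSign, contrIdx, alt3, lineIdx, lineSign]
    ring

theorem wedge_sum_smul_apply {k l n : ℕ} (α : Form k) (c : Fin n → ℝ) (β : Fin n → Form l)
    (v : Fin (k + l) → E7) :
    wedge α (∑ w, c w • β w) v = ∑ w, c w * wedge α (β w) v := by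
  rw [wedge_sum_right, ContinuousAlternatingMap.sum_apply]
  refine Finset.sum_congr rfl fun w _ => ?_
  rw [wedge_smul_right, ContinuousAlternatingMap.smul_apply, smul_eq_mul]

theorem wedge_psi0_eq_sum (α : Form 3) : (wedge α psi0 : Form (3 + 4)) stdVec =
    ∑ w, (quadSign w : ℝ) * (wedge α (eForm (quadIdx w)) : Form (3 + 4)) stdVec := by
  obtain ⟨b, hb⟩ : ∃ b : Fin 7 → Form 4, ∀ w, b w = eForm (quadIdx w) := ⟨_, fun w => rfl⟩
  obtain ⟨c, hc⟩ : ∃ c : Fin 7 → ℝ, ∀ w, c w = quadSign w := ⟨_, fun w => rfl⟩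
  have h : psi0 = ∑ w, c w • b w := by
    rw [psi0]
    exact Finset.sum_congr rfl fun w _ => by rw [hb, hc]
  rw [h, wedge_sum_smul_apply]
  exact Finset.sum_congr rfl fun w _ => by rw [hb, hc]

/-- Contraction of `dφ` with `⋆φ` isolates `τ₀`, since the terms `A` and `B` contract to zero. -/
theorem torsion_scalar {h : Fin 7 → Fin 7 → Fin 7 → ℝ} (hh : IsAlt3 h) (τ₀ : ℝ)
    (A B : (Fin 4 → Fin 7) → ℝ) (hA : ∀ w, A (quadIdx w) = 0)
    (hB : ∑ w, (quadSign w : ℝ) * B (quadIdx w) = 0)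
    (hd : ∀ J : Fin 4 → Fin 7, dphiC h (J 0) (J 1) (J 2) (J 3) =
      τ₀ * psi0 (fun a => stdVec (J a)) + 3 * A J + B J) :
    7 * τ₀ = ∑ m, contrPhi h m m := by
  rw [← sum_quadSign_dphiC hh]
  simp only [hd, psi0_quadIdx, hA, mul_add, Finset.sum_add_distrib, hB]
  simp only [Fin.sum_univ_seven]
  simp [quadSign]
  ring

/-- Contraction of `dφ` with `φ` isolates `τ₁`, since `⋆φ` and `B` contract to zero. -/
theorem torsion_lee {h : Fin 7 → Fin 7 → Fin 7 → ℝ} (hh : IsAlt3 h) (τ₀ : ℝ) (t : Fin 7 → ℝ)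
    (A B : (Fin 4 → Fin 7) → ℝ)
    (hA : ∀ m, ∑ w, (lineSign w : ℝ) * A (Matrix.vecCons m (lineIdx w)) = 4 * t m)
    (hB : ∀ m, ∑ w, (lineSign w : ℝ) * B (Matrix.vecCons m (lineIdx w)) = 0)
    (hd : ∀ J : Fin 4 → Fin 7, dphiC h (J 0) (J 1) (J 2) (J 3) =
      τ₀ * psi0 (fun a => stdVec (J a)) + 3 * A J + B J) (m : Fin 7) :
    4 * t m = leeC h m := by
  have e3 : ∀ w, dphiC h m (lineIdx w 0) (lineIdx w 1) (lineIdx w 2) =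
      3 * A (Matrix.vecCons m (lineIdx w)) + B (Matrix.vecCons m (lineIdx w)) := fun w => by
    have := hd (Matrix.vecCons m (lineIdx w))
    rw [psi0_cons_lineIdx, mul_zero, zero_add] at this
    exact this
  rw [leeC_eq_dphiC hh]
  simp only [e3, mul_add, Finset.sum_add_distrib, hB, add_zero]
  rw [← hA, Finset.mul_sum]
  exact Finset.sum_congr rfl fun w _ => by ring

/-- The components of `α ∧ φ₀`. -/
def wedgePhiC (α : Form 1) (J : Fin 4 → Fin 7) : ℝ :=
  (wedge α phi0 : Form (1 + 3)) fun a => stdVec (J a)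

/-- The components of `⋆α` for the standard metric. -/
def starC (α : Form 3) (J : Fin 4 → Fin 7) : ℝ := (wedge α (eForm J) : Form (3 + 4)) stdVec

theorem starC_quadIdx (τ₃ : Form 3) (h2 : (wedge τ₃ psi0 : Form (3 + 4)) stdVec = 0) :
    ∑ w, (quadSign w : ℝ) * starC τ₃ (quadIdx w) = 0 := by
  simp only [starC]
  rw [← wedge_psi0_eq_sum, h2]

theorem starC_lineIdx (τ₃ : Form 3) (h1 : wedge τ₃ phi0 = 0) (m : Fin 7) :
    ∑ w, (lineSign w : ℝ) * starC τ₃ (Matrix.vecCons m (lineIdx w)) = 0 := by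
  simp only [starC]
  rw [sum_lineSign_wedge_cons τ₃ h1]

theorem wedgePhiC_quadIdx (α : Form 1) (w : Fin 7) : wedgePhiC α (quadIdx w) = 0 := by
  rw [wedgePhiC, wedge_phi0_quadIdx]

theorem wedgePhiC_lineIdx (α : Form 1) (m : Fin 7) :
    ∑ w, (lineSign w : ℝ) * wedgePhiC α (Matrix.vecCons m (lineIdx w)) =
      4 * α (fun _ => stdVec m) := by
  simp only [wedgePhiC]
  rw [sum_lineSign_wedge_phi0]

/-- Contraction of `dφ = τ₀ ⋆φ + 3 τ₁ ∧ φ + ⋆τ₃` with `⋆φ` and with `φ`. -/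
theorem torsion_components {h : Fin 7 → Fin 7 → Fin 7 → ℝ} (hh : IsAlt3 h) (τ₀ : ℝ) (τ₁ : Form 1)
    (τ₃ : Form 3) (h1 : wedge τ₃ phi0 = 0) (h2 : (wedge τ₃ psi0 : Form (3 + 4)) stdVec = 0)
    (hd : ∀ J : Fin 4 → Fin 7, dphiC h (J 0) (J 1) (J 2) (J 3) =
      τ₀ * psi0 (fun a => stdVec (J a)) + 3 * wedgePhiC τ₁ J + starC τ₃ J) :
    7 * τ₀ = ∑ m, contrPhi h m m ∧ ∀ m, 4 * τ₁ (fun _ => stdVec m) = leeC h m :=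
  ⟨torsion_scalar hh τ₀ (wedgePhiC τ₁) (starC τ₃) (wedgePhiC_quadIdx τ₁) (starC_quadIdx τ₃ h2) hd,
    torsion_lee hh τ₀ (fun m => τ₁ fun _ => stdVec m) (wedgePhiC τ₁) (starC τ₃)
      (wedgePhiC_lineIdx τ₁) (starC_lineIdx τ₃ h1) hd⟩

/-! ### Contractions of the first Bianchi identity -/

theorem phiC_swap (i j k : Fin 7) : phiC i j k = -phiC j i k := by
  have h : ∀ i j k, phiZ i j k = -phiZ j i k := by decide
  rw [phiC, h, Int.cast_neg, phiC]

theorem phiC_rot (i j k : Fin 7) : phiC i j k = phiC j k i := by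
  have h : ∀ i j k, phiZ i j k = phiZ j k i := by decide
  rw [phiC, h, phiC]

theorem sum_rot (F : Fin 7 → Fin 7 → Fin 7 → ℝ) :
    ∑ i, ∑ j, ∑ k, F i j k = ∑ i, ∑ j, ∑ k, F j k i := by
  rw [Finset.sum_comm]
  rw [Finset.sum_congr rfl fun j _ => Finset.sum_comm]
  rw [Finset.sum_comm]
  exact Finset.sum_congr rfl fun k _ => Finset.sum_comm

theorem sum_swap (F : Fin 7 → Fin 7 → Fin 7 → ℝ) :
    ∑ i, ∑ j, ∑ k, F i j k = ∑ i, ∑ j, ∑ k, F j i k := Finset.sum_comm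

/-- The torsion term in the first Bianchi identity, and half the torsion term in `dH`:
`q_{ijkl} = H(T_{ij}, e_k, e_l) + H(T_{jk}, e_i, e_l) + H(T_{ki}, e_j, e_l)`. -/
def torsionSq (h : Fin 7 → Fin 7 → Fin 7 → ℝ) (i j k l : Fin 7) : ℝ :=
  ∑ m, (h i j m * h m k l + h j k m * h m i l + h k i m * h m j l)

/-- The torsion term changes sign under a cyclic rotation of its four indices. -/
theorem torsionSq_rot_neg {h : Fin 7 → Fin 7 → Fin 7 → ℝ} (hh : IsAlt3 h) (i j k l : Fin 7) :
    torsionSq h j k l i = -torsionSq h i j k l := by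
  rw [torsionSq, torsionSq, ← Finset.sum_neg_distrib]
  refine Finset.sum_congr rfl fun m _ => ?_
  have rot : ∀ a b c, h a b c = h b c a := fun a b c => by rw [hh.1, hh.2, neg_neg]
  have e1 := hh.1 l j m
  have e2 := rot m l i
  have e3 := rot m j i
  have e4 := rot m k i
  have e5 := hh.1 i l m
  have e6 := rot m k l
  have e7 := rot m i l
  have e8 := rot m j l
  have e9 := hh.1 k i m
  have e10 := hh.1 l i m
  have e11 := hh.1 j i m
  rw [e1, e2, e3, e4, e6, e7, e8, e9, e10, e11]
  ring

/-- If the curvature `R` takes values in `𝔤₂` and `dH = 0`, then the contraction of `∇H` with `φ`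
vanishes. -/
theorem sum_nabla_mul_phiC {h : Fin 7 → Fin 7 → Fin 7 → ℝ} (hh : IsAlt3 h)
    {N R : Fin 7 → Fin 7 → Fin 7 → Fin 7 → ℝ} (hN : ∀ i, IsAlt3 (N i))
    (dH : ∀ i j k l, N i j k l - N j i k l + N k i j l - N l i j k +
      2 * torsionSq h i j k l = 0)
    (bianchi : ∀ i j k l, R i j k l + R j k i l + R k i j l =
      N i j k l + N j k i l + N k i j l + torsionSq h i j k l)
    (R1 : ∀ i j k l, R i j k l = -R j i k l) (R2 : ∀ i j k l, R i j k l = -R i j l k)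
    (R3 : ∀ i j m, ∑ k, ∑ l, R i j k l * phiC k l m = 0) (i : Fin 7) :
    ∑ j, ∑ k, ∑ l, N i j k l * phiC j k l = 0 := by
  have rot : ∀ i a b c, N i a b c = N i b c a := fun i a b c => by
    rw [(hN i).1, (hN i).2, neg_neg]
  have bia : ∀ i j k l, R i j k l + R j k i l + R k i j l = N l i j k - torsionSq h i j k l := by
    intro i j k l
    rw [bianchi, (hN j).1]
    linarith [dH i j k l]
  set a := ∑ j, ∑ k, ∑ l, N i j k l * phiC j k l with ha
  set d := ∑ j, ∑ k, ∑ l, N l i j k * phiC j k l with hd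
  set Q := ∑ j, ∑ k, ∑ l, torsionSq h i j k l * phiC j k l with hQ
  set r := ∑ j, ∑ k, ∑ l, R j k i l * phiC j k l with hr
  have e1 : a - d - d - d + 2 * Q = 0 := by
    have s1 : ∑ j, ∑ k, ∑ l, N j i k l * phiC j k l = d := by
      rw [hd, sum_rot fun j k l => N l i j k * phiC j k l]
      exact Finset.sum_congr rfl fun x _ => Finset.sum_congr rfl fun y _ =>
        Finset.sum_congr rfl fun z _ => by rw [phiC_rot]
    have s2 : ∑ j, ∑ k, ∑ l, N k i j l * phiC j k l = -d := by
      rw [sum_swap, ← s1]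
      simp only [← Finset.sum_neg_distrib]
      exact Finset.sum_congr rfl fun x _ => Finset.sum_congr rfl fun y _ =>
        Finset.sum_congr rfl fun z _ => by rw [phiC_swap]; ring
    have s3 : ∑ j, ∑ k, ∑ l, (N i j k l - N j i k l + N k i j l - N l i j k +
        2 * torsionSq h i j k l) * phiC j k l = 0 := by simp [dH]
    simp only [add_mul, sub_mul, Finset.sum_add_distrib, Finset.sum_sub_distrib, mul_assoc,
      ← Finset.mul_sum] at s3
    rw [s1, s2] at s3
    linarith
  have e2 : r = d - Q := by
    have s1 : ∀ j, ∑ k, ∑ l, R i j k l * phiC j k l = 0 := fun j => by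
      rw [← R3 i j j]
      exact Finset.sum_congr rfl fun y _ => Finset.sum_congr rfl fun z _ => by
        rw [phiC_rot]
    have s2 : ∑ j, ∑ k, ∑ l, R k i j l * phiC j k l = 0 := by
      rw [sum_swap]
      refine Finset.sum_eq_zero fun x _ => ?_
      rw [← s1 x]
      exact Finset.sum_congr rfl fun y _ => Finset.sum_congr rfl fun z _ => by
        rw [R1, phiC_swap]; ring
    have s3 : ∑ j, ∑ k, ∑ l, (R i j k l + R j k i l + R k i j l) * phiC j k l =
        ∑ j, ∑ k, ∑ l, (N l i j k - torsionSq h i j k l) * phiC j k l := by simp only [bia]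
    simp only [add_mul, sub_mul, Finset.sum_add_distrib, Finset.sum_sub_distrib] at s3
    rw [s2] at s3
    simp only [s1] at s3
    simpa using s3
  have e3 : -(3 * r) = a + Q := by
    have s0 : ∑ j, ∑ k, ∑ l, R j k l i * phiC j k l = -r := by
      rw [hr]
      simp only [← Finset.sum_neg_distrib]
      exact Finset.sum_congr rfl fun x _ => Finset.sum_congr rfl fun y _ =>
        Finset.sum_congr rfl fun z _ => by rw [R2]; ring
    have s1 : ∑ j, ∑ k, ∑ l, R k l j i * phiC j k l = -r := by
      rw [← s0, sum_rot fun j k l => R j k l i * phiC j k l]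
      exact Finset.sum_congr rfl fun x _ => Finset.sum_congr rfl fun y _ =>
        Finset.sum_congr rfl fun z _ => by rw [phiC_rot]
    have s2 : ∑ j, ∑ k, ∑ l, R l j k i * phiC j k l = -r := by
      rw [← s1, sum_rot fun j k l => R k l j i * phiC j k l]
      exact Finset.sum_congr rfl fun x _ => Finset.sum_congr rfl fun y _ =>
        Finset.sum_congr rfl fun z _ => by rw [phiC_rot]
    have s3 : ∑ j, ∑ k, ∑ l, (R j k l i + R k l j i + R l j k i) * phiC j k l =
        ∑ j, ∑ k, ∑ l, (N i j k l - -torsionSq h i j k l) * phiC j k l := by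
      exact Finset.sum_congr rfl fun j _ => Finset.sum_congr rfl fun k _ =>
        Finset.sum_congr rfl fun l _ => by rw [bia, torsionSq_rot_neg hh]
    simp only [add_mul, sub_mul, neg_mul, Finset.sum_add_distrib, Finset.sum_sub_distrib,
      Finset.sum_neg_distrib] at s3
    rw [s0, s1, s2] at s3
    linarith
  linarith

/-! ### The divergence of the Lee form -/

/-- The components of `⋆φ₀`, through
`∑_p φ_{ijp} φ_{klp} = δ_{ik} δ_{jl} - δ_{il} δ_{jk} + (⋆φ)_{ijkl}`. -/
def psiC (i j k l : Fin 7) : ℝ :=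
  ((∑ p, phiZ i j p * phiZ k l p - dZ i k * dZ j l + dZ i l * dZ j k : ℤ) : ℝ)

theorem psiC_swap12 (i j k l : Fin 7) : psiC i j k l = -psiC j i k l := by
  have h : ∀ i j k l, (∑ p, phiZ i j p * phiZ k l p - dZ i k * dZ j l + dZ i l * dZ j k : ℤ) =
    -(∑ p, phiZ j i p * phiZ k l p - dZ j k * dZ i l + dZ j l * dZ i k) := by decide +kernel
  rw [psiC, h, Int.cast_neg, psiC]

theorem psiC_swap23 (i j k l : Fin 7) : psiC i j k l = -psiC i k j l := by
  have h : ∀ i j k l, (∑ p, phiZ i j p * phiZ k l p - dZ i k * dZ j l + dZ i l * dZ j k : ℤ) =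
    -(∑ p, phiZ i k p * phiZ j l p - dZ i j * dZ k l + dZ i l * dZ k j) := by decide +kernel
  rw [psiC, h, Int.cast_neg, psiC]

theorem psiC_swap34 (i j k l : Fin 7) : psiC i j k l = -psiC i j l k := by
  have h : ∀ i j k l, (∑ p, phiZ i j p * phiZ k l p - dZ i k * dZ j l + dZ i l * dZ j k : ℤ) =
    -(∑ p, phiZ i j p * phiZ l k p - dZ i l * dZ j k + dZ i k * dZ j l) := by decide +kernel
  rw [psiC, h, Int.cast_neg, psiC]

/-- The contraction identity for `φ₀`, which is the definition of the components of `⋆φ₀`. -/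
theorem sum_phiC_mul_phiC (i j k l : Fin 7) : ∑ p, phiC i j p * phiC k l p =
    psiC i j k l + (dZ i k * dZ j l : ℝ) - (dZ i l * dZ j k : ℝ) := by
  rw [psiC]
  push_cast
  simp only [phiC]
  ring

/-- The Lee form of `h` as the contraction of `h` with `⋆φ₀`. -/
theorem leeC_eq_psiC {h : Fin 7 → Fin 7 → Fin 7 → ℝ} (hh : IsAlt3 h) (m : Fin 7) :
    leeC h m = -(1 / 6) * ∑ i, ∑ j, ∑ k, h i j k * psiC m i j k := by
  have h0 : ∀ i j, h i j i = 0 := fun i j => by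
    have := hh.1 i j i; have := hh.2 j i i; have := hh.1 j i i; linarith
  have h1 : ∀ i j, h i j j = 0 := fun i j => by linarith [hh.2 i j j]
  have e1 : ∑ k, ∑ p, contrPhi h k p * phiC k m p =
      ∑ k, ∑ i, ∑ j, h i j k * ∑ p, phiC i j p * phiC k m p := by
    refine Finset.sum_congr rfl fun k _ => ?_
    simp only [contrPhi, Finset.sum_mul]
    rw [Finset.sum_comm]
    refine Finset.sum_congr rfl fun i _ => ?_
    rw [Finset.sum_comm]
    refine Finset.sum_congr rfl fun j _ => ?_
    rw [Finset.mul_sum]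
    exact Finset.sum_congr rfl fun p _ => by ring
  have e2 : ∀ i j k, h i j k * ∑ p, phiC i j p * phiC k m p = -(h i j k * psiC m i j k) := by
    intro i j k
    rw [sum_phiC_mul_phiC, psiC_swap34, psiC_swap23, psiC_swap12]
    by_cases c1 : i = k
    · subst c1; simp [h0]
    by_cases c2 : j = k
    · subst c2; simp [h1]
    simp [dZ, c1, c2]
  rw [leeC, e1]
  simp only [e2, Finset.sum_neg_distrib]
  rw [sum_rot fun k i j => h i j k * psiC m i j k]
  rw [sum_rot]
  ring

theorem sum_rot4 (F : Fin 7 → Fin 7 → Fin 7 → Fin 7 → ℝ) :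
    ∑ i, ∑ j, ∑ k, ∑ l, F i j k l = ∑ i, ∑ j, ∑ k, ∑ l, F l i j k := by
  rw [Finset.sum_comm]
  refine Finset.sum_congr rfl fun j _ => ?_
  rw [Finset.sum_comm]
  refine Finset.sum_congr rfl fun k _ => ?_
  rw [Finset.sum_comm]

/-- The quadratic form `⟨X ∧ X, ⋆φ₀⟩` on skew matrices, up to a constant, in terms of the
contraction with `φ₀`. -/
theorem sum_mul_mul_psiC (X : Fin 7 → Fin 7 → ℝ) (hX : ∀ i j, X i j = -X j i) :
    ∑ i, ∑ j, ∑ k, ∑ l, X i j * X k l * psiC i j k l =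
      ∑ p, (∑ i, ∑ j, X i j * phiC i j p) ^ 2 - 2 * ∑ i, ∑ j, X i j ^ 2 := by
  have e1 : ∀ i j k l, X i j * X k l * psiC i j k l =
      ∑ p, (X i j * phiC i j p) * (X k l * phiC k l p) -
      X i j * X k l * dZ i k * dZ j l + X i j * X k l * dZ i l * dZ j k := by
    intro i j k l
    have := sum_phiC_mul_phiC i j k l
    rw [show psiC i j k l = ∑ p, phiC i j p * phiC k l p - (dZ i k * dZ j l : ℝ) +
      (dZ i l * dZ j k : ℝ) by linarith, mul_add, mul_sub, Finset.mul_sum]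
    congr 1
    · congr 1
      · exact Finset.sum_congr rfl fun p _ => by ring
      · ring
    · ring
  have e2 : ∀ i j, ∑ k, ∑ l, X i j * X k l * dZ i k * dZ j l = X i j ^ 2 := by
    intro i j
    simp [dZ, sq]
  have e3 : ∀ i j, ∑ k, ∑ l, X i j * X k l * dZ i l * dZ j k = -X i j ^ 2 := by
    intro i j
    simp [dZ, sq, hX j i]
  have e4 : ∑ i, ∑ j, ∑ k, ∑ l, ∑ p, (X i j * phiC i j p) * (X k l * phiC k l p) =
      ∑ p, (∑ i, ∑ j, X i j * phiC i j p) ^ 2 := by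
    simp only [sq, Finset.sum_mul, Finset.mul_sum]
    symm
    rw [Finset.sum_comm]
    refine Finset.sum_congr rfl fun i _ => ?_
    rw [Finset.sum_comm]
    refine Finset.sum_congr rfl fun j _ => ?_
    rw [Finset.sum_comm]
    refine Finset.sum_congr rfl fun k _ => ?_
    rw [Finset.sum_comm]
    exact Finset.sum_congr rfl fun l _ => Finset.sum_congr rfl fun p _ => mul_comm _ _
  simp only [e1, Finset.sum_add_distrib, Finset.sum_sub_distrib, e4]
  simp only [e2, e3, Finset.sum_neg_distrib]
  ring

/-- The divergence of the Lee form: contraction of `dH = 0` with `⋆φ` gives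
`∑ ∇_m θ_m = ¼ |A|² - 3 |h|²`. -/
theorem sum_leeC_nabla {h : Fin 7 → Fin 7 → Fin 7 → ℝ} (hh : IsAlt3 h)
    {N : Fin 7 → Fin 7 → Fin 7 → Fin 7 → ℝ} (hN : ∀ i, IsAlt3 (N i))
    (dH : ∀ i j k l, N i j k l - N j i k l + N k i j l - N l i j k +
      2 * torsionSq h i j k l = 0) :
    ∑ m, leeC (N m) m = (1 / 4) * ∑ k, ∑ p, contrPhi h k p ^ 2 -
      3 * ((1 / 6) * ∑ i, ∑ j, ∑ k, h i j k ^ 2) := by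
  have prot : ∀ i j k l, psiC i j k l = psiC j k i l := fun i j k l => by
    rw [psiC_swap12, psiC_swap23, neg_neg]
  have hrot : ∀ a b c, h a b c = h b c a := fun a b c => by rw [hh.1, hh.2, neg_neg]
  set S := ∑ i, ∑ j, ∑ k, ∑ l, N i j k l * psiC i j k l with hS
  set Z := ∑ i, ∑ j, ∑ k, ∑ l, (∑ m, h i j m * h m k l) * psiC i j k l with hZ
  have s1 : ∑ i, ∑ j, ∑ k, ∑ l, N j i k l * psiC i j k l = -S := by
    rw [Finset.sum_comm, hS]
    simp only [← Finset.sum_neg_distrib]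
    exact Finset.sum_congr rfl fun i _ => Finset.sum_congr rfl fun j _ =>
      Finset.sum_congr rfl fun k _ => Finset.sum_congr rfl fun l _ => by
        rw [psiC_swap12]; ring
  have s2 : ∑ i, ∑ j, ∑ k, ∑ l, N k i j l * psiC i j k l = S := by
    rw [sum_rot fun i j k => ∑ l, N k i j l * psiC i j k l, hS]
    exact Finset.sum_congr rfl fun i _ => Finset.sum_congr rfl fun j _ =>
      Finset.sum_congr rfl fun k _ => Finset.sum_congr rfl fun l _ => by
        rw [← prot]
  have s3 : ∑ i, ∑ j, ∑ k, ∑ l, N l i j k * psiC i j k l = -S := by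
    rw [hS, sum_rot4 fun i j k l => N i j k l * psiC i j k l]
    simp only [← Finset.sum_neg_distrib]
    exact Finset.sum_congr rfl fun i _ => Finset.sum_congr rfl fun j _ =>
      Finset.sum_congr rfl fun k _ => Finset.sum_congr rfl fun l _ => by
        rw [psiC_swap12 l, psiC_swap23 i l, psiC_swap34 i j l]; ring
  have z2 : ∑ i, ∑ j, ∑ k, ∑ l, (∑ m, h j k m * h m i l) * psiC i j k l = Z := by
    rw [hZ, sum_rot fun i j k => ∑ l, (∑ m, h i j m * h m k l) * psiC i j k l]
    exact Finset.sum_congr rfl fun i _ => Finset.sum_congr rfl fun j _ =>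
      Finset.sum_congr rfl fun k _ => Finset.sum_congr rfl fun l _ => by
        rw [prot i j k]
  have z3 : ∑ i, ∑ j, ∑ k, ∑ l, (∑ m, h k i m * h m j l) * psiC i j k l = Z := by
    rw [← z2, sum_rot fun i j k => ∑ l, (∑ m, h j k m * h m i l) * psiC i j k l]
    exact Finset.sum_congr rfl fun i _ => Finset.sum_congr rfl fun j _ =>
      Finset.sum_congr rfl fun k _ => Finset.sum_congr rfl fun l _ => by
        rw [prot i j k]
  have e1 : 4 * S + 2 * (3 * Z) = 0 := by
    have s4 : ∑ i, ∑ j, ∑ k, ∑ l, (N i j k l - N j i k l + N k i j l - N l i j k +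
        2 * torsionSq h i j k l) * psiC i j k l = 0 := by simp [dH]
    simp only [torsionSq, Finset.sum_add_distrib, mul_add, add_mul, sub_mul,
      Finset.sum_sub_distrib, mul_assoc (2 : ℝ), ← Finset.mul_sum (a := (2 : ℝ))] at s4
    rw [s1, s2, s3, z2, z3, ← hZ, ← hS] at s4
    linarith
  have e2 : Z = ∑ k, ∑ p, contrPhi h k p ^ 2 - 2 * ∑ i, ∑ j, ∑ k, h i j k ^ 2 := by
    have z4 : Z = ∑ m, ∑ i, ∑ j, ∑ k, ∑ l, h i j m * h k l m * psiC i j k l := by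
      simp only [hZ, Finset.sum_mul]
      symm
      rw [Finset.sum_comm]
      refine Finset.sum_congr rfl fun i _ => ?_
      rw [Finset.sum_comm]
      refine Finset.sum_congr rfl fun j _ => ?_
      rw [Finset.sum_comm]
      refine Finset.sum_congr rfl fun k _ => ?_
      rw [Finset.sum_comm]
      exact Finset.sum_congr rfl fun l _ => Finset.sum_congr rfl fun m _ => by rw [hrot m k l]
    rw [z4, sum_rot fun i j k => h i j k ^ 2,
      sum_rot fun i j k => h j k i ^ 2]
    simp only [contrPhi]
    rw [Finset.mul_sum, ← Finset.sum_sub_distrib]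
    refine Finset.sum_congr rfl fun m _ => ?_
    rw [sum_mul_mul_psiC (fun i j => h i j m) fun i j => hh.1 i j m]
    congr 2
    exact Finset.sum_congr rfl fun i _ => Finset.sum_congr rfl fun j _ => by rw [hrot i j, hrot j m]
  have e3 : ∑ m, leeC (N m) m = -(1 / 6) * S := by
    simp only [leeC_eq_psiC (hN _), hS, Finset.mul_sum]
  rw [e3]
  linarith

/-! ### The stabiliser algebra of `φ₀` -/

/-- For given `b` and `c` the only nonzero `φ_{lbc}` is the one with `e_l = ± e_b × e_c`. -/
theorem stabilizer_eq {r : Fin 7 → Fin 7 → ℝ}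
    (hr : ∀ a b c, ∑ l, r a l * phiC l b c + ∑ l, r b l * phiC a l c + ∑ l, r c l * phiC a b l = 0)
    (a b c : Fin 7) :
    crossSign b c * r a (crossIdx b c) + crossSign c a * r b (crossIdx c a) +
      crossSign a b * r c (crossIdx a b) = 0 := by
  have h := hr a b c
  have h1 : ∀ l, phiC a l c = phiC l c a := fun l => phiC_rot a l c
  have h2 : ∀ l, phiC a b l = phiC l a b := fun l => by rw [phiC_rot, phiC_rot]
  simp only [h1, h2, sum_phiC_fst] at h
  exact h

set_option maxHeartbeats 1000000 in
/-- An endomorphism that annihilates `φ₀` is skew: `𝔤₂ ⊆ 𝔰𝔬(7)`. -/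
theorem stabilizer_skew {r : Fin 7 → Fin 7 → ℝ}
    (hr : ∀ a b c, ∑ l, r a l * phiC l b c + ∑ l, r b l * phiC a l c + ∑ l, r c l * phiC a b l = 0)
    (k l : Fin 7) : r k l = -r l k := by
  have e := stabilizer_eq hr
  rcases eq_or_ne k l with rfl | hkl
  · have t1 := e 0 1 6; have t2 := e 0 2 4; have t3 := e 0 3 5; have t4 := e 1 2 5
    have t5 := e 1 3 4; have t6 := e 2 3 6; have t7 := e 4 5 6
    simp [crossSign, crossIdx] at t1 t2 t3 t4 t5 t6 t7
    clear e hr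
    fin_cases k <;> simp only [Fin.reduceFinMk, Fin.zero_eta, Fin.mk_one] <;> linarith
  · have t1 := e k (contrIdx l 0 0) (contrIdx l 0 1)
    have t2 := e k (contrIdx l 1 0) (contrIdx l 1 1)
    have t3 := e k (contrIdx l 2 0) (contrIdx l 2 1)
    have t4 := e l (contrIdx k 0 0) (contrIdx k 0 1)
    have t5 := e l (contrIdx k 1 0) (contrIdx k 1 1)
    have t6 := e l (contrIdx k 2 0) (contrIdx k 2 1)
    clear e hr
    revert hkl t1 t2 t3 t4 t5 t6
    fin_cases k <;> fin_cases l <;> simp [crossSign, crossIdx, contrIdx] <;> intros <;> linarith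

set_option maxHeartbeats 1000000 in
/-- An endomorphism that annihilates `φ₀` has vanishing contraction with `φ₀`: in
`Λ² = Λ²₇ ⊕ Λ²₁₄` it lies in `𝔤₂ = Λ²₁₄`. -/
theorem stabilizer_contract {r : Fin 7 → Fin 7 → ℝ}
    (hr : ∀ a b c, ∑ l, r a l * phiC l b c + ∑ l, r b l * phiC a l c + ∑ l, r c l * phiC a b l = 0)
    (m : Fin 7) : ∑ k, ∑ l, r k l * phiC k l m = 0 := by
  rw [sum_mul_phiC r (stabilizer_skew hr)]
  have e := stabilizer_eq hr
  have s := stabilizer_skew hr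
  have t1 := e 0 1 2; have t2 := e 0 1 3; have t3 := e 0 1 4; have t4 := e 0 1 5
  have t6 := e 0 2 3; have t8 := e 0 2 5
  have t9 := e 0 2 6; have t10 := e 0 3 4; have t11 := e 1 2 3; have t12 := e 1 2 4
  have t13 := e 1 3 5; have t14 := e 1 4 5; have t15 := e 1 4 6
  simp [crossSign, crossIdx] at t1 t2 t3 t4 t6 t8 t9 t10 t11 t12 t13 t14 t15
  have s1 := s 1 0; have s2 := s 2 0; have s3 := s 3 0; have s4 := s 4 0; have s5 := s 5 0
  have s6 := s 6 0; have s7 := s 2 1; have s8 := s 3 1; have s9 := s 4 1; have s10 := s 5 1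
  have s11 := s 6 1; have s12 := s 3 2; have s13 := s 4 2; have s14 := s 5 2; have s15 := s 6 2
  have s16 := s 4 3; have s17 := s 5 3; have s18 := s 6 3; have s19 := s 5 4; have s20 := s 6 4
  have s21 := s 6 5
  simp only [Fin.sum_univ_three]
  clear e s hr
  fin_cases m <;> simp [contrIdx] <;> linarith

/-! ### The torsion forms in an adapted basis -/

theorem phi0_comp_adBasis (L : E7 ≃L[ℝ] E7) (I : Fin 3 → Fin 7) :
    (phi0.compContinuousLinearMap (L : E7 →L[ℝ] E7)) (fun a => adBasis L (I a)) =
      phiC (I 0) (I 1) (I 2) := by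
  rw [ContinuousAlternatingMap.compContinuousLinearMap_apply, ← phi0_stdVec]
  congr 1
  funext a
  exact L.apply_symm_apply _

/-- Pullback by the inverse of an adapted frame. -/
def pull (L : E7 ≃L[ℝ] E7) {k : ℕ} (α : Form k) : Form k :=
  α.compContinuousLinearMap (L.symm : E7 →L[ℝ] E7)

theorem pull_comp (L : E7 ≃L[ℝ] E7) {k : ℕ} (α : Form k) :
    pull L (α.compContinuousLinearMap (L : E7 →L[ℝ] E7)) = α := by
  ext v
  simp only [pull, ContinuousAlternatingMap.compContinuousLinearMap_apply]
  congr 1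
  funext i
  exact L.apply_symm_apply _

theorem pull_stdVec (L : E7 ≃L[ℝ] E7) {k : ℕ} (α : Form k) (I : Fin k → Fin 7) :
    pull L α (fun a => stdVec (I a)) = α fun a => adBasis L (I a) := rfl

theorem wedge_pull (L : E7 ≃L[ℝ] E7) {k l : ℕ} (α : Form k) (β : Form l) :
    wedge (pull L α) (pull L β) = pull L (wedge α β) := wedge_comp α β _

theorem star_comp_eq_starC (L : E7 ≃L[ℝ] E7) (α : Form 3) (J : Fin 4 → Fin 7) :
    star (phi0.compContinuousLinearMap (L : E7 →L[ℝ] E7)) 4 rfl α (fun a => adBasis L (J a)) =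
      starC (pull L α) J := by
  rw [star_comp, starC, wedge_eForm_stdVec]
  rfl

theorem starC_phi0 (J : Fin 4 → Fin 7) : starC phi0 J = psi0 (fun a => stdVec (J a)) := by
  rw [starC, psi0_stdVec]

theorem star_phi_comp (L : E7 ≃L[ℝ] E7) :
    pull L (star (phi0.compContinuousLinearMap (L : E7 →L[ℝ] E7)) 4 rfl
      (phi0.compContinuousLinearMap (L : E7 →L[ℝ] E7))) = psi0 := by
  refine form_ext_stdVec fun J => ?_
  rw [pull_stdVec, star_comp_eq_starC, pull_comp, starC_phi0]

/-- The components of a `3`-form in an adapted basis. -/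
def formC (L : E7 ≃L[ℝ] E7) (h : Form 3) (i j k : Fin 7) : ℝ :=
  h ![adBasis L i, adBasis L j, adBasis L k]

theorem isAlt3_form (h : Form 3) (b : Fin 7 → E7) : IsAlt3 fun i j k => h ![b i, b j, b k] := by
  constructor
  · intro i j k
    have := h.map_swap ![b j, b i, b k] (i := 0) (j := 1) (by decide)
    refine Eq.trans ?_ this
    change h _ = h _
    congr 1
    funext a
    fin_cases a <;> simp [Equiv.swap_apply_def]
  · intro i j k
    have := h.map_swap ![b i, b k, b j] (i := 1) (j := 2) (by decide)
    refine Eq.trans ?_ this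
    change h _ = h _
    congr 1
    funext a
    fin_cases a <;> simp [Equiv.swap_apply_def]

/-- The equation `dφ = τ₀ ⋆φ + 3 τ₁ ∧ φ + ⋆τ₃` determines `τ₀` and `τ₁`. -/
theorem torsion_pointwise (L : E7 ≃L[ℝ] E7) {φ : Form 3}
    (hL : φ = phi0.compContinuousLinearMap (L : E7 →L[ℝ] E7)) (h : Form 3) (dφ : Form 4) (τ₀ : ℝ)
    (τ₁ : Form 1) (τ₃ : Form 3)
    (hdφ : ∀ i j k l, dφ ![adBasis L i, adBasis L j, adBasis L k, adBasis L l] =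
      dphiC (formC L h) i j k l)
    (h1 : ∀ v, wedge τ₃ φ v = 0) (h2 : ∀ v, wedge τ₃ (star φ 4 rfl φ) v = 0)
    (hd : ∀ v : Fin 4 → E7, dφ v = τ₀ * star φ 4 rfl φ v + 3 * wedge τ₁ φ v + star φ 4 rfl τ₃ v) :
    7 * τ₀ = ∑ m, contrPhi (formC L h) m m ∧
      ∀ m, 4 * τ₁ (fun _ => adBasis L m) = leeC (formC L h) m := by
  have e1 : wedge (pull L τ₃) phi0 = 0 := by
    rw [show phi0 = pull L φ by rw [hL, pull_comp], wedge_pull]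
    ext v
    exact h1 _
  have e2 : (wedge (pull L τ₃) psi0 : Form (3 + 4)) stdVec = 0 := by
    rw [show psi0 = pull L (star φ 4 rfl φ) by rw [hL, star_phi_comp], wedge_pull]
    exact h2 _
  refine torsion_components (h := formC L h) (isAlt3_form h _) τ₀ (pull L τ₁) (pull L τ₃) e1 e2 fun J => ?_
  have e3 : dφ (fun a => adBasis L (J a)) = dphiC (formC L h) (J 0) (J 1) (J 2) (J 3) := by
    rw [← hdφ]
    congr 1
    funext a
    fin_cases a <;> rfl
  have e4 : star φ 4 rfl φ (fun a => adBasis L (J a)) = psi0 (fun a => stdVec (J a)) := by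
    rw [← pull_stdVec, hL, star_phi_comp]
  have e5 : (wedge τ₁ φ : Form (1 + 3)) (fun a => adBasis L (J a)) = wedgePhiC (pull L τ₁) J := by
    rw [wedgePhiC, show phi0 = pull L φ by rw [hL, pull_comp], wedge_pull, pull_stdVec]
  have e6 : star φ 4 rfl τ₃ (fun a => adBasis L (J a)) = starC (pull L τ₃) J := by
    rw [hL, star_comp_eq_starC]
  rw [← e3, ← e4, ← e5, ← e6]
  exact hd _

/-! ### Smooth dependence of the metric on the `G₂` form -/

section Smooth

variable {E : Type*} [NormedAddCommGroup E] [NormedSpace ℝ E] {n : WithTop ℕ∞} {y : E}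

theorem contDiffAt_form_apply {k : ℕ} {α : E → Form k} (hα : ContDiffAt ℝ n α y) (v : Fin k → E7) :
    ContDiffAt ℝ n (fun z => α z v) y := by
  have : ContDiff ℝ n fun β : Form k => β v :=
    ((ContinuousMultilinearMap.apply ℝ (fun _ : Fin k => E7) ℝ v).comp
      (ContinuousAlternatingMap.toContinuousMultilinearMapCLM ℝ)).contDiff
  exact this.contDiffAt.comp y hα

theorem contDiffAt_wedge_apply {k l : ℕ} {α : E → Form k} {β : E → Form l}
    (hα : ∀ v, ContDiffAt ℝ n (fun z => α z v) y) (hβ : ∀ v, ContDiffAt ℝ n (fun z => β z v) y)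
    (v : Fin (k + l) → E7) :
    ContDiffAt ℝ n (fun z => wedge (α z) (β z) v) y := by
  simp only [wedge_apply]
  refine contDiffAt_const.mul (ContDiffAt.sum fun σ _ => ?_)
  exact contDiffAt_const.mul ((hα _).mul (hβ _))

theorem contDiffAt_hitchinForm {φ : E → Form 3} (hφ : ContDiffAt ℝ n φ y) (X Y : E7) :
    ContDiffAt ℝ n (fun z => hitchinForm (φ z) X Y) y := by
  obtain ⟨a, ha⟩ : ∃ a : E → Form 2, ∀ z, a z = (φ z).curryLeft X := ⟨_, fun z => rfl⟩
  obtain ⟨b, hb⟩ : ∃ b : E → Form 2, ∀ z, b z = (φ z).curryLeft Y := ⟨_, fun z => rfl⟩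
  obtain ⟨c, hc⟩ : ∃ c : E → Form (2 + 2), ∀ z, c z = wedge (a z) (b z) := ⟨_, fun z => rfl⟩
  have h : (fun z => hitchinForm (φ z) X Y) =
      fun z => (1 / 6 : ℝ) * (wedge (c z) (φ z) : Form 7) stdVec :=
    funext fun z => by rw [hitchinForm, hc, ha, hb]
  rw [h]
  have ha' : ∀ v, ContDiffAt ℝ n (fun z => a z v) y := fun v => by
    simp only [ha]
    exact contDiffAt_form_apply hφ (Matrix.vecCons X v)
  have hb' : ∀ v, ContDiffAt ℝ n (fun z => b z v) y := fun v => by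
    simp only [hb]
    exact contDiffAt_form_apply hφ (Matrix.vecCons Y v)
  have hc' : ∀ v, ContDiffAt ℝ n (fun z => c z v) y := fun v => by
    simp only [hc]
    exact contDiffAt_wedge_apply ha' hb' v
  exact contDiffAt_const.mul (contDiffAt_wedge_apply hc' (contDiffAt_form_apply hφ) stdVec)

theorem contDiffAt_det {m : ℕ} {A : E → Matrix (Fin m) (Fin m) ℝ}
    (hA : ∀ i j, ContDiffAt ℝ n (fun z => A z i j) y) : ContDiffAt ℝ n (fun z => (A z).det) y := by
  simp only [Matrix.det_apply']
  exact ContDiffAt.sum fun σ _ => contDiffAt_const.mul (contDiffAt_prod fun i _ => hA _ _)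

theorem contDiffAt_inv {m : ℕ} {A : E → Matrix (Fin m) (Fin m) ℝ}
    (hA : ∀ i j, ContDiffAt ℝ n (fun z => A z i j) y) (h : (A y).det ≠ 0) (i j : Fin m) :
    ContDiffAt ℝ n (fun z => (A z)⁻¹ i j) y := by
  simp only [Matrix.inv_def, Ring.inverse_eq_inv', Matrix.smul_apply, smul_eq_mul,
    Matrix.adjugate_apply]
  refine ((contDiffAt_det hA).inv h).mul (contDiffAt_det fun a b => ?_)
  simp only [Matrix.updateRow_apply]
  split_ifs
  · exact contDiffAt_const
  · exact hA _ _

/-- The form lies in the `GL₇`-orbit of `φ₀`. -/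
def IsG2Form (φ : Form 3) : Prop :=
  ∃ L : E7 ≃L[ℝ] E7, φ = phi0.compContinuousLinearMap (L : E7 →L[ℝ] E7)

theorem IsG2Form.volCoeff_ne_zero {φ : Form 3} (h : IsG2Form φ) : volCoeff φ ≠ 0 := by
  obtain ⟨L, rfl⟩ := h
  rw [volCoeff_comp]
  exact det_equiv_ne_zero L

/-- The determinant of the metric is the square of the volume coefficient. -/
theorem IsG2Form.gram_det {φ : Form 3} (h : IsG2Form φ) : (gram φ).det = volCoeff φ ^ 2 := by
  obtain ⟨L, rfl⟩ := h
  have h : gram (phi0.compContinuousLinearMap (L : E7 →L[ℝ] E7)) =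
      (mat (L : E7 →L[ℝ] E7)).transpose * mat (L : E7 →L[ℝ] E7) := by
    ext i j
    simp [gram, metric_comp, mat, Matrix.mul_apply]
  rw [h, Matrix.det_mul, Matrix.det_transpose, det_mat, volCoeff_comp, sq]

/-- The real ninth root is smooth here since the determinant under it does not vanish. -/
theorem contDiffAt_volCoeff {φ : E → Form 3} (hφ : ContDiffAt ℝ n φ y) (h : IsG2Form (φ y)) :
    ContDiffAt ℝ n (fun z => volCoeff (φ z)) y := by
  have hd : ContDiffAt ℝ n (fun z => (Matrix.of fun i j : Fin 7 =>
      hitchinForm (φ z) (stdVec i) (stdVec j)).det) y :=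
    contDiffAt_det fun i j => contDiffAt_hitchinForm hφ _ _
  have h0 : (Matrix.of fun i j : Fin 7 => hitchinForm (φ y) (stdVec i) (stdVec j)).det ≠ 0 := by
    obtain ⟨L, hL⟩ := h
    rw [hL, det_hitchin_comp]
    exact pow_ne_zero _ (det_equiv_ne_zero L)
  simp only [volCoeff]
  set d := fun z => (Matrix.of fun i j : Fin 7 =>
      hitchinForm (φ z) (stdVec i) (stdVec j)).det with hdd
  rcases lt_or_gt_of_ne h0 with h1 | h1
  · have e : (fun z => (SignType.sign (d z) : ℝ) * |d z| ^ (1 / 9 : ℝ)) =ᶠ[𝓝 y]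
        fun z => -(-d z) ^ (1 / 9 : ℝ) := by
      filter_upwards [hd.continuousAt.eventually (eventually_lt_nhds h1)] with z hz
      rw [sign_neg hz, abs_of_neg hz]
      simp
    refine ContDiffAt.congr_of_eventuallyEq ?_ e
    exact (hd.neg.rpow_const_of_ne (neg_ne_zero.2 h0)).neg
  · have e : (fun z => (SignType.sign (d z) : ℝ) * |d z| ^ (1 / 9 : ℝ)) =ᶠ[𝓝 y]
        fun z => (d z) ^ (1 / 9 : ℝ) := by
      filter_upwards [hd.continuousAt.eventually (eventually_gt_nhds h1)] with z hz
      rw [sign_pos hz, abs_of_pos hz]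
      simp
    refine ContDiffAt.congr_of_eventuallyEq ?_ e
    exact hd.rpow_const_of_ne h0

theorem contDiffAt_metric {φ : E → Form 3} (hφ : ContDiffAt ℝ n φ y) (h : IsG2Form (φ y))
    (X Y : E7) : ContDiffAt ℝ n (fun z => metric (φ z) X Y) y :=
  (contDiffAt_hitchinForm hφ X Y).div (contDiffAt_volCoeff hφ h) h.volCoeff_ne_zero

theorem contDiffAt_gram_inv {φ : E → Form 3} (hφ : ContDiffAt ℝ n φ y) (h : IsG2Form (φ y))
    (i j : Fin 7) : ContDiffAt ℝ n (fun z => (gram (φ z))⁻¹ i j) y := by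
  refine contDiffAt_inv (A := fun z => gram (φ z)) (fun i j => contDiffAt_metric hφ h _ _) ?_ i j
  rw [h.gram_det]
  exact pow_ne_zero _ h.volCoeff_ne_zero

theorem contDiffAt_formInner {φ : E → Form 3} (hφ : ContDiffAt ℝ n φ y) (h : IsG2Form (φ y))
    {k : ℕ} {α β : E → Form k} (hα : ContDiffAt ℝ n α y) (hβ : ContDiffAt ℝ n β y) :
    ContDiffAt ℝ n (fun z => formInner (φ z) (α z) (β z)) y :=
  contDiffAt_const.mul (ContDiffAt.sum fun _ _ => ContDiffAt.sum fun _ _ =>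
    ((contDiffAt_prod fun _ _ => contDiffAt_gram_inv hφ h _ _).mul
      (contDiffAt_form_apply hα _)).mul (contDiffAt_form_apply hβ _))

end Smooth

/-! ### Invariant contractions with a `G₂` form -/

theorem multilinear_apply_eq_sum {k : ℕ} (F : ContinuousMultilinearMap ℝ (fun _ : Fin k => E7) ℝ)
    (v : Fin k → E7) :
    F v = ∑ I : Fin k → Fin 7, (∏ a, v a (I a)) * F (fun a => stdVec (I a)) := by
  have hv : v = fun a => ∑ i : Fin 7, v a i • stdVec i := by
    ext a i
    simp [stdVec_apply]
  conv_lhs => rw [hv]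
  rw [F.map_sum]
  refine Finset.sum_congr rfl fun I _ => ?_
  rw [F.map_smul_univ, smul_eq_mul]

/-- The multilinear form `(a, b, c) ↦ ∑ g^{pq} φ(e_p, a, b) φ(w, e_q, c)`. -/
def phiSq (φ : Form 3) (w : E7) : ContinuousMultilinearMap ℝ (fun _ : Fin (2 + 1) => E7) ℝ :=
  ∑ p : Fin 7, ∑ q : Fin 7, (gram φ)⁻¹ p q •
    tensor (φ.curryLeft (stdVec p) : Form 2) ((φ.curryLeft w : Form 2).curryLeft (stdVec q))

/-- The Lee form of the `3`-form `h`, in terms of the metric `g_φ`. -/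
def leeInv (φ h : Form 3) (w : E7) : ℝ :=
  (1 / 6) * ∑ I : Fin 3 → Fin 7, ∑ J : Fin 3 → Fin 7,
    (∏ a, (gram φ)⁻¹ (I a) (J a)) * h (fun a => stdVec (I a)) *
      phiSq φ w (fun a => stdVec (J a))

theorem phiSq_apply (φ : Form 3) (w : E7) (v : Fin 3 → E7) : phiSq φ w v =
    ∑ p, ∑ q, (gram φ)⁻¹ p q * (φ ![stdVec p, v 0, v 1] * φ ![w, stdVec q, v 2]) := by
  simp only [phiSq, _root_.sum_apply, _root_.smul_apply, smul_eq_mul, tensor_apply]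
  refine Finset.sum_congr rfl fun p _ => Finset.sum_congr rfl fun q _ => ?_
  congr 2
  · change φ _ = φ _
    congr 1
    funext a
    fin_cases a <;> rfl
  · change φ _ = φ _
    congr 1
    funext a
    fin_cases a <;> rfl

/-- Contraction with the inverse metric is a sum over an adapted basis. -/
theorem gram_inv_contract (L : E7 ≃L[ℝ] E7) (f g : E7 →ₗ[ℝ] ℝ) :
    ∑ p, ∑ q, (gram (phi0.compContinuousLinearMap (L : E7 →L[ℝ] E7)))⁻¹ p q *
      (f (stdVec p) * g (stdVec q)) = ∑ m, f (adBasis L m) * g (adBasis L m) := by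
  have h : ∀ (f : E7 →ₗ[ℝ] ℝ) m, f (adBasis L m) = ∑ p, adBasis L m p * f (stdVec p) := by
    intro f m
    conv_lhs => rw [eq_sum_stdVec (adBasis L m), map_sum]
    simp
  have e : ∀ m, f (adBasis L m) * g (adBasis L m) = ∑ p, ∑ q,
      adBasis L m p * adBasis L m q * (f (stdVec p) * g (stdVec q)) := by
    intro m
    rw [h f, h g, Finset.sum_mul_sum]
    exact Finset.sum_congr rfl fun p _ => Finset.sum_congr rfl fun q _ => by ring
  simp only [gram_inv_comp, e, Finset.sum_mul]
  symm
  rw [Finset.sum_comm]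
  refine Finset.sum_congr rfl fun p _ => ?_
  rw [Finset.sum_comm]
  rfl

/-- A form with all but one argument fixed. -/
def slotL {k : ℕ} (α : Form k) (v : Fin k → E7) (i : Fin k) : E7 →ₗ[ℝ] ℝ :=
  α.toMultilinearMap.toLinearMap v i

theorem slotL_apply {k : ℕ} (α : Form k) (v : Fin k → E7) (i : Fin k) (x : E7) :
    slotL α v i x = α (Function.update v i x) := rfl

theorem phiSq_comp (L : E7 ≃L[ℝ] E7) (w : E7) (v : Fin 3 → E7) :
    phiSq (phi0.compContinuousLinearMap (L : E7 →L[ℝ] E7)) w v =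
      ∑ m, phi0.compContinuousLinearMap (L : E7 →L[ℝ] E7) ![adBasis L m, v 0, v 1] *
        phi0.compContinuousLinearMap (L : E7 →L[ℝ] E7) ![w, adBasis L m, v 2] := by
  rw [phiSq_apply]
  set φ := phi0.compContinuousLinearMap (L : E7 →L[ℝ] E7) with hφ
  have h1 : ∀ x, φ ![x, v 0, v 1] = slotL φ ![0, v 0, v 1] 0 x := fun x => by
    rw [slotL_apply]
    congr 1
    funext a
    fin_cases a <;> rfl
  have h2 : ∀ x, φ ![w, x, v 2] = slotL φ ![w, 0, v 2] 1 x := fun x => by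
    rw [slotL_apply]
    congr 1
    funext a
    fin_cases a <;> rfl
  simp only [h1, h2]
  exact gram_inv_contract L _ _

theorem eq_sum_adBasis (L : E7 ≃L[ℝ] E7) (w : E7) : w = ∑ m, L w m • adBasis L m := by
  apply L.injective
  rw [map_sum]
  conv_lhs => rw [eq_sum_stdVec (L w)]
  refine Finset.sum_congr rfl fun m _ => ?_
  rw [map_smul, adBasis, L.apply_symm_apply]

theorem sum_fin_three (F : Fin 7 → Fin 7 → Fin 7 → ℝ) :
    ∑ K : Fin 3 → Fin 7, F (K 0) (K 1) (K 2) = ∑ i, ∑ j, ∑ k, F i j k := by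
  rw [← Fintype.sum_prod_type', ← Fintype.sum_prod_type']
  let e : (Fin 3 → Fin 7) ≃ (Fin 7 × Fin 7) × Fin 7 :=
    { toFun := fun K => ((K 0, K 1), K 2)
      invFun := fun t => ![t.1.1, t.1.2, t.2]
      left_inv := fun K => by
        funext a
        fin_cases a <;> rfl
      right_inv := fun t => rfl }
  exact Fintype.sum_equiv e _ _ fun K => rfl

theorem form_three_apply (L : E7 ≃L[ℝ] E7) (h : Form 3) (K : Fin 3 → Fin 7) :
    h (fun a => adBasis L (K a)) = formC L h (K 0) (K 1) (K 2) := by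
  rw [formC]
  congr 1
  funext a
  fin_cases a <;> rfl

theorem formC_phi0 (L : E7 ≃L[ℝ] E7) (i j k : Fin 7) :
    formC L (phi0.compContinuousLinearMap (L : E7 →L[ℝ] E7)) i j k = phiC i j k := by
  have := phi0_comp_adBasis L ![i, j, k]
  rw [form_three_apply] at this
  exact this

/-- In an adapted basis `leeInv` is the Lee form in components. -/
theorem leeInv_comp (L : E7 ≃L[ℝ] E7) (h : Form 3) (w : E7) :
    leeInv (phi0.compContinuousLinearMap (L : E7 →L[ℝ] E7)) h w =
      ∑ m, L w m * leeC (formC L h) m := by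
  have e1 := contract_eq _ (adBasis L) (gram_inv_comp L) (fun v => h v)
    (fun v => phiSq (phi0.compContinuousLinearMap (L : E7 →L[ℝ] E7)) w v)
    (form_apply_eq_sum h) (multilinear_apply_eq_sum _)
  simp only [smul_eq_mul] at e1
  rw [leeInv, e1]
  simp only [phiSq_comp, form_three_apply]
  set φ := phi0.compContinuousLinearMap (L : E7 →L[ℝ] E7) with hφ
  have e2 : ∀ m k, φ ![w, adBasis L m, adBasis L k] = ∑ n, L w n * phiC k n m := by
    intro m k
    have h1 : ∀ x, φ ![x, adBasis L m, adBasis L k] =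
        slotL φ ![0, adBasis L m, adBasis L k] 0 x := fun x => by
      rw [slotL_apply]
      congr 1
      funext a
      fin_cases a <;> rfl
    rw [h1]
    conv_lhs => rw [eq_sum_adBasis L w, map_sum]
    refine Finset.sum_congr rfl fun n _ => ?_
    rw [map_smul, ← h1, smul_eq_mul, phiC_rot k n m, ← formC_phi0 L n m k, formC]
  have e3 : ∀ m i j, φ ![adBasis L m, adBasis L i, adBasis L j] = phiC i j m := fun m i j => by
    rw [← phiC_rot, ← formC_phi0 L m i j, formC]
  simp only [e2, e3]
  rw [sum_fin_three fun i j k => formC L h i j k * ∑ m, phiC i j m * ∑ n, L w n * phiC k n m]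
  simp only [leeC, contrPhi]
  rw [sum_rot fun i j k => formC L h i j k * ∑ m, phiC i j m * ∑ n, L w n * phiC k n m]
  have e4 : ∀ k, ∑ i, ∑ j, formC L h i j k * ∑ m, phiC i j m * ∑ n, L w n * phiC k n m =
      ∑ n, L w n * ∑ p, (∑ i, ∑ j, formC L h i j k * phiC i j p) * phiC k n p := by
    intro k
    have e5 : ∀ Y : Fin 7 → ℝ, ∑ i, ∑ j, formC L h i j k * ∑ m, phiC i j m * Y m =
        ∑ p, (∑ i, ∑ j, formC L h i j k * phiC i j p) * Y p := by
      intro Y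
      simp only [Finset.sum_mul, Finset.mul_sum]
      symm
      rw [Finset.sum_comm]
      refine Finset.sum_congr rfl fun i _ => ?_
      rw [Finset.sum_comm]
      exact Finset.sum_congr rfl fun j _ => Finset.sum_congr rfl fun m _ => by ring
    rw [e5]
    simp only [Finset.mul_sum]
    rw [Finset.sum_comm]
    exact Finset.sum_congr rfl fun n _ => Finset.sum_congr rfl fun p _ => by ring
  simp only [e4]
  rw [Finset.sum_comm, Finset.mul_sum]
  refine Finset.sum_congr rfl fun n _ => ?_
  rw [← Finset.mul_sum]
  ring

/-! ### Invariance under linear isomorphisms -/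

theorem comp_comp (L E : E7 ≃L[ℝ] E7) {k : ℕ} (α : Form k) :
    (α.compContinuousLinearMap (L : E7 →L[ℝ] E7)).compContinuousLinearMap (E : E7 →L[ℝ] E7) =
      α.compContinuousLinearMap ((E.trans L : E7 ≃L[ℝ] E7) : E7 →L[ℝ] E7) := rfl

theorem IsG2Form.comp {φ : Form 3} (h : IsG2Form φ) (E : E7 ≃L[ℝ] E7) :
    IsG2Form (φ.compContinuousLinearMap (E : E7 →L[ℝ] E7)) := by
  obtain ⟨L, rfl⟩ := h
  exact ⟨E.trans L, rfl⟩

theorem apply_adBasis_trans (L E : E7 ≃L[ℝ] E7) (i : Fin 7) :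
    E (adBasis (E.trans L) i) = adBasis L i := by
  simp [adBasis]

theorem comp_apply_adBasis (L E : E7 ≃L[ℝ] E7) {k : ℕ} (α : Form k) (K : Fin k → Fin 7) :
    α.compContinuousLinearMap (E : E7 →L[ℝ] E7) (fun a => adBasis (E.trans L) (K a)) =
      α fun a => adBasis L (K a) := by
  rw [ContinuousAlternatingMap.compContinuousLinearMap_apply]
  congr 1
  funext a
  exact apply_adBasis_trans L E _

theorem formC_comp (L E : E7 ≃L[ℝ] E7) (h : Form 3) :
    formC (E.trans L) (h.compContinuousLinearMap (E : E7 →L[ℝ] E7)) = formC L h := by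
  funext i j k
  have h1 := form_three_apply (E.trans L) (h.compContinuousLinearMap (E : E7 →L[ℝ] E7)) ![i, j, k]
  rw [comp_apply_adBasis, form_three_apply] at h1
  exact h1.symm

theorem metric_comp_equiv {φ : Form 3} (hφ : IsG2Form φ) (E : E7 ≃L[ℝ] E7) (v w : E7) :
    metric (φ.compContinuousLinearMap (E : E7 →L[ℝ] E7)) v w = metric φ (E v) (E w) := by
  obtain ⟨L, rfl⟩ := hφ
  rw [comp_comp, metric_comp, metric_comp]
  rfl

theorem formInner_comp_equiv {φ : Form 3} (hφ : IsG2Form φ) (E : E7 ≃L[ℝ] E7) {k : ℕ}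
    (α β : Form k) :
    formInner (φ.compContinuousLinearMap (E : E7 →L[ℝ] E7))
      (α.compContinuousLinearMap (E : E7 →L[ℝ] E7)) (β.compContinuousLinearMap (E : E7 →L[ℝ] E7)) =
        formInner φ α β := by
  obtain ⟨L, rfl⟩ := hφ
  rw [comp_comp, formInner_comp, formInner_comp]
  simp only [comp_apply_adBasis]

theorem leeInv_comp_equiv {φ : Form 3} (hφ : IsG2Form φ) (E : E7 ≃L[ℝ] E7) (h : Form 3) (w : E7) :
    leeInv (φ.compContinuousLinearMap (E : E7 →L[ℝ] E7))
      (h.compContinuousLinearMap (E : E7 →L[ℝ] E7)) w = leeInv φ h (E w) := by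
  obtain ⟨L, rfl⟩ := hφ
  rw [comp_comp, leeInv_comp, leeInv_comp, formC_comp]
  rfl

theorem formInner_self_eq (L : E7 ≃L[ℝ] E7) (h : Form 3) :
    formInner (phi0.compContinuousLinearMap (L : E7 →L[ℝ] E7)) h h =
      (1 / 6) * ∑ i, ∑ j, ∑ k, formC L h i j k ^ 2 := by
  rw [formInner_comp, ← sum_fin_three fun i j k => formC L h i j k ^ 2]
  congr 1
  · norm_num [Nat.factorial]
  · exact Finset.sum_congr rfl fun K _ => by rw [form_three_apply, sq]

theorem formInner_phi_eq (L : E7 ≃L[ℝ] E7) (h : Form 3) :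
    formInner (phi0.compContinuousLinearMap (L : E7 →L[ℝ] E7)) h
      (phi0.compContinuousLinearMap (L : E7 →L[ℝ] E7)) =
      (1 / 6) * ∑ i, ∑ j, ∑ k, formC L h i j k * phiC i j k := by
  rw [formInner_comp, ← sum_fin_three fun i j k => formC L h i j k * phiC i j k]
  congr 1
  · norm_num [Nat.factorial]
  · exact Finset.sum_congr rfl fun K _ => by rw [form_three_apply, phi0_comp_adBasis]

theorem sum_contrPhi_diag (h : Fin 7 → Fin 7 → Fin 7 → ℝ) :
    ∑ m, contrPhi h m m = ∑ i, ∑ j, ∑ k, h i j k * phiC i j k := by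
  rw [sum_rot fun i j k => h i j k * phiC i j k]
  rfl

theorem contDiffAt_leeInv {E : Type*} [NormedAddCommGroup E] [NormedSpace ℝ E] {n : WithTop ℕ∞}
    {y : E} {φ h : E → Form 3} (hφ : ContDiffAt ℝ n φ y) (hG : IsG2Form (φ y))
    (hh : ContDiffAt ℝ n h y) (w : E7) :
    ContDiffAt ℝ n (fun z => leeInv (φ z) (h z) w) y := by
  simp only [leeInv, phiSq_apply]
  exact contDiffAt_const.mul (ContDiffAt.sum fun _ _ => ContDiffAt.sum fun _ _ =>
    ((contDiffAt_prod fun _ _ => contDiffAt_gram_inv hφ hG _ _).mul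
      (contDiffAt_form_apply hh _)).mul (ContDiffAt.sum fun _ _ => ContDiffAt.sum fun _ _ =>
        (contDiffAt_gram_inv hφ hG _ _).mul
          ((contDiffAt_form_apply hφ _).mul (contDiffAt_form_apply hφ _))))

/-! ### Covariant derivatives of forms and parallel frames -/

theorem form_eq_slotL (α : Form 3) (x b c : E7) : α ![x, b, c] = slotL α ![0, b, c] 0 x := by
  rw [slotL_apply]
  congr 1
  funext a
  fin_cases a <;> rfl

theorem form_add₁ (α : Form 3) (x y b c : E7) : α ![x + y, b, c] = α ![x, b, c] + α ![y, b, c] := by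
  simp only [form_eq_slotL, map_add]

theorem form_smul₁ (α : Form 3) (r : ℝ) (x b c : E7) : α ![r • x, b, c] = r * α ![x, b, c] := by
  simp only [form_eq_slotL, map_smul, smul_eq_mul]

theorem form_rot (α : Form 3) (a b c : E7) : α ![a, b, c] = α ![b, c, a] := by
  have h := isAlt3_form α ![a, b, c, 0, 0, 0, 0]
  have h1 := h.1 0 1 2
  have h2 := h.2 1 0 2
  simp at h1 h2
  rw [h1, h2, neg_neg]

theorem form_swap (α : Form 3) (a b c : E7) : α ![a, b, c] = -α ![b, a, c] := by
  have h := isAlt3_form α ![a, b, c, 0, 0, 0, 0]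
  simpa using h.1 0 1 2

theorem form_neg₁ (α : Form 3) (x b c : E7) : α ![-x, b, c] = -α ![x, b, c] := by
  have := form_smul₁ α (-1) x b c
  simpa using this

theorem form_sub₁ (α : Form 3) (x y b c : E7) : α ![x - y, b, c] = α ![x, b, c] - α ![y, b, c] := by
  rw [sub_eq_add_neg, form_add₁, form_neg₁, sub_eq_add_neg]

theorem form_add₂ (α : Form 3) (x y b c : E7) : α ![b, x + y, c] = α ![b, x, c] + α ![b, y, c] := by
  rw [form_rot, form_add₁, form_rot α b x, form_rot α b y]

theorem form_sub₂ (α : Form 3) (x y b c : E7) : α ![b, x - y, c] = α ![b, x, c] - α ![b, y, c] := by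
  rw [form_rot, form_sub₁, form_rot α b x, form_rot α b y]

theorem form_add₃ (α : Form 3) (x y b c : E7) : α ![b, c, x + y] = α ![b, c, x] + α ![b, c, y] := by
  rw [form_rot, form_add₂, form_rot α b c x, form_rot α b c y]

theorem form_sub₃ (α : Form 3) (x y b c : E7) : α ![b, c, x - y] = α ![b, c, x] - α ![b, c, y] := by
  rw [form_rot, form_sub₂, form_rot α b c x, form_rot α b c y]

theorem form_sum₁ {ι : Type*} (s : Finset ι) (α : Form 3) (f : ι → E7) (b c : E7) :
    α ![∑ i ∈ s, f i, b, c] = ∑ i ∈ s, α ![f i, b, c] := by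
  simp only [form_eq_slotL, map_sum]

/-- The derivation action `(A · α)(v₁, …, v_k) = ∑ᵢ α(v₁, …, A vᵢ, …, v_k)`. -/
def formAct {k : ℕ} (α : Form k) : (E7 →L[ℝ] E7) →L[ℝ] Form k :=
  α.fderivCompContinuousLinearMap (ContinuousLinearMap.id ℝ E7)

theorem formAct_apply {k : ℕ} (α : Form k) (A : E7 →L[ℝ] E7) (v : Fin k → E7) :
    formAct α A v = ∑ i, α (Function.update v i (A (v i))) := by
  rw [formAct, ContinuousAlternatingMap.fderivCompContinuousLinearMap_apply]
  refine Finset.sum_congr rfl fun i _ => ?_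
  congr 1
  funext j
  rcases eq_or_ne j i with rfl | hj
  · simp
  · simp [hj]

theorem formAct_three (α : Form 3) (A : E7 →L[ℝ] E7) (a b c : E7) :
    formAct α A ![a, b, c] = α ![A a, b, c] + α ![a, A b, c] + α ![a, b, A c] := by
  rw [formAct_apply, Fin.sum_univ_three]
  congr 1
  · congr 1
    · congr 1
      funext i
      fin_cases i <;> rfl
    · congr 1
      funext i
      fin_cases i <;> rfl
  · congr 1
    funext i
    fin_cases i <;> rfl

/-- The covariant derivative of a form for the connection with Christoffel operators `Γ`. -/
def covD {k : ℕ} (Γ : E7 → E7 →L[ℝ] E7 →L[ℝ] E7) (α : E7 → Form k) (y : E7) : E7 →L[ℝ] Form k :=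
  fderiv ℝ α y - formAct (α y) ∘L Γ y

theorem fderiv_form_apply {k : ℕ} {α : E7 → Form k} {y : E7} (hα : DifferentiableAt ℝ α y)
    (v : Fin k → E7) (u : E7) : fderiv ℝ (fun z => α z v) y u = fderiv ℝ α y u v := by
  have hc : ∀ i : Fin k, DifferentiableAt ℝ (fun _ : E7 => v i) y :=
    fun i => differentiableAt_const _
  rw [fderiv_continuousAlternatingMap_apply_apply hα hc u]
  simp [ContinuousAlternatingMap.map_update_zero]

theorem fderiv_eq_covD (Γ : E7 → E7 →L[ℝ] E7 →L[ℝ] E7) (α : E7 → Form 3) (y u a b c : E7) :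
    fderiv ℝ α y u ![a, b, c] = covD Γ α y u ![a, b, c] +
      (α y ![Γ y u a, b, c] + α y ![a, Γ y u b, c] + α y ![a, b, Γ y u c]) := by
  rw [← formAct_three]
  simp [covD]

theorem contDiffAt_form {E : Type*} [NormedAddCommGroup E] [NormedSpace ℝ E] {n : WithTop ℕ∞}
    {k : ℕ} {α : E → Form k} {y : E} (h : ∀ v, ContDiffAt ℝ n (fun z => α z v) y) :
    ContDiffAt ℝ n α y := by
  have : α = fun z => (k.factorial : ℝ)⁻¹ • ∑ I : Fin k → Fin 7,
      α z (fun a => stdVec (I a)) • eForm I := funext fun z => form_eq_sum_eForm (α z)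
  rw [this]
  refine ContDiffAt.const_smul _ (ContDiffAt.sum fun I _ => ?_)
  exact ContDiffAt.smul (h fun a => stdVec (I a)) (contDiffAt_const (c := eForm I))

/-- The frame `E_z = 1 - Γ_y(z - y)`, which is parallel at `y`. -/
def parFrame (Γ : E7 → E7 →L[ℝ] E7 →L[ℝ] E7) (y z : E7) : E7 →L[ℝ] E7 :=
  ContinuousLinearMap.id ℝ E7 - Γ y (z - y)

theorem parFrame_self (Γ : E7 → E7 →L[ℝ] E7 →L[ℝ] E7) (y : E7) :
    parFrame Γ y y = ContinuousLinearMap.id ℝ E7 := by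
  simp [parFrame]

theorem hasFDerivAt_parFrame (Γ : E7 → E7 →L[ℝ] E7 →L[ℝ] E7) (y : E7) :
    HasFDerivAt (parFrame Γ y) (-Γ y) y := by
  have h1 : HasFDerivAt (fun z : E7 => z - y) (ContinuousLinearMap.id ℝ E7) y :=
    (hasFDerivAt_id y).sub_const y
  have h := HasFDerivAt.comp (g := fun z => Γ y z) (f := fun z : E7 => z - y) y
    (Γ y).hasFDerivAt h1
  exact h.const_sub (ContinuousLinearMap.id ℝ E7)

theorem eventually_parFrame (Γ : E7 → E7 →L[ℝ] E7 →L[ℝ] E7) (y : E7) :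
    ∀ᶠ z in 𝓝 y, ∃ E : E7 ≃L[ℝ] E7, (E : E7 →L[ℝ] E7) = parFrame Γ y z := by
  have h := (hasFDerivAt_parFrame Γ y).continuousAt
  rw [ContinuousAt, parFrame_self] at h
  exact h.eventually (ContinuousLinearEquiv.nhds (ContinuousLinearEquiv.refl ℝ E7))

/-- In the frame that is parallel at `y`, the derivative of a form is its covariant derivative. -/
theorem hasFDerivAt_comp_parFrame (Γ : E7 → E7 →L[ℝ] E7 →L[ℝ] E7) {k : ℕ} {α : E7 → Form k} {y : E7}
    (hα : DifferentiableAt ℝ α y) :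
    HasFDerivAt (fun z => (α z).compContinuousLinearMap (parFrame Γ y z)) (covD Γ α y) y := by
  have h := hα.hasFDerivAt.continuousAlternatingMapCompContinuousLinearMap
    (hasFDerivAt_parFrame Γ y)
  refine h.congr_fderiv ?_
  rw [parFrame_self]
  ext u v
  simp [covD, formAct, sub_eq_add_neg]

/-- Differentiation of an expression that is linear in the second form, at a point where the first
form is stationary. -/
theorem fderiv_of_stationary {G : Form 3 × Form 3 → ℝ} {φ h : E7 → Form 3} {y : E7}
    {N : E7 →L[ℝ] Form 3} (hG : DifferentiableAt ℝ G (φ y, h y))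
    (hadd : ∀ a b, G (φ y, a + b) = G (φ y, a) + G (φ y, b))
    (hsmul : ∀ (r : ℝ) a, G (φ y, r • a) = r * G (φ y, a))
    (hφ : HasFDerivAt φ (0 : E7 →L[ℝ] Form 3) y) (hh : HasFDerivAt h N y) :
    DifferentiableAt ℝ (fun z => G (φ z, h z)) y ∧
      ∀ u, fderiv ℝ (fun z => G (φ z, h z)) y u = G (φ y, N u) := by
  have h1 := hG.hasFDerivAt.comp y (hφ.prodMk hh)
  refine ⟨h1.differentiableAt, fun u => ?_⟩
  rw [show (fun z => G (φ z, h z)) = G ∘ fun z => (φ z, h z) from rfl, h1.fderiv]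
  have h2 : HasDerivAt (fun t : ℝ => (φ y, h y + t • N u)) ((0 : Form 3), N u) 0 := by
    have := ((hasDerivAt_id (0 : ℝ)).smul_const (N u)).const_add (h y)
    simpa using (hasDerivAt_const (0 : ℝ) (φ y)).prodMk this
  have hG' : HasFDerivAt G (fderiv ℝ G (φ y, h y)) (φ y, h y + (0 : ℝ) • N u) := by
    simpa using hG.hasFDerivAt
  have h3 := hG'.comp_hasDerivAt (0 : ℝ) h2
  have h4 : (G ∘ fun t : ℝ => (φ y, h y + t • N u)) =
      fun t : ℝ => G (φ y, h y) + t * G (φ y, N u) := by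
    funext t
    simp [hadd, hsmul]
  rw [h4] at h3
  have h5 : HasDerivAt (fun t : ℝ => G (φ y, h y) + t * G (φ y, N u)) (G (φ y, N u)) 0 := by
    simpa using ((hasDerivAt_id (0 : ℝ)).mul_const (G (φ y, N u))).const_add (G (φ y, h y))
  have := h3.unique h5
  simpa using this

/-! ### Strong torsion `G₂` structures in a chart -/

theorem two_le_infty : (2 : WithTop ℕ∞) ≤ ∞ :=
  WithTop.coe_le_coe.2 (le_top : (2 : ℕ∞) ≤ ⊤)

/-- `g_φ` as a continuous bilinear map. -/
def metricB (φ : Form 3) : E7 →L[ℝ] E7 →L[ℝ] ℝ :=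
  ∑ i : Fin 7, ∑ j : Fin 7, metric φ (stdVec i) (stdVec j) •
    (EuclideanSpace.proj i : E7 →L[ℝ] ℝ).smulRight (EuclideanSpace.proj j : E7 →L[ℝ] ℝ)

theorem metricB_apply (φ : Form 3) (X Y : E7) : metricB φ X Y = metric φ X Y := by
  rw [← metricL_apply]
  conv_rhs => rw [eq_sum_stdVec X, eq_sum_stdVec Y]
  simp only [metricB, map_sum, map_smul, LinearMap.sum_apply, LinearMap.smul_apply, metricL_apply,
    _root_.sum_apply, _root_.smul_apply,
    ContinuousLinearMap.smulRight_apply, smul_eq_mul, Finset.mul_sum]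
  rw [Finset.sum_comm]
  refine Finset.sum_congr rfl fun i _ => Finset.sum_congr rfl fun j _ => ?_
  simp
  ring

theorem contDiffAt_metricB {E : Type*} [NormedAddCommGroup E] [NormedSpace ℝ E] {n : WithTop ℕ∞}
    {y : E} {φ : E → Form 3} (hφ : ContDiffAt ℝ n φ y) (h : IsG2Form (φ y)) :
    ContDiffAt ℝ n (fun z => metricB (φ z)) y :=
  ContDiffAt.sum fun _ _ => ContDiffAt.sum fun _ _ =>
    (ContinuousLinearMap.toSpanSingleton ℝ _).contDiff.contDiffAt.comp y (contDiffAt_metric hφ h _ _)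

theorem metric_add_left (φ : Form 3) (x y w : E7) :
    metric φ (x + y) w = metric φ x w + metric φ y w := by
  simp only [← metricL_apply, map_add, LinearMap.add_apply]

theorem metric_sub_left (φ : Form 3) (x y w : E7) :
    metric φ (x - y) w = metric φ x w - metric φ y w := by
  simp only [← metricL_apply, map_sub, LinearMap.sub_apply]

theorem metric_adBasis (L : E7 ≃L[ℝ] E7) (x : E7) (n : Fin 7) :
    metric (phi0.compContinuousLinearMap (L : E7 →L[ℝ] E7)) x (adBasis L n) = L x n := by
  rw [metric_comp, Finset.sum_eq_single n]
  · simp [adBasis, stdVec_apply]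
  · intro b _ hb
    simp [adBasis, stdVec_apply, hb]
  · simp

/-- The data of a `G₂` structure `φ` near a point `y` of `ℝ⁷`, with a metric connection with
Christoffel operators `Γ` (that is, `∇_u v = Γ u v` for constant fields) that preserves `φ` and
has the skew torsion `H`. -/
structure IsLocalG2 (φ H : E7 → Form 3) (Γ : E7 → E7 →L[ℝ] E7 →L[ℝ] E7) (y : E7) : Prop where
  phi_smooth : ContDiffAt ℝ ∞ φ y
  christoffel_smooth : ContDiffAt ℝ ∞ Γ y
  g2 : ∀ᶠ z in 𝓝 y, IsG2Form (φ z)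
  form_par : ∀ᶠ z in 𝓝 y, covD Γ φ z = 0
  metric_par : ∀ᶠ z in 𝓝 y, ∀ u v w, fderiv ℝ (fun x => metric (φ x) v w) z u =
    metric (φ z) (Γ z u v) w + metric (φ z) v (Γ z u w)
  torsion : ∀ᶠ z in 𝓝 y, ∀ u v w, metric (φ z) (Γ z u v - Γ z v u) w = H z ![u, v, w]

/-- The torsion of the connection with Christoffel operators `Γ`. -/
def tors (Γ : E7 → E7 →L[ℝ] E7 →L[ℝ] E7) (y u v : E7) : E7 := Γ y u v - Γ y v u

/-- The curvature of the connection with Christoffel operators `Γ`. -/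
def curv (Γ : E7 → E7 →L[ℝ] E7 →L[ℝ] E7) (y u v w : E7) : E7 :=
  fderiv ℝ Γ y u v w - fderiv ℝ Γ y v u w + Γ y u (Γ y v w) - Γ y v (Γ y u w)

section

variable {φ H : E7 → Form 3} {Γ : E7 → E7 →L[ℝ] E7 →L[ℝ] E7} {y : E7}

/-- The torsion form is smooth because the metric and the Christoffel operators are. -/
theorem IsLocalG2.contDiffAt_torsion (h : IsLocalG2 φ H Γ y) : ContDiffAt ℝ ∞ H y := by
  refine contDiffAt_form fun v => ?_
  have e : (fun z => H z v) =ᶠ[𝓝 y]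
      fun z => metricB (φ z) (Γ z (v 0) (v 1) - Γ z (v 1) (v 0)) (v 2) := by
    filter_upwards [h.torsion] with z hz
    rw [metricB_apply, hz]
    congr 1
    funext i
    fin_cases i <;> rfl
  refine ContDiffAt.congr_of_eventuallyEq ?_ e
  have h1 : ∀ a b, ContDiffAt ℝ ∞ (fun z => Γ z a b) y := fun a b =>
    (h.christoffel_smooth.clm_apply contDiffAt_const).clm_apply contDiffAt_const
  exact ((contDiffAt_metricB h.phi_smooth h.g2.self_of_nhds).clm_apply
    ((h1 _ _).sub (h1 _ _))).clm_apply contDiffAt_const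

theorem fderiv_metric (hφ : DifferentiableAt ℝ (fun z => metricB (φ z)) y)
    (hm : ∀ u v w, fderiv ℝ (fun x => metric (φ x) v w) y u =
      metric (φ y) (Γ y u v) w + metric (φ y) v (Γ y u w)) {X Y : E7 → E7}
    (hX : DifferentiableAt ℝ X y) (hY : DifferentiableAt ℝ Y y) (u : E7) :
    fderiv ℝ (fun z => metric (φ z) (X z) (Y z)) y u =
      metric (φ y) (fderiv ℝ X y u + Γ y u (X y)) (Y y) +
        metric (φ y) (X y) (fderiv ℝ Y y u + Γ y u (Y y)) := by
  have h0 : ∀ v w, fderiv ℝ (fun x => metric (φ x) v w) y u = fderiv ℝ (fun z => metricB (φ z)) y u v w := by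
    intro v w
    have h1 : (fun x => metric (φ x) v w) = fun x => metricB (φ x) v w :=
      funext fun x => (metricB_apply _ _ _).symm
    rw [h1]
    have h2 := (hφ.hasFDerivAt.clm_apply (hasFDerivAt_const v y)).clm_apply (hasFDerivAt_const w y)
    rw [h2.fderiv]
    simp
  have h3 := (hφ.hasFDerivAt.clm_apply hX.hasFDerivAt).clm_apply hY.hasFDerivAt
  have h1 : (fun x => metric (φ x) (X x) (Y x)) = fun x => metricB (φ x) (X x) (Y x) :=
      funext fun x => (metricB_apply _ _ _).symm
  rw [h1, h3.fderiv]
  have h4 := (h0 (X y) (Y y)).symm.trans (hm u (X y) (Y y))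
  simp only [_root_.add_apply, ContinuousLinearMap.comp_apply,
    ContinuousLinearMap.flip_apply, h4]
  simp only [← metricB_apply, map_add, _root_.add_apply]
  ring

theorem extDeriv_three {α : E7 → Form 3} (hα : DifferentiableAt ℝ α y) (a b c d : E7) :
    extDeriv α y ![a, b, c, d] = fderiv ℝ α y a ![b, c, d] - fderiv ℝ α y b ![a, c, d] +
      fderiv ℝ α y c ![a, b, d] - fderiv ℝ α y d ![a, b, c] := by
  rw [extDeriv_apply hα, Fin.sum_univ_four]
  simp only [fderiv_form_apply hα]
  have e0 : (0 : Fin 4).removeNth ![a, b, c, d] = ![b, c, d] := by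
    funext i; fin_cases i <;> rfl
  have e1 : (1 : Fin 4).removeNth ![a, b, c, d] = ![a, c, d] := by
    funext i; fin_cases i <;> rfl
  have e2 : (2 : Fin 4).removeNth ![a, b, c, d] = ![a, b, d] := by
    funext i; fin_cases i <;> rfl
  have e3 : (3 : Fin 4).removeNth ![a, b, c, d] = ![a, b, c] := by
    funext i; fin_cases i <;> rfl
  rw [e0, e1, e2, e3]
  simp
  ring

/-- The exterior derivative in terms of a connection with torsion: the antisymmetrised covariant
derivative plus insertions of the torsion. -/
theorem extDeriv_eq_covD {α : E7 → Form 3} (hα : DifferentiableAt ℝ α y) (a b c d : E7) :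
    extDeriv α y ![a, b, c, d] = covD Γ α y a ![b, c, d] - covD Γ α y b ![a, c, d] +
      covD Γ α y c ![a, b, d] - covD Γ α y d ![a, b, c] +
      (α y ![tors Γ y a b, c, d] - α y ![tors Γ y a c, b, d] + α y ![tors Γ y a d, b, c] +
        α y ![tors Γ y b c, a, d] - α y ![tors Γ y b d, a, c] + α y ![tors Γ y c d, a, b]) := by
  rw [extDeriv_three hα]
  simp only [fderiv_eq_covD Γ, tors, form_sub₁]
  have e : ∀ x p q, α y ![p, x, q] = -α y ![x, p, q] := fun x p q => form_swap _ _ _ _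
  have e' : ∀ x p q, α y ![p, q, x] = α y ![x, p, q] := fun x p q => (form_rot _ _ _ _).symm
  rw [e (Γ y a c), e' (Γ y a d), e (Γ y b c), e' (Γ y b d), e (Γ y c b), e' (Γ y c d),
    e (Γ y d b), e' (Γ y d c)]
  ring

theorem fderiv_form_comp {α : E7 → Form 3} (hα : DifferentiableAt ℝ α y) {g₁ g₂ g₃ : E7 → E7}
    (h₁ : DifferentiableAt ℝ g₁ y) (h₂ : DifferentiableAt ℝ g₂ y) (h₃ : DifferentiableAt ℝ g₃ y)
    (u : E7) :
    fderiv ℝ (fun z => α z ![g₁ z, g₂ z, g₃ z]) y u = fderiv ℝ α y u ![g₁ y, g₂ y, g₃ y] +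
      α y ![fderiv ℝ g₁ y u, g₂ y, g₃ y] + α y ![g₁ y, fderiv ℝ g₂ y u, g₃ y] +
      α y ![g₁ y, g₂ y, fderiv ℝ g₃ y u] := by
  have hg : ∀ i : Fin 3, DifferentiableAt ℝ ((![g₁, g₂, g₃] : Fin 3 → E7 → E7) i) y := by
    intro i
    fin_cases i <;> assumption
  have h := fderiv_continuousAlternatingMap_apply_apply hα hg u
  have e : ∀ z, (fun i => (![g₁, g₂, g₃] : Fin 3 → E7 → E7) i z) = ![g₁ z, g₂ z, g₃ z] := by
    intro z
    funext i
    fin_cases i <;> rfl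
  simp only [e, Fin.sum_univ_three] at h
  rw [h]
  simp only [← add_assoc]
  congr 1
  · congr 1
    · congr 1
      congr 1
      funext i
      fin_cases i <;> rfl
    · congr 1
      funext i
      fin_cases i <;> rfl
  · congr 1
    funext i
    fin_cases i <;> rfl

/-- The curvature annihilates the parallel form `φ`. -/
theorem IsLocalG2.curv_act (h : IsLocalG2 φ H Γ y) (u v a b c : E7) :
    φ y ![curv Γ y u v a, b, c] + φ y ![a, curv Γ y u v b, c] + φ y ![a, b, curv Γ y u v c] = 0 := by
  have hφd : DifferentiableAt ℝ φ y := h.phi_smooth.differentiableAt (by simp)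
  have hΓd : DifferentiableAt ℝ Γ y := h.christoffel_smooth.differentiableAt (by simp)
  have par : ∀ u a b c, fderiv ℝ φ y u ![a, b, c] =
      φ y ![Γ y u a, b, c] + φ y ![a, Γ y u b, c] + φ y ![a, b, Γ y u c] := by
    intro u a b c
    rw [fderiv_eq_covD Γ, h.form_par.self_of_nhds]
    simp
  have hd2 : DifferentiableAt ℝ (fderiv ℝ φ) y :=
    (h.phi_smooth.fderiv_right (m := 1) (by exact two_le_infty)).differentiableAt (by simp)
  have hΓ1 : ∀ v a, DifferentiableAt ℝ (fun z => Γ z v a) y := fun v a =>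
    (hΓd.clm_apply (differentiableAt_const _)).clm_apply (differentiableAt_const _)
  have hΓ2 : ∀ v a u, fderiv ℝ (fun z => Γ z v a) y u = fderiv ℝ Γ y u v a := by
    intro v a u
    have := (hΓd.hasFDerivAt.clm_apply (hasFDerivAt_const v y)).clm_apply (hasFDerivAt_const a y)
    rw [this.fderiv]
    simp
  have key : ∀ u v, fderiv ℝ (fderiv ℝ φ) y u v ![a, b, c] =
      fderiv ℝ (fun z => φ z ![Γ z v a, b, c] + φ z ![a, Γ z v b, c] + φ z ![a, b, Γ z v c]) y u := by
    intro u v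
    have e1 : (fun z => fderiv ℝ φ z v ![a, b, c]) =ᶠ[𝓝 y]
        fun z => φ z ![Γ z v a, b, c] + φ z ![a, Γ z v b, c] + φ z ![a, b, Γ z v c] := by
      filter_upwards [h.form_par] with z hz
      rw [fderiv_eq_covD Γ, hz]
      simp
    rw [← e1.fderiv_eq, fderiv_form_apply (α := fun z => fderiv ℝ φ z v)
      (hd2.clm_apply (differentiableAt_const _))]
    have := hd2.hasFDerivAt.clm_apply (hasFDerivAt_const v y)
    rw [this.fderiv]
    simp
  have comp : ∀ u v, fderiv ℝ (fderiv ℝ φ) y u v ![a, b, c] =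
      (fderiv ℝ φ y u ![Γ y v a, b, c] + φ y ![fderiv ℝ Γ y u v a, b, c]) +
      (fderiv ℝ φ y u ![a, Γ y v b, c] + φ y ![a, fderiv ℝ Γ y u v b, c]) +
      (fderiv ℝ φ y u ![a, b, Γ y v c] + φ y ![a, b, fderiv ℝ Γ y u v c]) := by
    intro u v
    have z1 : ∀ p q, φ y ![p, 0, q] = 0 := fun p q => by
      simpa using form_add₂ (φ y) 0 0 p q
    have z2 : ∀ p q, φ y ![p, q, 0] = 0 := fun p q => by
      simpa using form_add₃ (φ y) 0 0 p q
    have z3 : ∀ p q, φ y ![0, p, q] = 0 := fun p q => by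
      simpa using form_add₁ (φ y) 0 0 p q
    have c1 := fderiv_form_comp hφd (hΓ1 v a) (differentiableAt_const b) (differentiableAt_const c) u
    have c2 := fderiv_form_comp hφd (differentiableAt_const a) (hΓ1 v b) (differentiableAt_const c) u
    have c3 := fderiv_form_comp hφd (differentiableAt_const a) (differentiableAt_const b) (hΓ1 v c) u
    have d : ∀ {g₁ g₂ g₃ : E7 → E7}, DifferentiableAt ℝ g₁ y → DifferentiableAt ℝ g₂ y →
        DifferentiableAt ℝ g₃ y → DifferentiableAt ℝ (fun z => φ z ![g₁ z, g₂ z, g₃ z]) y := by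
      intro g₁ g₂ g₃ h₁ h₂ h₃
      have hg : ∀ i : Fin 3, DifferentiableAt ℝ ((![g₁, g₂, g₃] : Fin 3 → E7 → E7) i) y := by
        intro i
        fin_cases i <;> assumption
      have := hφd.continuousAlternatingMap_apply hg
      refine this.congr_of_eventuallyEq (Filter.Eventually.of_forall fun z => ?_)
      simp only
      congr 1
      funext i
      fin_cases i <;> rfl
    have d1 := d (hΓ1 v a) (differentiableAt_const b) (differentiableAt_const c)
    have d2 := d (differentiableAt_const a) (hΓ1 v b) (differentiableAt_const c)
    have d3 := d (differentiableAt_const a) (differentiableAt_const b) (hΓ1 v c)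
    have d4 := ((d1.hasFDerivAt.fun_add d2.hasFDerivAt).fun_add d3.hasFDerivAt).fderiv
    rw [key, d4]
    simp only [_root_.add_apply, c1, c2, c3, hΓ2]
    simp [z1, z2, z3]
  -- the Ricci identity for `φ`: symmetry of second derivatives
  have symm : fderiv ℝ (fderiv ℝ φ) y u v = fderiv ℝ (fderiv ℝ φ) y v u :=
    (h.phi_smooth.isSymmSndFDerivAt (by simpa using two_le_infty)) u v
  have e1 := comp u v
  rw [symm, comp v u] at e1
  simp only [par] at e1
  simp only [curv, form_sub₁, form_add₁, form_sub₂, form_add₂, form_sub₃, form_add₃]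
  linarith

/-- The first Bianchi identity with torsion. -/
theorem IsLocalG2.bianchi (h : IsLocalG2 φ H Γ y) (a u v w : E7) :
    metric (φ y) (curv Γ y a u v) w + metric (φ y) (curv Γ y u v a) w +
      metric (φ y) (curv Γ y v a u) w =
    covD Γ H y a ![u, v, w] + covD Γ H y u ![v, a, w] + covD Γ H y v ![a, u, w] +
      (H y ![tors Γ y a u, v, w] + H y ![tors Γ y u v, a, w] + H y ![tors Γ y v a, u, w]) := by
  have hΓd : DifferentiableAt ℝ Γ y := h.christoffel_smooth.differentiableAt (by simp)
  have hHd : DifferentiableAt ℝ H y := h.contDiffAt_torsion.differentiableAt (by simp)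
  have hgd : DifferentiableAt ℝ (fun z => metricB (φ z)) y :=
    (contDiffAt_metricB h.phi_smooth h.g2.self_of_nhds).differentiableAt (by simp)
  have hΓ1 : ∀ v a, DifferentiableAt ℝ (fun z => Γ z v a) y := fun v a =>
    (hΓd.clm_apply (differentiableAt_const _)).clm_apply (differentiableAt_const _)
  have hΓ2 : ∀ v a u, fderiv ℝ (fun z => Γ z v a) y u = fderiv ℝ Γ y u v a := by
    intro v a u
    have := (hΓd.hasFDerivAt.clm_apply (hasFDerivAt_const v y)).clm_apply (hasFDerivAt_const a y)
    rw [this.fderiv]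
    simp
  have tor := h.torsion.self_of_nhds
  -- differentiation of `g(T(u, v), w) = H(u, v, w)`; the cyclic sum is the Bianchi identity
  have key : ∀ a u v, metric (φ y) (fderiv ℝ Γ y a u v - fderiv ℝ Γ y a v u +
      Γ y a (tors Γ y u v)) w =
      covD Γ H y a ![u, v, w] + H y ![Γ y a u, v, w] + H y ![u, Γ y a v, w] := by
    intro a u v
    have e1 : (fun z => metric (φ z) (Γ z u v - Γ z v u) w) =ᶠ[𝓝 y] fun z => H z ![u, v, w] := by
      filter_upwards [h.torsion] with z hz using hz u v w
    have e2 := fderiv_metric hgd h.metric_par.self_of_nhds ((hΓ1 u v).sub (hΓ1 v u))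
      (differentiableAt_const w) a
    have e3 : fderiv ℝ (fun z => Γ z u v - Γ z v u) y a = fderiv ℝ Γ y a u v - fderiv ℝ Γ y a v u := by
      rw [fderiv_fun_sub (hΓ1 u v) (hΓ1 v u)]
      simp [hΓ2]
    have e4 : fderiv ℝ (fun z => metric (φ z) (Γ z u v - Γ z v u) w) y a = _ := e2
    rw [e1.fderiv_eq, fderiv_form_apply hHd, fderiv_eq_covD Γ] at e4
    simp only [Pi.sub_apply] at e4
    have e5 : fderiv ℝ ((fun z => Γ z u v) - fun z => Γ z v u) y a = _ := e3
    rw [e5] at e4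
    have e6 := tor u v (Γ y a w)
    simp only [fderiv_fun_const, Pi.zero_apply, _root_.zero_apply, zero_add] at e4
    rw [tors]
    linarith
  have k1 := key a u v
  have k2 := key u v a
  have k3 := key v a u
  simp only [curv, tors, metric_sub_left, metric_add_left, form_sub₁, map_sub] at k1 k2 k3 ⊢
  have s1 := form_swap (H y) u (Γ y a v) w
  have s2 := form_swap (H y) v (Γ y u a) w
  have s3 := form_swap (H y) a (Γ y v u) w
  linarith

end

/-! ### Consequences of `dH = 0` at a point -/

section

variable {φ H : E7 → Form 3} {Γ : E7 → E7 →L[ℝ] E7 →L[ℝ] E7} {y : E7}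

theorem form_tors (h : IsLocalG2 φ H Γ y) {L : E7 ≃L[ℝ] E7}
    (hL : φ y = phi0.compContinuousLinearMap (L : E7 →L[ℝ] E7)) (α : Form 3) (i j : Fin 7)
    (b c : E7) : α ![tors Γ y (adBasis L i) (adBasis L j), b, c] =
      ∑ n, formC L (H y) i j n * α ![adBasis L n, b, c] := by
  have e : ∀ n, L (tors Γ y (adBasis L i) (adBasis L j)) n = formC L (H y) i j n := fun n => by
    rw [← metric_adBasis, ← hL, tors, h.torsion.self_of_nhds, formC]
  conv_lhs => rw [eq_sum_adBasis L (tors Γ y (adBasis L i) (adBasis L j)), form_sum₁]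
  simp only [form_smul₁, e]

/-- As `φ` is parallel, `dφ` is given by the torsion alone. -/
theorem IsLocalG2.extDeriv_phi (h : IsLocalG2 φ H Γ y) {L : E7 ≃L[ℝ] E7}
    (hL : φ y = phi0.compContinuousLinearMap (L : E7 →L[ℝ] E7)) (i j k l : Fin 7) :
    extDeriv φ y ![adBasis L i, adBasis L j, adBasis L k, adBasis L l] =
      dphiC (formC L (H y)) i j k l := by
  have hP : ∀ i j k, φ y ![adBasis L i, adBasis L j, adBasis L k] = phiC i j k := fun i j k => by
    rw [hL, ← formC_phi0 L, formC]
  rw [extDeriv_eq_covD (Γ := Γ) (h.phi_smooth.differentiableAt (by simp)),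
    h.form_par.self_of_nhds]
  simp only [form_tors h hL, hP, dphiC, Finset.sum_add_distrib, Finset.sum_sub_distrib]
  simp

/-- The components of the covariant derivative of the torsion. -/
def nablaC (L : E7 ≃L[ℝ] E7) (N : E7 →L[ℝ] Form 3) (i : Fin 7) : Fin 7 → Fin 7 → Fin 7 → ℝ :=
  formC L (N (adBasis L i))

/-- The equation `dH = 0` in terms of `∇H` and the torsion. -/
theorem IsLocalG2.nabla_closed (h : IsLocalG2 φ H Γ y) (hd : extDeriv H y = 0) {L : E7 ≃L[ℝ] E7}
    (hL : φ y = phi0.compContinuousLinearMap (L : E7 →L[ℝ] E7)) (i j k l : Fin 7) :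
    nablaC L (covD Γ H y) i j k l - nablaC L (covD Γ H y) j i k l + nablaC L (covD Γ H y) k i j l -
      nablaC L (covD Γ H y) l i j k + 2 * torsionSq (formC L (H y)) i j k l = 0 := by
  have e := extDeriv_eq_covD (Γ := Γ) (h.contDiffAt_torsion.differentiableAt (by simp))
    (adBasis L i) (adBasis L j) (adBasis L k) (adBasis L l)
  rw [hd] at e
  simp only [form_tors h hL] at e
  have hh : IsAlt3 (formC L (H y)) := isAlt3_form _ _
  have rot : ∀ a b c, formC L (H y) a b c = formC L (H y) b c a := fun a b c => by
    rw [hh.1, hh.2, neg_neg]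
  have q : 2 * torsionSq (formC L (H y)) i j k l =
      ∑ n, formC L (H y) i j n * formC L (H y) n k l -
      ∑ n, formC L (H y) i k n * formC L (H y) n j l +
      ∑ n, formC L (H y) i l n * formC L (H y) n j k +
      ∑ n, formC L (H y) j k n * formC L (H y) n i l -
      ∑ n, formC L (H y) j l n * formC L (H y) n i k +
      ∑ n, formC L (H y) k l n * formC L (H y) n i j := by
    rw [torsionSq, Finset.mul_sum]
    simp only [← Finset.sum_add_distrib, ← Finset.sum_sub_distrib]
    refine Finset.sum_congr rfl fun m _ => ?_
    rw [hh.1 k i m, rot m k l, rot m i l, rot m j l, rot m j k, rot m i k, rot m i j]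
    ring
  rw [q]
  exact e.symm

/-- The contraction of `∇H` with `φ` vanishes: the curvature takes values in `𝔤₂`, by
`IsLocalG2.curv_act`, and the contracted first Bianchi identity and `dH = 0` leave nothing else. -/
theorem IsLocalG2.nabla_contract (h : IsLocalG2 φ H Γ y) (hd : extDeriv H y = 0) {L : E7 ≃L[ℝ] E7}
    (hL : φ y = phi0.compContinuousLinearMap (L : E7 →L[ℝ] E7)) (i : Fin 7) :
    ∑ j, ∑ k, ∑ l, nablaC L (covD Γ H y) i j k l * phiC j k l = 0 := by
  have hP : ∀ i j k, φ y ![adBasis L i, adBasis L j, adBasis L k] = phiC i j k := fun i j k => by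
    rw [hL, ← formC_phi0 L, formC]
  have hstab : ∀ i j a b c, ∑ l, L (curv Γ y (adBasis L i) (adBasis L j) (adBasis L a)) l *
      phiC l b c + ∑ l, L (curv Γ y (adBasis L i) (adBasis L j) (adBasis L b)) l * phiC a l c +
      ∑ l, L (curv Γ y (adBasis L i) (adBasis L j) (adBasis L c)) l * phiC a b l = 0 := by
    intro i j a b c
    have e := h.curv_act (adBasis L i) (adBasis L j) (adBasis L a) (adBasis L b) (adBasis L c)
    have e1 : ∀ x p q, φ y ![x, adBasis L p, adBasis L q] = ∑ l, L x l * phiC l p q := by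
      intro x p q
      conv_lhs => rw [eq_sum_adBasis L x, form_sum₁]
      simp only [form_smul₁, hP]
    have e2 : ∀ x p q, φ y ![adBasis L p, x, adBasis L q] = ∑ l, L x l * phiC p l q := by
      intro x p q
      rw [form_swap, e1, ← Finset.sum_neg_distrib]
      exact Finset.sum_congr rfl fun l _ => by rw [phiC_swap p]; ring
    have e3 : ∀ x p q, φ y ![adBasis L p, adBasis L q, x] = ∑ l, L x l * phiC p q l := by
      intro x p q
      rw [← form_rot, e1]
      exact Finset.sum_congr rfl fun l _ => by rw [phiC_rot l]
    rw [e1, e2, e3] at e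
    exact e
  refine sum_nabla_mul_phiC (h := formC L (H y))
    (R := fun i j k l => L (curv Γ y (adBasis L i) (adBasis L j) (adBasis L k)) l)
    (isAlt3_form _ _) (fun i => isAlt3_form _ _) (h.nabla_closed hd hL) ?_ ?_ ?_ ?_ i
  · intro i j k l
    have e := h.bianchi (adBasis L i) (adBasis L j) (adBasis L k) (adBasis L l)
    simp only [form_tors h hL] at e
    rw [hL] at e
    simp only [metric_adBasis] at e
    rw [torsionSq]
    simp only [Finset.sum_add_distrib]
    exact e
  · intro i j k l
    have : curv Γ y (adBasis L i) (adBasis L j) (adBasis L k) =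
        -curv Γ y (adBasis L j) (adBasis L i) (adBasis L k) := by
      simp only [curv]
      abel
    rw [this, map_neg]
    rfl
  · exact fun i j => stabilizer_skew (hstab i j)
  · exact fun i j => stabilizer_contract (hstab i j)

theorem trace_eq_sum (A : E7 →L[ℝ] E7) :
    LinearMap.trace ℝ E7 (A : E7 →ₗ[ℝ] E7) = ∑ m, A (stdVec m) m := by
  rw [LinearMap.trace_eq_matrix_trace ℝ stdBasis, Matrix.trace]
  refine Finset.sum_congr rfl fun m _ => ?_
  rw [Matrix.diag_apply, LinearMap.toMatrix_apply, stdBasis_apply]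
  rfl

theorem trace_eq_sum_adBasis (L : E7 ≃L[ℝ] E7) (A : E7 →L[ℝ] E7) :
    LinearMap.trace ℝ E7 (A : E7 →ₗ[ℝ] E7) = ∑ m, L (A (adBasis L m)) m := by
  rw [← LinearMap.trace_conj' (A : E7 →ₗ[ℝ] E7) L.toLinearEquiv]
  exact trace_eq_sum ((L : E7 →L[ℝ] E7) ∘L A ∘L (L.symm : E7 →L[ℝ] E7))

theorem adBasis_coord (L : E7 ≃L[ℝ] E7) (m n : Fin 7) :
    L (adBasis L m) n = if n = m then 1 else 0 := by
  simp [adBasis, stdVec_apply]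

theorem comp_parFrame {Γ : E7 → E7 →L[ℝ] E7 →L[ℝ] E7} {y z : E7} {E : E7 ≃L[ℝ] E7}
    (hE : (E : E7 →L[ℝ] E7) = parFrame Γ y z) {k : ℕ} (α : Form k) :
    α.compContinuousLinearMap (parFrame Γ y z) =
      α.compContinuousLinearMap (E : E7 →L[ℝ] E7) := by
  rw [hE]

theorem comp_parFrame_self {Γ : E7 → E7 →L[ℝ] E7 →L[ℝ] E7} {y : E7} {k : ℕ} (α : Form k) :
    α.compContinuousLinearMap (parFrame Γ y y) = α := by
  rw [parFrame_self]
  rfl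

/-- If `dH = 0` at `y`, then the function `⟨H, φ⟩` is stationary at `y`. -/
theorem IsLocalG2.fderiv_scalar (h : IsLocalG2 φ H Γ y) (hd : extDeriv H y = 0) :
    DifferentiableAt ℝ (fun z => formInner (φ z) (H z) (φ z)) y ∧
      fderiv ℝ (fun z => formInner (φ z) (H z) (φ z)) y = 0 := by
  have hφd : DifferentiableAt ℝ φ y := h.phi_smooth.differentiableAt (by simp)
  have hHd : DifferentiableAt ℝ H y := h.contDiffAt_torsion.differentiableAt (by simp)
  have hφ' := hasFDerivAt_comp_parFrame Γ hφd
  rw [h.form_par.self_of_nhds] at hφ'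
  have hH' := hasFDerivAt_comp_parFrame Γ hHd
  have hG : DifferentiableAt ℝ (fun p : Form 3 × Form 3 => formInner p.1 p.2 p.1) (φ y, H y) :=
    (contDiffAt_formInner (n := 1) contDiffAt_fst h.g2.self_of_nhds contDiffAt_snd
      contDiffAt_fst).differentiableAt (by simp)
  have e : (fun z => formInner (φ z) (H z) (φ z)) =ᶠ[𝓝 y]
      fun z => formInner ((φ z).compContinuousLinearMap (parFrame Γ y z))
        ((H z).compContinuousLinearMap (parFrame Γ y z))
        ((φ z).compContinuousLinearMap (parFrame Γ y z)) := by
    filter_upwards [h.g2, eventually_parFrame Γ y] with z hz ⟨E, hE⟩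
    rw [comp_parFrame hE, comp_parFrame hE, formInner_comp_equiv hz]
  have key := fderiv_of_stationary (G := fun p : Form 3 × Form 3 => formInner p.1 p.2 p.1)
    (φ := fun z => (φ z).compContinuousLinearMap (parFrame Γ y z))
    (h := fun z => (H z).compContinuousLinearMap (parFrame Γ y z)) (y := y) (N := covD Γ H y)
    (by simpa only [comp_parFrame_self] using hG)
    (fun a b => by simp [formInner, mul_add, add_mul, Finset.sum_add_distrib])
    (fun r a => by
      simp only [formInner, ContinuousAlternatingMap.smul_apply, smul_eq_mul, Finset.mul_sum]
      exact Finset.sum_congr rfl fun I _ => Finset.sum_congr rfl fun J _ => by ring)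
    hφ' hH'
  refine ⟨(e.differentiableAt_iff).2 key.1, ?_⟩
  rw [e.fderiv_eq]
  obtain ⟨L, hL⟩ := h.g2.self_of_nhds
  have e2 : ∀ i, fderiv ℝ (fun z => formInner ((φ z).compContinuousLinearMap (parFrame Γ y z))
        ((H z).compContinuousLinearMap (parFrame Γ y z))
        ((φ z).compContinuousLinearMap (parFrame Γ y z))) y (adBasis L i) = 0 := by
    intro i
    rw [key.2]
    simp only [comp_parFrame_self]
    rw [hL, formInner_phi_eq]
    have := h.nabla_contract hd hL i
    simp only [nablaC] at this
    rw [this, mul_zero]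
  ext u
  rw [eq_sum_adBasis L u, map_sum]
  simp only [map_smul, e2]
  simp

/-- If `dH = 0` at `y` and the Lee form of `φ` is `df`, then the divergence of `e^{-f} ∇f` is
`e^{-f} (⟨H, φ⟩² - |H|²)`. -/
theorem IsLocalG2.div_lee (h : IsLocalG2 φ H Γ y) (hd : extDeriv H y = 0) {f : E7 → ℝ}
    (hf : DifferentiableAt ℝ f y) {X : E7 → E7} (hX : DifferentiableAt ℝ X y)
    (hlee : ∀ᶠ z in 𝓝 y, ∀ w, leeInv (φ z) (H z) w = fderiv ℝ f z w)
    (hXf : ∀ᶠ z in 𝓝 y, ∀ w, metric (φ z) (X z) w = Real.exp (-f z) * fderiv ℝ f z w) :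
    LinearMap.trace ℝ E7 ((fderiv ℝ X y + (Γ y).flip (X y) : E7 →L[ℝ] E7) : E7 →ₗ[ℝ] E7) =
      Real.exp (-f y) * (formInner (φ y) (H y) (φ y) ^ 2 - formInner (φ y) (H y) (H y)) := by
  have hφd : DifferentiableAt ℝ φ y := h.phi_smooth.differentiableAt (by simp)
  have hHd : DifferentiableAt ℝ H y := h.contDiffAt_torsion.differentiableAt (by simp)
  have hgd : DifferentiableAt ℝ (fun z => metricB (φ z)) y :=
    (contDiffAt_metricB h.phi_smooth h.g2.self_of_nhds).differentiableAt (by simp)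
  have hφ' := hasFDerivAt_comp_parFrame Γ hφd
  rw [h.form_par.self_of_nhds] at hφ'
  have hH' := hasFDerivAt_comp_parFrame Γ hHd
  obtain ⟨L, hL⟩ := h.g2.self_of_nhds
  -- the derivative of `df` in the frame that is parallel at `y`
  have dlee : ∀ w, DifferentiableAt ℝ (fun z => fderiv ℝ f z (parFrame Γ y z w)) y ∧
      ∀ u, fderiv ℝ (fun z => fderiv ℝ f z (parFrame Γ y z w)) y u =
        leeInv (φ y) (covD Γ H y u) w := by
    intro w
    have hG : DifferentiableAt ℝ (fun p : Form 3 × Form 3 => leeInv p.1 p.2 w) (φ y, H y) :=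
      (contDiffAt_leeInv (n := 1) contDiffAt_fst h.g2.self_of_nhds contDiffAt_snd
        w).differentiableAt (by simp)
    have e : (fun z => fderiv ℝ f z (parFrame Γ y z w)) =ᶠ[𝓝 y]
        fun z => leeInv ((φ z).compContinuousLinearMap (parFrame Γ y z))
          ((H z).compContinuousLinearMap (parFrame Γ y z)) w := by
      filter_upwards [h.g2, eventually_parFrame Γ y, hlee] with z hz ⟨E, hE⟩ hz2
      rw [comp_parFrame hE, comp_parFrame hE, leeInv_comp_equiv hz, hz2, ← hE]
      rfl
    have key := fderiv_of_stationary (G := fun p : Form 3 × Form 3 => leeInv p.1 p.2 w)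
      (φ := fun z => (φ z).compContinuousLinearMap (parFrame Γ y z))
      (h := fun z => (H z).compContinuousLinearMap (parFrame Γ y z)) (y := y) (N := covD Γ H y)
      (by simpa only [comp_parFrame_self] using hG)
      (fun a b => by simp [leeInv, mul_add, add_mul, Finset.sum_add_distrib])
      (fun r a => by
        simp only [leeInv, ContinuousAlternatingMap.smul_apply, smul_eq_mul, Finset.mul_sum]
        exact Finset.sum_congr rfl fun I _ => Finset.sum_congr rfl fun J _ => by ring)
      hφ' hH'
    refine ⟨(e.differentiableAt_iff).2 key.1, fun u => ?_⟩
    rw [e.fderiv_eq, key.2]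
    simp only [comp_parFrame_self]
  have hE : ∀ w, HasFDerivAt (fun z => parFrame Γ y z w) (-(Γ y).flip w) y := by
    intro w
    have := (hasFDerivAt_parFrame Γ y).clm_apply (hasFDerivAt_const w y)
    refine this.congr_fderiv ?_
    ext u
    simp
  have hexp : HasFDerivAt (fun z => Real.exp (-f z)) (Real.exp (-f y) • -fderiv ℝ f y) y :=
    hf.hasFDerivAt.neg.exp
  have main : ∀ u w, metric (φ y) (fderiv ℝ X y u + Γ y u (X y)) w =
      Real.exp (-f y) * (leeInv (φ y) (covD Γ H y u) w - fderiv ℝ f y u * fderiv ℝ f y w) := by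
    intro u w
    have e1 := fderiv_metric hgd h.metric_par.self_of_nhds hX (hE w).differentiableAt u
    rw [(hE w).fderiv] at e1
    have e2 : (fun z => metric (φ z) (X z) (parFrame Γ y z w)) =ᶠ[𝓝 y]
        fun z => Real.exp (-f z) * fderiv ℝ f z (parFrame Γ y z w) := by
      filter_upwards [hXf] with z hz using hz _
    rw [e2.fderiv_eq, (hexp.fun_mul (dlee w).1.hasFDerivAt).fderiv] at e1
    have e3 := (dlee w).2 u
    have z1 : metric (φ y) (X y) 0 = 0 := by rw [← metricL_apply, map_zero]
    simp only [parFrame_self, _root_.add_apply, _root_.smul_apply, e3,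
      ContinuousLinearMap.id_apply, _root_.neg_apply, ContinuousLinearMap.flip_apply,
      neg_add_cancel, z1, smul_eq_mul] at e1
    linarith
  have hlee' : ∀ m, fderiv ℝ f y (adBasis L m) = leeC (formC L (H y)) m := by
    intro m
    rw [← hlee.self_of_nhds, hL, leeInv_comp]
    simp [adBasis_coord]
  rw [trace_eq_sum_adBasis L]
  have hsum : ∀ m, L ((fderiv ℝ X y + (Γ y).flip (X y) : E7 →L[ℝ] E7) (adBasis L m)) m =
      Real.exp (-f y) * (leeC (nablaC L (covD Γ H y) m) m - leeC (formC L (H y)) m ^ 2) := by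
    intro m
    have e := main (adBasis L m) (adBasis L m)
    rw [hlee', hL, metric_adBasis, leeInv_comp] at e
    simp only [adBasis_coord, ite_mul, one_mul, zero_mul, Finset.sum_ite_eq',
      Finset.mem_univ, if_true] at e
    rw [sq]
    exact e
  simp only [hsum]
  rw [← Finset.mul_sum, Finset.sum_sub_distrib,
    sum_leeC_nabla (h := formC L (H y)) (N := nablaC L (covD Γ H y)) (isAlt3_form _ _) (fun i => isAlt3_form _ _)
      (h.nabla_closed hd hL), hL, formInner_self_eq, formInner_phi_eq, ← sum_contrPhi_diag,
    sum_contrPhi_sq (h := formC L (H y)) (isAlt3_form _ _)]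
  ring

end

/-! ### The divergence theorem in a chart -/

/-- The volume coefficient is multiplied by the determinant under linear maps. -/
theorem volCoeff_compCLM {φ : Form 3} (h : IsG2Form φ) (A : E7 →L[ℝ] E7) :
    volCoeff (φ.compContinuousLinearMap A) =
      volCoeff φ * LinearMap.det (A : E7 →ₗ[ℝ] E7) := by
  obtain ⟨L, rfl⟩ := h
  have e : (phi0.compContinuousLinearMap (L : E7 →L[ℝ] E7)).compContinuousLinearMap A =
      phi0.compContinuousLinearMap ((L : E7 →L[ℝ] E7).comp A) := rfl
  rw [e, volCoeff_comp, volCoeff_comp, ← LinearMap.det_comp]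
  rfl

theorem hasDerivAt_det (A : E7 →L[ℝ] E7) :
    HasDerivAt (fun t : ℝ =>
      LinearMap.det ((ContinuousLinearMap.id ℝ E7 - t • A : E7 →L[ℝ] E7) : E7 →ₗ[ℝ] E7))
      (-LinearMap.trace ℝ E7 (A : E7 →ₗ[ℝ] E7)) 0 := by
  set b := (EuclideanSpace.basisFun (Fin 7) ℝ).toBasis
  set N := LinearMap.toMatrix b b (A : E7 →ₗ[ℝ] E7) with hN
  have e : (fun t : ℝ =>
      LinearMap.det ((ContinuousLinearMap.id ℝ E7 - t • A : E7 →L[ℝ] E7) : E7 →ₗ[ℝ] E7)) =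
      fun t : ℝ => (Polynomial.eval (-t)
        (Matrix.det (1 + (Polynomial.X : Polynomial ℝ) • N.map Polynomial.C))) := by
    funext t
    rw [← LinearMap.det_toMatrix b, ← Polynomial.coe_evalRingHom, RingHom.map_det]
    congr 1
    ext i j
    simp [hN, Matrix.one_apply, LinearMap.toMatrix_apply, sub_eq_add_neg, Matrix.map_apply]
    have : ∀ i j : Fin 7, (b.repr (b j)) i = if i = j then 1 else 0 := fun i j => by
      simp [Finsupp.single_apply, eq_comm]
    split_ifs <;> simp_all [mul_comm]
  rw [e]
  have h := (Polynomial.hasDerivAt (Matrix.det (1 + (Polynomial.X : Polynomial ℝ) •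
    N.map Polynomial.C)) (-0 : ℝ)).scomp (0 : ℝ) (hasDerivAt_neg (0 : ℝ))
  rw [neg_zero, Matrix.derivative_det_one_add_X_smul, hN,
    LinearMap.trace_eq_matrix_trace ℝ b] at *
  rw [neg_one_smul] at h
  exact h

section

variable {φ H : E7 → Form 3} {Γ : E7 → E7 →L[ℝ] E7 →L[ℝ] E7} {y : E7}

/-- The volume form is parallel, as it is a function of the parallel form `φ`. -/
theorem IsLocalG2.fderiv_volCoeff (h : IsLocalG2 φ H Γ y) (u : E7) :
    fderiv ℝ (fun z => volCoeff (φ z)) y u =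
      volCoeff (φ y) * LinearMap.trace ℝ E7 (Γ y u : E7 →ₗ[ℝ] E7) := by
  have hφd : DifferentiableAt ℝ φ y := h.phi_smooth.differentiableAt (by simp)
  have hφ' := hasFDerivAt_comp_parFrame Γ hφd
  rw [h.form_par.self_of_nhds] at hφ'
  have hv : DifferentiableAt ℝ (fun z => volCoeff (φ z)) y :=
    (contDiffAt_volCoeff h.phi_smooth h.g2.self_of_nhds).differentiableAt (by simp)
  have hV : DifferentiableAt ℝ volCoeff ((φ y).compContinuousLinearMap (parFrame Γ y y)) := by
    rw [comp_parFrame_self]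
    exact (contDiffAt_volCoeff (n := 1) contDiffAt_id h.g2.self_of_nhds).differentiableAt (by simp)
  have h1 := hV.hasFDerivAt.comp y hφ'
  rw [ContinuousLinearMap.comp_zero] at h1
  have hl : HasDerivAt (fun t : ℝ => y + t • u) u 0 := by
    simpa using ((hasDerivAt_id (0 : ℝ)).smul_const u).const_add y
  have hy : y + (0 : ℝ) • u = y := by simp
  have h2 := HasFDerivAt.comp_hasDerivAt (f := fun t : ℝ => y + t • u) (0 : ℝ)
    (by rw [hy]; exact h1) hl
  have h3 := HasFDerivAt.comp_hasDerivAt (f := fun t : ℝ => y + t • u) (0 : ℝ)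
    (by rw [hy]; exact hv.hasFDerivAt) hl
  have h4 := h3.mul (hasDerivAt_det (Γ y u))
  -- in the frame that is parallel at `y` the volume coefficient is stationary, and the frame
  -- contributes the trace of `Γ`
  have e : (volCoeff ∘ fun z => (φ z).compContinuousLinearMap (parFrame Γ y z)) ∘
      (fun t : ℝ => y + t • u) =ᶠ[𝓝 0]
      ((fun z => volCoeff (φ z)) ∘ fun t : ℝ => y + t • u) * fun t : ℝ =>
        LinearMap.det ((ContinuousLinearMap.id ℝ E7 - t • Γ y u : E7 →L[ℝ] E7) : E7 →ₗ[ℝ] E7) := by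
    have hc : Filter.Tendsto (fun t : ℝ => y + t • u) (𝓝 0) (𝓝 y) := by
      simpa using hl.continuousAt.tendsto
    filter_upwards [hc.eventually h.g2] with t ht
    have : parFrame Γ y (y + t • u) = ContinuousLinearMap.id ℝ E7 - t • Γ y u := by
      simp [parFrame]
    simp only [Function.comp_apply, Pi.mul_apply, volCoeff_compCLM ht, this]
  have h5 := h2.unique (h4.congr_of_eventuallyEq e)
  simp at h5
  linarith

/-- As the torsion is skew, the two contractions of the Christoffel operators agree. -/
theorem IsLocalG2.trace_flip (h : IsLocalG2 φ H Γ y) (X : E7) :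
    LinearMap.trace ℝ E7 (Γ y X : E7 →ₗ[ℝ] E7) =
      LinearMap.trace ℝ E7 ((Γ y).flip X : E7 →ₗ[ℝ] E7) := by
  obtain ⟨L, hL⟩ := h.g2.self_of_nhds
  rw [trace_eq_sum_adBasis L, trace_eq_sum_adBasis L]
  refine Finset.sum_congr rfl fun m _ => ?_
  have h1 := h.torsion.self_of_nhds X (adBasis L m) (adBasis L m)
  have h0 : H y ![X, adBasis L m, adBasis L m] = 0 :=
    (H y).map_eq_zero_of_eq _ (i := 1) (j := 2) rfl (by decide)
  rw [h0, metric_sub_left, hL, metric_adBasis, metric_adBasis] at h1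
  rw [ContinuousLinearMap.flip_apply]
  linarith

/-- The divergence with respect to a metric connection with skew torsion is the Riemannian
divergence. -/
theorem IsLocalG2.trace_fderiv_vol_smul (h : IsLocalG2 φ H Γ y) {X : E7 → E7}
    (hX : DifferentiableAt ℝ X y) :
    LinearMap.trace ℝ E7 (fderiv ℝ (fun z => |volCoeff (φ z)| • X z) y : E7 →ₗ[ℝ] E7) =
      |volCoeff (φ y)| * LinearMap.trace ℝ E7
        ((fderiv ℝ X y + (Γ y).flip (X y) : E7 →L[ℝ] E7) : E7 →ₗ[ℝ] E7) := by
  have hv : DifferentiableAt ℝ (fun z => volCoeff (φ z)) y :=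
    (contDiffAt_volCoeff h.phi_smooth h.g2.self_of_nhds).differentiableAt (by simp)
  have h0 := h.g2.self_of_nhds.volCoeff_ne_zero
  have hab := hv.hasFDerivAt.abs h0
  rw [(hab.fun_smul hX.hasFDerivAt).fderiv]
  have h1 : LinearMap.trace ℝ E7 (((SignType.sign (volCoeff (φ y)) : ℝ) •
      fderiv ℝ (fun z => volCoeff (φ z)) y).smulRight (X y) : E7 →L[ℝ] E7).toLinearMap =
      |volCoeff (φ y)| * LinearMap.trace ℝ E7 ((Γ y).flip (X y) : E7 →ₗ[ℝ] E7) := by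
    rw [show ((((SignType.sign (volCoeff (φ y)) : ℝ) •
      fderiv ℝ (fun z => volCoeff (φ z)) y).smulRight (X y) : E7 →L[ℝ] E7) : E7 →ₗ[ℝ] E7) =
      LinearMap.smulRight ((((SignType.sign (volCoeff (φ y)) : ℝ) •
      fderiv ℝ (fun z => volCoeff (φ z)) y) : E7 →L[ℝ] ℝ) : E7 →ₗ[ℝ] ℝ) (X y) from rfl,
      LinearMap.trace_smulRight]
    simp only [ContinuousLinearMap.coe_coe, _root_.smul_apply, smul_eq_mul, h.fderiv_volCoeff,
      ← h.trace_flip, ← mul_assoc]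
    rw [sign_mul_self]
  rw [show ∀ A B : E7 →L[ℝ] E7, ((A + B : E7 →L[ℝ] E7) : E7 →ₗ[ℝ] E7) =
      (A : E7 →ₗ[ℝ] E7) + (B : E7 →ₗ[ℝ] E7) from fun _ _ => rfl,
    show ∀ (r : ℝ) (A : E7 →L[ℝ] E7), ((r • A : E7 →L[ℝ] E7) : E7 →ₗ[ℝ] E7) =
      r • (A : E7 →ₗ[ℝ] E7) from fun _ _ => rfl, map_add, map_smul, h1,
    show ∀ A B : E7 →L[ℝ] E7, ((A + B : E7 →L[ℝ] E7) : E7 →ₗ[ℝ] E7) =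
      (A : E7 →ₗ[ℝ] E7) + (B : E7 →ₗ[ℝ] E7) from fun _ _ => rfl, map_add, smul_eq_mul]
  ring

end

/-- The divergence theorem in `ℝ⁷`, for a compactly supported field. -/
theorem integral_trace_fderiv_eq_zero {W : E7 → E7} (hW : ContDiff ℝ 1 W)
    (hs : HasCompactSupport W) :
    ∫ z, LinearMap.trace ℝ E7 (fderiv ℝ W z : E7 →ₗ[ℝ] E7) = 0 := by
  have hd : Differentiable ℝ W := hW.differentiable (by simp)
  have hc : ∀ i : Fin 7, ContDiff ℝ 1 fun z => W z i := fun i =>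
    (EuclideanSpace.proj i : E7 →L[ℝ] ℝ).contDiff.comp hW
  have hsi : ∀ i : Fin 7, HasCompactSupport fun z => W z i := fun i =>
    hs.comp_left (g := fun v : E7 => v i) rfl
  have e : ∀ z, LinearMap.trace ℝ E7 (fderiv ℝ W z : E7 →ₗ[ℝ] E7) =
      ∑ i, fderiv ℝ (fun z => W z i) z (stdVec i) := by
    intro z
    rw [trace_eq_sum]
    refine Finset.sum_congr rfl fun i _ => ?_
    have := ((EuclideanSpace.proj i : E7 →L[ℝ] ℝ).hasFDerivAt.comp z (hd z).hasFDerivAt).fderiv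
    rw [show (fun z => W z i) = (EuclideanSpace.proj i : E7 →L[ℝ] ℝ) ∘ W from rfl, this]
    rfl
  have hi : ∀ i : Fin 7, Integrable fun z => fderiv ℝ (fun z => W z i) z (stdVec i) := fun i =>
    (((hc i).continuous_fderiv (by simp)).clm_apply continuous_const).integrable_of_hasCompactSupport
      ((hsi i).fderiv_apply (𝕜 := ℝ) (stdVec i))
  simp_rw [e]
  rw [integral_finsetSum _ fun i _ => hi i]
  refine Finset.sum_eq_zero fun i _ => ?_
  have := integral_mul_fderiv_eq_neg_fderiv_mul_of_integrable (μ := (volume : Measure E7))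
    (f := fun _ : E7 => (1 : ℝ)) (g := fun z => W z i) (v := stdVec i)
    (by simp) (by simpa using hi i)
    (by simpa using (hc i).continuous.integrable_of_hasCompactSupport (hsi i))
    (fun _ _ => differentiableAt_const _) (fun z _ => (hc i).differentiable (by simp) z)
  simpa using this

/-! ### Vector fields in a chart -/

theorem target_mem_nhds {M : Type*} [TopologicalSpace M] [ChartedSpace E7 M] (p : M)
    {z : E7} (hz : z ∈ (extChartAt (𝓡 7) p).target) :
    (extChartAt (𝓡 7) p).target ∈ 𝓝 z :=
  (isOpen_extChartAt_target p).mem_nhds hz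

theorem symm_mem_source {M : Type*} [TopologicalSpace M] [ChartedSpace E7 M] {p : M}
    {z : E7} (hz : z ∈ (extChartAt (𝓡 7) p).target) :
    (extChartAt (𝓡 7) p).source ∈ 𝓝 ((extChartAt (𝓡 7) p).symm z) :=
  (isOpen_extChartAt_source p).mem_nhds ((extChartAt (𝓡 7) p).map_target hz)

section

variable {M : Type*} [TopologicalSpace M] [ChartedSpace E7 M] [IsManifold (𝓡 7) ∞ M]

/-- The derivative of the inverse of the chart centred at `p`, as a linear automorphism of `ℝ⁷`. -/
def chartEquiv (p : M) {z : E7} (hz : z ∈ (extChartAt (𝓡 7) p).target) : E7 ≃L[ℝ] E7 :=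
  ContinuousLinearEquiv.equivOfInverse
    (mfderiv 𝓘(ℝ, E7) (𝓡 7) (extChartAt (𝓡 7) p).symm z : E7 →L[ℝ] E7)
    (mfderiv (𝓡 7) 𝓘(ℝ, E7) (extChartAt (𝓡 7) p) ((extChartAt (𝓡 7) p).symm z) : E7 →L[ℝ] E7)
    (fun v => by
      have : IsManifold (𝓡 7) 1 M := .of_le (n := ∞) (by simp)
      have := mfderiv_extChartAt_comp_mfderivWithin_extChartAt_symm hz
      rw [ModelWithCorners.range_eq_univ, mfderivWithin_univ] at this
      exact congrArg (fun A : E7 →L[ℝ] E7 => A v) this)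
    (fun v => by
      have : IsManifold (𝓡 7) 1 M := .of_le (n := ∞) (by simp)
      have := mfderivWithin_extChartAt_symm_comp_mfderiv_extChartAt hz
      rw [ModelWithCorners.range_eq_univ, mfderivWithin_univ] at this
      exact congrArg (fun A : E7 →L[ℝ] E7 => A v) this)

theorem formInChart_eq {k : ℕ} (p : M) {z : E7} (hz : z ∈ (extChartAt (𝓡 7) p).target)
    (α : DForm M k) : formInChart p α z =
      ContinuousAlternatingMap.compContinuousLinearMap
        (α ((extChartAt (𝓡 7) p).symm z) : Form k) (chartEquiv p hz : E7 →L[ℝ] E7) := rfl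

/-- The coordinate expression of a vector field in the chart centred at `p`. -/
def fieldInChart (p : M) (Y : VField M) (z : E7) : E7 :=
  (mfderiv (𝓡 7) 𝓘(ℝ, E7) (extChartAt (𝓡 7) p) ((extChartAt (𝓡 7) p).symm z) : E7 →L[ℝ] E7)
    (Y ((extChartAt (𝓡 7) p).symm z))

theorem chartEquiv_fieldInChart (p : M) {z : E7} (hz : z ∈ (extChartAt (𝓡 7) p).target)
    (Y : VField M) : chartEquiv p hz (fieldInChart p Y z) = Y ((extChartAt (𝓡 7) p).symm z) :=
  (chartEquiv p hz).apply_symm_apply _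

theorem fieldInChart_eq (p : M) {z : E7} (hz : z ∈ (extChartAt (𝓡 7) p).target)
    (Y : VField M) : fieldInChart p Y z =
      (chartEquiv p hz).symm (Y ((extChartAt (𝓡 7) p).symm z)) := rfl

/-- The vector field on the domain of the chart centred at `p` with constant coordinates `v`. -/
def constField (p : M) (v : E7) : VField M := fun x =>
  (trivializationAt E7 (TangentSpace (𝓡 7) : M → Type) p).symmL ℝ x v

theorem constField_symm (p : M) {z : E7} (hz : z ∈ (extChartAt (𝓡 7) p).target) (v : E7) :
    constField p v ((extChartAt (𝓡 7) p).symm z) = chartEquiv p hz v := by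
  have : IsManifold (𝓡 7) 1 M := .of_le (n := ∞) (by simp)
  have hx : (extChartAt (𝓡 7) p).symm z ∈ (chartAt E7 p).source := by
    rw [← extChartAt_source (𝓡 7)]
    exact (extChartAt (𝓡 7) p).map_target hz
  rw [constField, TangentBundle.symmL_trivializationAt hx, ModelWithCorners.range_eq_univ,
    mfderivWithin_univ, (extChartAt (𝓡 7) p).right_inv hz]
  rfl

theorem fieldInChart_constField (p : M) {z : E7} (hz : z ∈ (extChartAt (𝓡 7) p).target) (v : E7) :
    fieldInChart p (constField p v) z = v := by
  rw [fieldInChart_eq p hz, constField_symm p hz]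
  exact (chartEquiv p hz).symm_apply_apply v

theorem mdifferentiableAt_iff_chart {F : Type*} [NormedAddCommGroup F] [NormedSpace ℝ F] (p : M)
    {z : E7} (hz : z ∈ (extChartAt (𝓡 7) p).target) (g : M → F) :
    MDifferentiableAt (𝓡 7) 𝓘(ℝ, F) g ((extChartAt (𝓡 7) p).symm z) ↔
      DifferentiableAt ℝ (g ∘ (extChartAt (𝓡 7) p).symm) z := by
  have : IsManifold (𝓡 7) 1 M := .of_le (n := ∞) (by simp)
  have hx : (extChartAt (𝓡 7) p).symm z ∈ (extChartAt (𝓡 7) p).source :=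
    (extChartAt (𝓡 7) p).map_target hz
  have h1 : MDifferentiableAt 𝓘(ℝ, E7) (𝓡 7) (extChartAt (𝓡 7) p).symm z := by
    have := mdifferentiableWithinAt_extChartAt_symm (I := 𝓡 7) hz
    rwa [ModelWithCorners.range_eq_univ, mdifferentiableWithinAt_univ] at this
  rw [← mdifferentiableAt_iff_differentiableAt]
  refine ⟨fun h => h.comp z h1, fun h => ?_⟩
  have h2 : MDifferentiableAt (𝓡 7) 𝓘(ℝ, E7) (extChartAt (𝓡 7) p) ((extChartAt (𝓡 7) p).symm z) :=
    mdifferentiableAt_extChartAt (by rwa [← extChartAt_source (𝓡 7)])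
  have h3 := MDifferentiableAt.comp (I' := 𝓘(ℝ, E7)) ((extChartAt (𝓡 7) p).symm z)
    (g := g ∘ (extChartAt (𝓡 7) p).symm)
    (by rwa [(extChartAt (𝓡 7) p).right_inv hz]) h2
  refine h3.congr_of_eventuallyEq ?_
  filter_upwards [(isOpen_extChartAt_source p).mem_nhds hx] with y hy
  exact congrArg g ((extChartAt (𝓡 7) p).left_inv hy).symm

theorem contMDiffAt_iff_chart {F : Type*} [NormedAddCommGroup F] [NormedSpace ℝ F] (p : M)
    {z : E7} (hz : z ∈ (extChartAt (𝓡 7) p).target) (g : M → F) :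
    ContMDiffAt (𝓡 7) 𝓘(ℝ, F) ∞ g ((extChartAt (𝓡 7) p).symm z) ↔
      ContDiffAt ℝ ∞ (g ∘ (extChartAt (𝓡 7) p).symm) z := by
  have hx : (extChartAt (𝓡 7) p).symm z ∈ (extChartAt (𝓡 7) p).source :=
    (extChartAt (𝓡 7) p).map_target hz
  have h1 : ContMDiffAt 𝓘(ℝ, E7) (𝓡 7) ∞ (extChartAt (𝓡 7) p).symm z :=
    (contMDiffOn_extChartAt_symm p).contMDiffAt (target_mem_nhds p hz)
  rw [← contMDiffAt_iff_contDiffAt]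
  refine ⟨fun h => h.comp z h1, fun h => ?_⟩
  have h2 : ContMDiffAt (𝓡 7) 𝓘(ℝ, E7) ∞ (extChartAt (𝓡 7) p) ((extChartAt (𝓡 7) p).symm z) :=
    contMDiffAt_extChartAt' (by rwa [← extChartAt_source (𝓡 7)])
  have h3 := ContMDiffAt.comp (I' := 𝓘(ℝ, E7)) ((extChartAt (𝓡 7) p).symm z)
    (g := g ∘ (extChartAt (𝓡 7) p).symm)
    (by rwa [(extChartAt (𝓡 7) p).right_inv hz]) h2
  refine h3.congr_of_eventuallyEq ?_
  filter_upwards [(isOpen_extChartAt_source p).mem_nhds hx] with y hy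
  exact congrArg g ((extChartAt (𝓡 7) p).left_inv hy).symm

theorem mfderiv_comp_chart {F : Type*} [NormedAddCommGroup F] [NormedSpace ℝ F] (p : M)
    {z : E7} (hz : z ∈ (extChartAt (𝓡 7) p).target) {g : M → F}
    (hg : DifferentiableAt ℝ (g ∘ (extChartAt (𝓡 7) p).symm) z) (u : E7) :
    mvfderiv (𝓡 7) g ((extChartAt (𝓡 7) p).symm z) (chartEquiv p hz u) =
      fderiv ℝ (g ∘ (extChartAt (𝓡 7) p).symm) z u := by
  have : IsManifold (𝓡 7) 1 M := .of_le (n := ∞) (by simp)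
  have h1 : MDifferentiableAt 𝓘(ℝ, E7) (𝓡 7) (extChartAt (𝓡 7) p).symm z := by
    have := mdifferentiableWithinAt_extChartAt_symm (I := 𝓡 7) hz
    rwa [ModelWithCorners.range_eq_univ, mdifferentiableWithinAt_univ] at this
  have h2 := mfderiv_comp z ((mdifferentiableAt_iff_chart p hz g).2 hg) h1
  rw [mfderiv_eq_fderiv] at h2
  exact (congrArg (fun A : E7 →L[ℝ] F => A u) h2).symm

theorem trivialization_apply (p : M) {z : E7} (hz : z ∈ (extChartAt (𝓡 7) p).target)
    (Y : VField M) :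
    (trivializationAt E7 (TangentSpace (𝓡 7) : M → Type) p
      ⟨(extChartAt (𝓡 7) p).symm z, Y ((extChartAt (𝓡 7) p).symm z)⟩).2 = fieldInChart p Y z := by
  have : IsManifold (𝓡 7) 1 M := .of_le (n := ∞) (by simp)
  have hx : (extChartAt (𝓡 7) p).symm z ∈ (chartAt E7 p).source := by
    rw [← extChartAt_source (𝓡 7)]
    exact (extChartAt (𝓡 7) p).map_target hz
  have h1 := TangentBundle.continuousLinearMapAt_trivializationAt (I := 𝓡 7) hx
  have h2 : (trivializationAt E7 (TangentSpace (𝓡 7) : M → Type) p).continuousLinearMapAt ℝ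
      ((extChartAt (𝓡 7) p).symm z) (Y ((extChartAt (𝓡 7) p).symm z)) =
      (trivializationAt E7 (TangentSpace (𝓡 7) : M → Type) p
        ⟨(extChartAt (𝓡 7) p).symm z, Y ((extChartAt (𝓡 7) p).symm z)⟩).2 := by
    rw [Bundle.Trivialization.continuousLinearMapAt_apply,
      Bundle.Trivialization.linearMapAt_apply, if_pos]
    exact hx
  exact h2.symm.trans (congrArg (fun A : E7 →L[ℝ] E7 => A (Y ((extChartAt (𝓡 7) p).symm z))) h1)

theorem isDiffFieldAt_iff (p : M) {z : E7} (hz : z ∈ (extChartAt (𝓡 7) p).target)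
    (Y : VField M) : IsDiffFieldAt Y ((extChartAt (𝓡 7) p).symm z) ↔
      DifferentiableAt ℝ (fieldInChart p Y) z := by
  have hx : (extChartAt (𝓡 7) p).symm z ∈ (chartAt E7 p).source := by
    rw [← extChartAt_source (𝓡 7)]
    exact (extChartAt (𝓡 7) p).map_target hz
  have : IsManifold (𝓡 7) 1 M := .of_le (n := ∞) (by simp)
  rw [IsDiffFieldAt, (trivializationAt E7 (TangentSpace (𝓡 7) : M → Type)
    p).mdifferentiableAt_section_iff (𝓡 7) Y hx, mdifferentiableAt_iff_chart p hz]
  refine Filter.EventuallyEq.differentiableAt_iff ?_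
  filter_upwards [target_mem_nhds p hz] with y hy
  exact trivialization_apply p hy Y

theorem contMDiffAt_field_iff (p : M) {z : E7} (hz : z ∈ (extChartAt (𝓡 7) p).target)
    (Y : VField M) : ContMDiffAt (𝓡 7) ((𝓡 7).prod 𝓘(ℝ, E7)) ∞
      (fun y => (Bundle.TotalSpace.mk y (Y y) :
        Bundle.TotalSpace E7 (TangentSpace (𝓡 7) : M → Type))) ((extChartAt (𝓡 7) p).symm z) ↔
      ContDiffAt ℝ ∞ (fieldInChart p Y) z := by
  have hx : (extChartAt (𝓡 7) p).symm z ∈ (chartAt E7 p).source := by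
    rw [← extChartAt_source (𝓡 7)]
    exact (extChartAt (𝓡 7) p).map_target hz
  rw [(trivializationAt E7 (TangentSpace (𝓡 7) : M → Type) p).contMDiffAt_section_iff hx,
    contMDiffAt_iff_chart p hz]
  have e : ((fun x => (trivializationAt E7 (TangentSpace (𝓡 7) : M → Type) p ⟨x, Y x⟩).2) ∘
      (extChartAt (𝓡 7) p).symm) =ᶠ[𝓝 z] fieldInChart p Y := by
    filter_upwards [target_mem_nhds p hz] with y hy
    exact trivialization_apply p hy Y
  exact ⟨fun h => h.congr_of_eventuallyEq e.symm, fun h => h.congr_of_eventuallyEq e⟩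

end

/-! ### Connections in a chart -/

/-- The constant vector field `v` on `ℝ⁷`. -/
def constFieldE (v : E7) : Π y : E7, TangentSpace 𝓘(ℝ, E7) y := fun _ => v

theorem mdifferentiableAt_constFieldE (w y : E7) :
    MDifferentiableAt 𝓘(ℝ, E7) (𝓘(ℝ, E7).prod 𝓘(ℝ, E7))
      (fun y => (Bundle.TotalSpace.mk y (constFieldE w y) :
        Bundle.TotalSpace E7 (TangentSpace 𝓘(ℝ, E7) : E7 → Type))) y :=
  (contMDiffAt_vectorSpace_iff_contDiffAt (n := 1).2
    (contDiffAt_const (c := w))).mdifferentiableAt (by simp)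

theorem mlieBracket_constFieldE (u v y : E7) :
    VectorField.mlieBracket 𝓘(ℝ, E7) (constFieldE u) (constFieldE v) y = 0 := by
  rw [← VectorField.mlieBracketWithin_univ, VectorField.mlieBracketWithin_eq_lieBracketWithin]
  have h : VectorField.lieBracketWithin ℝ (fun _ : E7 => u) (fun _ : E7 => v) Set.univ y = 0 := by
    simp [VectorField.lieBracketWithin_eq]
  exact h

section

variable {M : Type*} [TopologicalSpace M] [ChartedSpace E7 M] [IsManifold (𝓡 7) ∞ M]

theorem IsDiffFieldAt.add {Y Z : VField M} {x : M} (hY : IsDiffFieldAt Y x)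
    (hZ : IsDiffFieldAt Z x) : IsDiffFieldAt (Y + Z) x :=
  mdifferentiableAt_add_section hY hZ

theorem IsDiffFieldAt.smul {Y : VField M} {g : M → ℝ} {x : M}
    (hg : MDifferentiableAt (𝓡 7) 𝓘(ℝ, ℝ) g x) (hY : IsDiffFieldAt Y x) :
    IsDiffFieldAt (g • Y) x :=
  hg.smul_section hY

theorem isDiffFieldAt_zero (x : M) : IsDiffFieldAt (0 : VField M) x :=
  Bundle.mdifferentiableAt_zeroSection (IB := 𝓡 7) (F := E7) (E := (TangentSpace (𝓡 7) : M → Type)) ..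

/-- The Leibniz rule for a finite combination of vector fields. -/
theorem conn_sum (D : Connection M) {ι : Type*} (s : Finset ι) (g : ι → M → ℝ) (Y : ι → VField M)
    {x : M} (hg : ∀ i, MDifferentiableAt (𝓡 7) 𝓘(ℝ, ℝ) (g i) x)
    (hY : ∀ i, IsDiffFieldAt (Y i) x) (u : TangentSpace (𝓡 7) x) :
    IsDiffFieldAt (∑ i ∈ s, g i • Y i) x ∧ D (∑ i ∈ s, g i • Y i) x u =
      ∑ i ∈ s, (g i x • D (Y i) x u + mvfderiv (𝓡 7) (g i) x u • Y i x) := by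
  classical
  induction s using Finset.induction_on with
  | empty => exact ⟨by simpa using isDiffFieldAt_zero x, by simp⟩
  | insert a s ha ih =>
    rw [Finset.sum_insert ha, Finset.sum_insert ha, ← ih.2]
    refine ⟨((hY a).smul (hg a)).add ih.1, ?_⟩
    have h1 := D.isCovariantDerivativeOnUniv.add ((hY a).smul (hg a)) ih.1
    have h2 := D.isCovariantDerivativeOnUniv.leibniz (hY a) (hg a)
    rw [h1, h2]
    rfl

/-- The operator `u ↦ ∇_u ∂_v` in the chart centred at `p`. -/
def christoffelAux (p : M) (D : Connection M) (v z : E7) : E7 →L[ℝ] E7 :=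
  (mfderiv (𝓡 7) 𝓘(ℝ, E7) (extChartAt (𝓡 7) p) ((extChartAt (𝓡 7) p).symm z) : E7 →L[ℝ] E7).comp
    ((D (constField p v) ((extChartAt (𝓡 7) p).symm z) : E7 →L[ℝ] E7).comp
      (mfderiv 𝓘(ℝ, E7) (𝓡 7) (extChartAt (𝓡 7) p).symm z : E7 →L[ℝ] E7))

theorem chartEquiv_christoffelAux (p : M) (D : Connection M) (v : E7) {z : E7}
    (hz : z ∈ (extChartAt (𝓡 7) p).target) (u : E7) :
    chartEquiv p hz (christoffelAux p D v z u) =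
      D (constField p v) ((extChartAt (𝓡 7) p).symm z) (chartEquiv p hz u) :=
  (chartEquiv p hz).apply_symm_apply _

/-- The Christoffel operators of a connection in the chart centred at `p`. -/
def christoffel (p : M) (D : Connection M) (z : E7) : E7 →L[ℝ] E7 →L[ℝ] E7 :=
  ∑ j : Fin 7, (ContinuousLinearMap.smulRightL ℝ E7 E7 (EuclideanSpace.proj j)).comp
    (christoffelAux p D (stdVec j) z)

theorem christoffel_apply (p : M) (D : Connection M) (z u v : E7) :
    christoffel p D z u v = ∑ j : Fin 7, v j • christoffelAux p D (stdVec j) z u := by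
  simp [christoffel, _root_.sum_apply]

theorem isDiffFieldAt_constField (p : M) {z : E7} (hz : z ∈ (extChartAt (𝓡 7) p).target) (v : E7) :
    IsDiffFieldAt (constField p v) ((extChartAt (𝓡 7) p).symm z) := by
  rw [isDiffFieldAt_iff p hz]
  refine (differentiableAt_const v).congr_of_eventuallyEq ?_
  filter_upwards [target_mem_nhds p hz] with y hy
  exact fieldInChart_constField p hy v

/-- A connection in the chart centred at `p`: `∇_u Y = ∂_u Y + Γ(u, Y)`. -/
theorem conn_chart (D : Connection M) (p : M) {z : E7} (hz : z ∈ (extChartAt (𝓡 7) p).target)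
    {Y : VField M} (hY : DifferentiableAt ℝ (fieldInChart p Y) z) (u : E7) :
    D Y ((extChartAt (𝓡 7) p).symm z) (chartEquiv p hz u) =
      chartEquiv p hz (fderiv ℝ (fieldInChart p Y) z u +
        christoffel p D z u (fieldInChart p Y z)) := by
  set x := (extChartAt (𝓡 7) p).symm z with hx
  set g : Fin 7 → M → ℝ := fun j q => fieldInChart p Y (extChartAt (𝓡 7) p q) j with hg
  have hgc : ∀ j, (g j ∘ (extChartAt (𝓡 7) p).symm) =ᶠ[𝓝 z] fun y => fieldInChart p Y y j := by
    intro j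
    filter_upwards [target_mem_nhds p hz] with y hy
    simp only [hg, Function.comp_apply, (extChartAt (𝓡 7) p).right_inv hy]
  have hd : ∀ j, HasFDerivAt (fun y => fieldInChart p Y y j)
      ((EuclideanSpace.proj j : E7 →L[ℝ] ℝ).comp (fderiv ℝ (fieldInChart p Y) z)) z := fun j =>
    (EuclideanSpace.proj j : E7 →L[ℝ] ℝ).hasFDerivAt.comp z hY.hasFDerivAt
  have hgd : ∀ j, DifferentiableAt ℝ (g j ∘ (extChartAt (𝓡 7) p).symm) z := fun j =>
    (hgc j).differentiableAt_iff.2 (hd j).differentiableAt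
  have hs := conn_sum D Finset.univ g (fun j => constField p (stdVec j)) (x := x)
    (fun j => (mdifferentiableAt_iff_chart p hz (g j)).2 (hgd j))
    (fun j => isDiffFieldAt_constField p hz (stdVec j)) (chartEquiv p hz u)
  have hloc : D Y x = D (∑ j, g j • constField p (stdVec j)) x := by
    refine D.isCovariantDerivativeOnUniv.congr_of_eventuallyEq
      ((isDiffFieldAt_iff p hz Y).2 hY) hs.1 Filter.univ_mem ?_
    filter_upwards [symm_mem_source hz] with q hq
    have hq' := (extChartAt (𝓡 7) p).map_source hq
    have e1 := chartEquiv_fieldInChart p hq' Y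
    have e2 := fun j => constField_symm p hq' (stdVec j)
    rw [(extChartAt (𝓡 7) p).left_inv hq] at e1 e2
    rw [← e1]
    conv_lhs => rw [eq_sum_stdVec (fieldInChart p Y (extChartAt (𝓡 7) p q))]
    rw [map_sum, Finset.sum_apply]
    refine Finset.sum_congr rfl fun j _ => ?_
    rw [map_smul, ← e2]
    rfl
  rw [hloc, hs.2, map_add, christoffel_apply, map_sum]
  rw [eq_sum_stdVec (fderiv ℝ (fieldInChart p Y) z u), map_sum, ← Finset.sum_add_distrib]
  refine Finset.sum_congr rfl fun j _ => ?_
  rw [mfderiv_comp_chart p hz (hgd j), (hgc j).fderiv_eq, (hd j).fderiv, map_smul, map_smul,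
    chartEquiv_christoffelAux, ← constField_symm p hz (stdVec j)]
  have : g j x = fieldInChart p Y z j := by
    simp only [hg, hx, (extChartAt (𝓡 7) p).right_inv hz]
  rw [this, add_comm]
  rfl

theorem conn_constField (D : Connection M) (p : M) {z : E7}
    (hz : z ∈ (extChartAt (𝓡 7) p).target) (u v : E7) :
    D (constField p v) ((extChartAt (𝓡 7) p).symm z) (chartEquiv p hz u) =
      chartEquiv p hz (christoffel p D z u v) := by
  have e : fieldInChart p (constField p v) =ᶠ[𝓝 z] fun _ => v := by
    filter_upwards [target_mem_nhds p hz] with y hy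
    exact fieldInChart_constField p hy v
  rw [conn_chart D p hz (e.differentiableAt_iff.2 (differentiableAt_const v)), e.fderiv_eq,
    fieldInChart_constField p hz]
  have h0 : fderiv ℝ (fun _ : E7 => v) z u = 0 := by simp
  rw [h0, zero_add]

theorem contDiffAt_clm {E F : Type*} [NormedAddCommGroup E] [NormedSpace ℝ E]
    [NormedAddCommGroup F] [NormedSpace ℝ F] {n : WithTop ℕ∞} {A : E → E7 →L[ℝ] F} {z : E}
    (h : ∀ u, ContDiffAt ℝ n (fun y => A y u) z) : ContDiffAt ℝ n A z := by
  have e : A = fun y => ∑ j : Fin 7,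
      (ContinuousLinearMap.smulRightL ℝ E7 F (EuclideanSpace.proj j)) (A y (stdVec j)) := by
    funext y
    ext u
    conv_lhs => rw [eq_sum_stdVec u, map_sum]
    simp [_root_.sum_apply]
  rw [e]
  exact ContDiffAt.sum fun j _ =>
    (ContinuousLinearMap.smulRightL ℝ E7 F (EuclideanSpace.proj j)).contDiff.contDiffAt.comp z
      (h (stdVec j))

theorem contDiffAt_fieldInChart_constField (p : M) {z : E7}
    (hz : z ∈ (extChartAt (𝓡 7) p).target) (v : E7) :
    ContDiffAt ℝ ∞ (fieldInChart p (constField p v)) z := by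
  refine (contDiffAt_const (c := v)).congr_of_eventuallyEq ?_
  filter_upwards [target_mem_nhds p hz] with y hy
  exact fieldInChart_constField p hy v

/-- A chart field is only defined on the domain of the chart, so its product with a bump function
is differentiated in its place; connections are local operators. -/
theorem contDiffAt_christoffelAux [T2Space M] (D : Connection M)
    (hD : CovariantDerivative.ContMDiffCovariantDerivative D ∞) (p : M) (v : E7) {z : E7}
    (hz : z ∈ (extChartAt (𝓡 7) p).target) : ContDiffAt ℝ ∞ (christoffelAux p D v) z := by
  refine contDiffAt_clm fun u => ?_
  set x := (extChartAt (𝓡 7) p).symm z with hx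
  obtain ⟨ρ, -, hρ⟩ := (SmoothBumpFunction.nhds_basis_tsupport (I := 𝓡 7) x).mem_iff.1
    (symm_mem_source hz)
  have hc : ContMDiffOn (𝓡 7) ((𝓡 7).prod 𝓘(ℝ, E7)) ∞
      (fun y => (Bundle.TotalSpace.mk y (constField p v y) :
        Bundle.TotalSpace E7 (TangentSpace (𝓡 7) : M → Type))) (extChartAt (𝓡 7) p).source := by
    intro q hq
    have := (contMDiffAt_field_iff p ((extChartAt (𝓡 7) p).map_source hq) (constField p v)).2
      (contDiffAt_fieldInChart_constField p ((extChartAt (𝓡 7) p).map_source hq) v)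
    rw [(extChartAt (𝓡 7) p).left_inv hq] at this
    exact this.contMDiffWithinAt
  have hσ := ContMDiffOn.smul_section_of_tsupport (n := ∞) (ρ.contMDiff.contMDiffOn)
    (isOpen_extChartAt_source p) hρ hc
  have h1 := hD.contMDiff.contMDiff (σ := (ρ : M → ℝ) • constField p v) hσ.contMDiffOn
  have h2 : ContMDiffAt (𝓡 7) ((𝓡 7).prod 𝓘(ℝ, E7 →L[ℝ] E7)) ∞ _ x :=
    h1.contMDiffAt Filter.univ_mem
  have hcu := (contMDiffAt_field_iff p hz (constField p u)).2
    (contDiffAt_fieldInChart_constField p hz u)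
  have h3 := ContMDiffAt.clm_bundle_apply h2 hcu
  have h4 := (contMDiffAt_field_iff p hz
    (fun y => D ((ρ : M → ℝ) • constField p v) y (constField p u y))).1 h3
  refine h4.congr_of_eventuallyEq ?_
  have hcont : ContinuousAt (extChartAt (𝓡 7) p).symm z := continuousAt_extChartAt_symm'' hz
  filter_upwards [target_mem_nhds p hz,
    hcont.eventually ρ.eventuallyEq_one.eventuallyEq_nhds] with y hy hyρ
  have hyρ' : (ρ : M → ℝ) =ᶠ[𝓝 ((extChartAt (𝓡 7) p).symm y)] 1 := hyρ
  have : D (constField p v) ((extChartAt (𝓡 7) p).symm y) =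
      D ((ρ : M → ℝ) • constField p v) ((extChartAt (𝓡 7) p).symm y) := by
    refine D.isCovariantDerivativeOnUniv.congr_of_eventuallyEq
      (isDiffFieldAt_constField p hy v)
      ((isDiffFieldAt_constField p hy v).smul (ρ.contMDiff.mdifferentiableAt (by simp)))
      Filter.univ_mem ?_
    filter_upwards [hyρ'] with q hq
    simp [hq]
  refine (chartEquiv p hy).injective ?_
  rw [chartEquiv_christoffelAux, chartEquiv_fieldInChart, this, constField_symm p hy]

theorem contDiffAt_christoffel [T2Space M] (D : Connection M)
    (hD : CovariantDerivative.ContMDiffCovariantDerivative D ∞) (p : M) {z : E7}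
    (hz : z ∈ (extChartAt (𝓡 7) p).target) : ContDiffAt ℝ ∞ (christoffel p D) z := by
  refine contDiffAt_clm fun u => contDiffAt_clm fun v => ?_
  simp only [christoffel_apply]
  exact ContDiffAt.sum fun j _ =>
    ((contDiffAt_christoffelAux D hD p (stdVec j) hz).clm_apply
      (contDiffAt_const (c := u))).const_smul (v j)

theorem mlieBracket_constField (p : M) {z : E7} (hz : z ∈ (extChartAt (𝓡 7) p).target) (u v : E7) :
    VectorField.mlieBracket (𝓡 7) (constField p u) (constField p v)
      ((extChartAt (𝓡 7) p).symm z) = 0 := by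
  have : IsManifold (𝓡 7) 1 M := .of_le (n := ∞) (by simp)
  have hm : minSmoothness ℝ 2 = 2 := by simp
  have : IsManifold (𝓡 7) (minSmoothness ℝ 2) M := .of_le (n := ∞) (by rw [hm]; exact two_le_infty)
  have hx := (extChartAt (𝓡 7) p).map_target hz
  have h := VectorField.mpullback_mlieBracket (I := 𝓡 7) (I' := 𝓘(ℝ, E7)) (n := ∞)
    (f := extChartAt (𝓡 7) p) (V := constFieldE u) (W := constFieldE v)
    (x₀ := (extChartAt (𝓡 7) p).symm z) (mdifferentiableAt_constFieldE u _)
    (mdifferentiableAt_constFieldE v _)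
    (contMDiffAt_extChartAt' (by rwa [← extChartAt_source (𝓡 7)]))
    (by rw [hm]; exact two_le_infty)
  have e : ∀ w : E7, VectorField.mpullback (𝓡 7) 𝓘(ℝ, E7) (extChartAt (𝓡 7) p) (constFieldE w)
      =ᶠ[𝓝 ((extChartAt (𝓡 7) p).symm z)] constField p w := by
    intro w
    filter_upwards [symm_mem_source hz] with q hq
    have hq' := (extChartAt (𝓡 7) p).map_source hq
    have e2 := constField_symm p hq' w
    rw [(extChartAt (𝓡 7) p).left_inv hq] at e2
    rw [e2, VectorField.mpullback_apply]
    have e3 : ((chartEquiv p hq').symm : E7 →L[ℝ] E7) =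
      mfderiv (𝓡 7) 𝓘(ℝ, E7) (extChartAt (𝓡 7) p)
        ((extChartAt (𝓡 7) p).symm (extChartAt (𝓡 7) p q)) := rfl
    rw [(extChartAt (𝓡 7) p).left_inv hq] at e3
    have e4 := congrArg (fun A : E7 →L[ℝ] E7 => A.inverse w) e3
    simp only [ContinuousLinearMap.inverse_equiv] at e4
    exact e4.symm
  rw [← (e u).mlieBracket_vectorField_eq (e v), ← h, VectorField.mpullback_apply,
    mlieBracket_constFieldE, map_zero]

end

/-! ### Strong torsion structures on a manifold, in a chart -/

theorem IsG2Structure.isG2Form {M : Type*} [TopologicalSpace M] [ChartedSpace E7 M]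
    {φ : DForm M 3} (h : IsG2Structure φ) (x : M) : IsG2Form (φ x : Form 3) :=
  h.pointwise x

theorem contDiffAt_formInChart {M : Type*} [TopologicalSpace M] [ChartedSpace E7 M]
    (p : M) {z : E7} {k : ℕ} {α : DForm M k} (h : IsSmoothForm α)
    (hz : z ∈ (extChartAt (𝓡 7) p).target) : ContDiffAt ℝ ∞ (formInChart p α) z :=
  (h p).contDiffAt (target_mem_nhds p hz)

section

variable {M : Type*} [TopologicalSpace M] [ChartedSpace E7 M] [IsManifold (𝓡 7) ∞ M]
  {φ H : DForm M 3} {D : Connection M} (p : M) {z : E7}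

theorem metric_chart (h : IsG2Structure φ) (hz : z ∈ (extChartAt (𝓡 7) p).target) (v w : E7) :
    metric (formInChart p φ z) v w =
      gMetric φ ((extChartAt (𝓡 7) p).symm z) (chartEquiv p hz v) (chartEquiv p hz w) := by
  rw [formInChart_eq p hz]
  exact metric_comp_equiv (h.isG2Form _) _ _ _

theorem isG2Form_chart (h : IsG2Structure φ) (hz : z ∈ (extChartAt (𝓡 7) p).target) :
    IsG2Form (formInChart p φ z) := by
  rw [formInChart_eq p hz]
  exact (h.isG2Form _).comp _

/-- The coordinate expression of `∇φ = 0`. -/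
theorem covD_chart (h : IsSmoothForm φ) (hD : PreservesForm φ D)
    (hz : z ∈ (extChartAt (𝓡 7) p).target) :
    covD (christoffel p D) (formInChart p φ) z = 0 := by
  have hd : DifferentiableAt ℝ (formInChart p φ) z :=
    (contDiffAt_formInChart p h hz).differentiableAt (by simp)
  ext u v
  have h1 := hD ((extChartAt (𝓡 7) p).symm z) (chartEquiv p hz u) (fun i => constField p (v i))
    (fun i => isDiffFieldAt_constField p hz (v i))
  have e : ((fun y => φ y fun i => constField p (v i) y) ∘ (extChartAt (𝓡 7) p).symm) =ᶠ[𝓝 z]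
      fun y => formInChart p φ y v := by
    filter_upwards [target_mem_nhds p hz] with y hy
    simp only [Function.comp_apply, constField_symm p hy]
    rfl
  have hd' : DifferentiableAt ℝ (fun y => formInChart p φ y v) z :=
    (contDiffAt_form_apply (contDiffAt_formInChart p h hz) v).differentiableAt (by simp)
  rw [mfderiv_comp_chart p hz (e.differentiableAt_iff.2 hd'), e.fderiv_eq,
    fderiv_form_apply hd] at h1
  simp only [covD, _root_.sub_apply, ContinuousLinearMap.comp_apply,
    ContinuousAlternatingMap.sub_apply, formAct_apply, h1, conn_constField D p hz]
  rw [show (0 : E7 →L[ℝ] Form 3) u v = 0 from rfl, sub_eq_zero]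
  refine Finset.sum_congr rfl fun i _ => ?_
  simp only [constField_symm p hz]
  rw [formInChart_eq p hz]
  refine congrArg (φ ((extChartAt (𝓡 7) p).symm z) : Form 3) ?_
  exact (Function.comp_update (chartEquiv p hz : E7 → E7) v i _).symm

/-- The coordinate expression of `∇g = 0`. -/
theorem metric_par_chart (h : IsG2Structure φ) (hD : PreservesMetric φ D)
    (hz : z ∈ (extChartAt (𝓡 7) p).target) (u v w : E7) :
    fderiv ℝ (fun x => metric (formInChart p φ x) v w) z u =
      metric (formInChart p φ z) (christoffel p D z u v) w +
        metric (formInChart p φ z) v (christoffel p D z u w) := by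
  have h1 := hD ((extChartAt (𝓡 7) p).symm z) (chartEquiv p hz u) (constField p v) (constField p w)
    (isDiffFieldAt_constField p hz v) (isDiffFieldAt_constField p hz w)
  have e : ((fun y => gMetric φ y (constField p v y) (constField p w y)) ∘
      (extChartAt (𝓡 7) p).symm) =ᶠ[𝓝 z] fun y => metric (formInChart p φ y) v w := by
    filter_upwards [target_mem_nhds p hz] with y hy
    simp only [Function.comp_apply, constField_symm p hy]
    exact (metric_chart p h hy v w).symm
  have hd' : DifferentiableAt ℝ (fun y => metric (formInChart p φ y) v w) z :=
    (contDiffAt_metric (contDiffAt_formInChart p h.smooth hz) (isG2Form_chart p h hz)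
      v w).differentiableAt (by simp)
  rw [mfderiv_comp_chart p hz (e.differentiableAt_iff.2 hd'), e.fderiv_eq,
    conn_constField D p hz, conn_constField D p hz, constField_symm p hz,
    constField_symm p hz] at h1
  rw [h1, metric_chart p h hz, metric_chart p h hz]

/-- The coordinate expression of the torsion form. -/
theorem torsion_chart (h : IsG2Structure φ)
    (hD : ∀ (x : M) (u v w : TangentSpace (𝓡 7) x),
      gMetric φ x (D.torsion x u v) w = H x ![u, v, w])
    (hz : z ∈ (extChartAt (𝓡 7) p).target) (u v w : E7) :
    metric (formInChart p φ z) (christoffel p D z u v - christoffel p D z v u) w =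
      formInChart p H z ![u, v, w] := by
  have : IsManifold (𝓡 7) 2 M := .of_le (n := ∞) two_le_infty
  have h1 := hD ((extChartAt (𝓡 7) p).symm z) (chartEquiv p hz u) (chartEquiv p hz v)
    (chartEquiv p hz w)
  have h2 := D.torsion_apply (isDiffFieldAt_constField p hz u) (isDiffFieldAt_constField p hz v)
  rw [mlieBracket_constField p hz, constField_symm p hz, constField_symm p hz,
    conn_constField D p hz, conn_constField D p hz, sub_zero] at h2
  have h3 : D.torsion ((extChartAt (𝓡 7) p).symm z) (chartEquiv p hz u) (chartEquiv p hz v) =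
      chartEquiv p hz (christoffel p D z u v - christoffel p D z v u) :=
    h2.trans (map_sub (chartEquiv p hz) _ _).symm
  rw [h3] at h1
  rw [metric_chart p h hz, h1, formInChart_eq p hz]
  refine congrArg (H ((extChartAt (𝓡 7) p).symm z) : Form 3) ?_
  funext i
  fin_cases i <;> rfl

variable [T2Space M]

/-- Every coordinate expression of a strong torsion `G₂` structure is one on an open set of `ℝ⁷`. -/
theorem IsStrongTorsionG2.isLocalG2 (h : IsStrongTorsionG2 φ D H)
    (hz : z ∈ (extChartAt (𝓡 7) p).target) :
    IsLocalG2 (formInChart p φ) (formInChart p H) (christoffel p D) z where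
  phi_smooth := contDiffAt_formInChart p h.isG2.smooth hz
  christoffel_smooth := contDiffAt_christoffel D h.skewTorsion.smooth p hz
  g2 := by
    filter_upwards [target_mem_nhds p hz] with y hy
    exact isG2Form_chart p h.isG2 hy
  form_par := by
    filter_upwards [target_mem_nhds p hz] with y hy
    exact covD_chart p h.isG2.smooth h.skewTorsion.form_parallel hy
  metric_par := by
    filter_upwards [target_mem_nhds p hz] with y hy u v w
    exact metric_par_chart p h.isG2 h.skewTorsion.metric_parallel hy u v w
  torsion := by
    filter_upwards [target_mem_nhds p hz] with y hy u v w
    exact torsion_chart p h.isG2 h.skewTorsion.torsion_eq hy u v w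

end

/-! ### The musical isomorphism and the norm of forms -/

theorem one_form_eq_sum (a : Form 1) (L : E7 ≃L[ℝ] E7) (w : E7) :
    a (fun _ => w) = ∑ m, L w m * a fun _ => adBasis L m := by
  have hA : ∀ x, slotL a (fun _ => 0) 0 x = a fun _ => x := fun x => by
    rw [slotL_apply]
    congr 1
    funext i
    fin_cases i
    rfl
  rw [← hA]
  conv_lhs => rw [eq_sum_adBasis L w, map_sum]
  exact Finset.sum_congr rfl fun m _ => by rw [map_smul, smul_eq_mul, hA]

/-- The vector `a^♯` is dual to `a`. -/
theorem metric_sharp {φ : Form 3} (h : IsG2Form φ) (a : Form 1) (w : E7) :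
    metric φ (sharp φ a) w = a fun _ => w := by
  obtain ⟨L, rfl⟩ := h
  set ψ := phi0.compContinuousLinearMap (L : E7 →L[ℝ] E7) with hψ
  set A : E7 →ₗ[ℝ] ℝ := slotL a (fun _ => 0) 0 with hA
  have hAa : ∀ x, A x = a fun _ => x := fun x => by
    rw [hA, slotL_apply]
    congr 1
    funext i
    fin_cases i
    rfl
  have h1 : metric ψ (sharp ψ a) w = ∑ i, ∑ j, (gram ψ)⁻¹ i j * ((metricL ψ).flip w (stdVec i) *
      A (stdVec j)) := by
    rw [← metricL_apply, sharp, map_sum, LinearMap.sum_apply]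
    refine Finset.sum_congr rfl fun i _ => ?_
    rw [map_sum, LinearMap.sum_apply]
    refine Finset.sum_congr rfl fun j _ => ?_
    rw [map_smul, LinearMap.smul_apply, LinearMap.flip_apply, hAa, smul_eq_mul]
    ring
  rw [h1, hψ, gram_inv_contract, ← hAa]
  conv_rhs => rw [eq_sum_adBasis L w, map_sum]
  refine Finset.sum_congr rfl fun m _ => ?_
  rw [LinearMap.flip_apply, metricL_apply, metric_comp, map_smul, smul_eq_mul]
  congr 1
  rw [Finset.sum_eq_single m]
  · simp [adBasis, stdVec_apply]
  · intro b _ hb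
    simp [adBasis, stdVec_apply, hb]
  · simp

/-- The metric of a `G₂` form is nondegenerate. -/
theorem eq_of_metric_eq {φ : Form 3} (h : IsG2Form φ) {X Y : E7}
    (hXY : ∀ w, metric φ X w = metric φ Y w) : X = Y := by
  obtain ⟨L, rfl⟩ := h
  refine L.injective ?_
  ext n
  have := hXY (adBasis L n)
  rwa [metric_adBasis, metric_adBasis] at this

theorem formInner_self_nonneg {φ : Form 3} (h : IsG2Form φ) (α : Form 3) :
    0 ≤ formInner φ α α := by
  obtain ⟨L, rfl⟩ := h
  rw [formInner_self_eq]
  positivity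

theorem eq_zero_of_formInner_self {φ : Form 3} (h : IsG2Form φ) {α : Form 3}
    (h0 : formInner φ α α = 0) : α = 0 := by
  obtain ⟨L, rfl⟩ := h
  rw [formInner_self_eq] at h0
  have h1 : ∀ i j k, formC L α i j k = 0 := by
    intro i j k
    have h2 : ∑ i, ∑ j, ∑ k, formC L α i j k ^ 2 = 0 := by linarith
    have h3 := (Finset.sum_eq_zero_iff_of_nonneg fun i _ =>
      Finset.sum_nonneg fun j _ => Finset.sum_nonneg fun k _ => sq_nonneg _).1 h2 i
      (Finset.mem_univ i)
    have h4 := (Finset.sum_eq_zero_iff_of_nonneg fun j _ =>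
      Finset.sum_nonneg fun k _ => sq_nonneg _).1 h3 j (Finset.mem_univ j)
    have h5 := (Finset.sum_eq_zero_iff_of_nonneg fun k _ => sq_nonneg _).1 h4 k (Finset.mem_univ k)
    exact pow_eq_zero_iff two_ne_zero |>.1 h5
  have h2 : α.compContinuousLinearMap (L.symm : E7 →L[ℝ] E7) = 0 := by
    refine form_ext_stdVec fun K => ?_
    have := h1 (K 0) (K 1) (K 2)
    rw [← form_three_apply L α K] at this
    exact this
  ext v
  have h3 : α (L.symm ∘ fun i => L (v i)) = 0 :=
    congrArg (fun β : Form 3 => β fun i => L (v i)) h2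
  have e : (L.symm ∘ fun i => L (v i)) = v := funext fun i => L.symm_apply_apply _
  rw [e] at h3
  exact h3

/-- The form of `torsion_pointwise` in which `⋆φ` is given by a variable `S`. -/
theorem torsion_pointwise_of_eq (L : E7 ≃L[ℝ] E7) {φ : Form 3}
    (hL : φ = phi0.compContinuousLinearMap (L : E7 →L[ℝ] E7)) {S : Form 4}
    (hS : S = star φ 4 rfl φ) (h : Form 3) (dφ : Form 4) (τ₀ : ℝ)
    (τ₁ : Form 1) (τ₃ : Form 3)
    (hdφ : ∀ i j k l, dφ ![adBasis L i, adBasis L j, adBasis L k, adBasis L l] =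
      dphiC (formC L h) i j k l)
    (h1 : ∀ v, wedge τ₃ φ v = 0) (h2 : ∀ v : Fin 7 → E7, wedge τ₃ S v = 0)
    (hd : ∀ v : Fin 4 → E7, dφ v = τ₀ * S v + 3 * wedge τ₁ φ v + star φ 4 rfl τ₃ v) :
    7 * τ₀ = ∑ m, contrPhi (formC L h) m m ∧
      ∀ m, 4 * τ₁ (fun _ => adBasis L m) = leeC (formC L h) m := by
  subst hS
  exact torsion_pointwise L hL h dφ τ₀ τ₁ τ₃ hdφ h1 h2 hd

section

variable {M : Type*} [TopologicalSpace M] [ChartedSpace E7 M] [IsManifold (𝓡 7) ∞ M]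

/-! ### Forms at the centre of a chart -/

/-- The chart centred at `x` has identity derivative at `x`, as the tangent space at `x` is trivialised
by that chart. -/
theorem chartEquiv_self (x : M) (v : E7) :
    chartEquiv x (mem_extChartAt_target x) v = v := by
  have : IsManifold (𝓡 7) 1 M := .of_le (n := ∞) (by simp)
  have h := mfderivWithin_range_extChartAt_symm (I := 𝓡 7) (x := x)
  rw [ModelWithCorners.range_eq_univ, mfderivWithin_univ] at h
  exact congrArg (fun A : E7 →L[ℝ] E7 => A v) h

theorem formInChart_self {k : ℕ} (α : DForm M k) (x : M) :
    formInChart x α (extChartAt (𝓡 7) x x) = (α x : Form k) := by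
  have h : ∀ q, q = x → ∀ w : Fin k → E7, (α q : Form k) w = (α x : Form k) w := by
    rintro q rfl w
    rfl
  ext v
  exact (h _ (extChartAt_to_inv (I := 𝓡 7) x) _).trans
    (congrArg (α x : Form k) (funext fun i => chartEquiv_self x (v i)))

theorem extD_self {k : ℕ} (α : DForm M k) (x : M) :
    (extD α x : Form (k + 1)) = extDeriv (formInChart x α) (extChartAt (𝓡 7) x x) := by
  have : IsManifold (𝓡 7) 1 M := .of_le (n := ∞) (by simp)
  have h := mfderiv_extChartAt_self (I := 𝓡 7) (x := x)
  ext v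
  rw [extD]
  refine congrArg (extDeriv (formInChart x α) (extChartAt (𝓡 7) x x)) ?_
  funext i
  exact congrArg (fun A : E7 →L[ℝ] E7 => A (v i)) h

variable {φ H : DForm M 3} {D : Connection M}

/-- The torsion forms `τ₀` and `τ₁` in terms of the torsion of the connection. -/
theorem IsStrongTorsionG2.torsion_forms [T2Space M] (h : IsStrongTorsionG2 φ D H) {τ₀ : M → ℝ}
    {τ₁ : DForm M 1} {τ₂ : DForm M 2} {τ₃ : DForm M 3} (hτ : IsTorsionForms φ τ₀ τ₁ τ₂ τ₃) (x : M) :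
    7 * τ₀ x = 6 * formInner (φ x) (H x) (φ x) ∧
      ∀ w : E7, leeInv (φ x) (H x) w = leeForm τ₁ x fun _ => w := by
  have hl := h.isLocalG2 x (mem_extChartAt_target x)
  obtain ⟨L, hL⟩ := h.isG2.isG2Form x
  have hL' : formInChart x φ (extChartAt (𝓡 7) x x) =
      phi0.compContinuousLinearMap (L : E7 →L[ℝ] E7) := by rw [formInChart_self, hL]
  have h1 := hl.extDeriv_phi hL'
  rw [formInChart_self, ← extD_self] at h1
  have h2 := torsion_pointwise_of_eq L hL (S := starPhi φ x) rfl (H x) (extD φ x) (τ₀ x) (τ₁ x) (τ₃ x)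
    h1 (hτ.mem27 x).1 (hτ.mem27 x).2 (hτ.d_phi x)
  constructor
  · rw [h2.1, sum_contrPhi_diag, hL]
    have := formInner_phi_eq L (H x)
    rw [this]
    ring
  · intro w
    have e1 := leeInv_comp L (H x) w
    rw [← hL] at e1
    refine e1.trans ?_
    refine Eq.trans ?_ (one_form_eq_sum (leeForm τ₁ x) L w).symm
    exact Finset.sum_congr rfl fun m _ => congrArg (L w m * ·) (h2.2 m).symm

end

/-! ### Divergence and the scalar invariants on the manifold -/

/-- The vector field `e^{-f} ∇f`. -/
def weightedGradient {M : Type*} [TopologicalSpace M] [ChartedSpace E7 M] (φ : DForm M 3)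
    (f : M → ℝ) : VField M := fun x =>
  sharp (φ x) (Real.exp (-f x) • dFun f x : Form 1)

theorem gMetric_weightedGradient {M : Type*} [TopologicalSpace M] [ChartedSpace E7 M] 
    {φ : DForm M 3} (h : IsG2Structure φ) (f : M → ℝ) (x : M)
    (w : TangentSpace (𝓡 7) x) : gMetric φ x (weightedGradient φ f x) w =
      Real.exp (-f x) * mvfderiv (𝓡 7) f x w :=
  metric_sharp (h.isG2Form x) (Real.exp (-f x) • dFun f x : Form 1) w

section

variable {M : Type*} [TopologicalSpace M] [ChartedSpace E7 M] [IsManifold (𝓡 7) ∞ M]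
  {φ H : DForm M 3} {D : Connection M}

/-- The divergence `tr (u ↦ D_u Y)` of a vector field. -/
def divergence (D : Connection M) (Y : VField M) (x : M) : ℝ :=
  LinearMap.trace ℝ (TangentSpace (𝓡 7) x) (D Y x).toLinearMap

/-- The divergence in a chart: `∑ ∂_i Y^i + Γ(e_i, Y)^i`. -/
theorem divergence_chart (D : Connection M) (p : M) {z : E7}
    (hz : z ∈ (extChartAt (𝓡 7) p).target) {Y : VField M}
    (hY : DifferentiableAt ℝ (fieldInChart p Y) z) :
    divergence D Y ((extChartAt (𝓡 7) p).symm z) =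
      LinearMap.trace ℝ E7 ((fderiv ℝ (fieldInChart p Y) z +
        (christoffel p D z).flip (fieldInChart p Y z) : E7 →L[ℝ] E7) : E7 →ₗ[ℝ] E7) := by
  set A : E7 →L[ℝ] E7 := fderiv ℝ (fieldInChart p Y) z +
    (christoffel p D z).flip (fieldInChart p Y z) with hA
  rw [← LinearMap.trace_conj' (A : E7 →ₗ[ℝ] E7) (chartEquiv p hz).toLinearEquiv]
  refine congrArg (LinearMap.trace ℝ E7) (LinearMap.ext fun w => ?_)
  obtain ⟨u, rfl⟩ := (chartEquiv p hz).surjective w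
  refine (conn_chart D p hz hY u).trans ?_
  change _ = chartEquiv p hz (A ((chartEquiv p hz).symm (chartEquiv p hz u)))
  rw [(chartEquiv p hz).symm_apply_apply]
  rfl

theorem contDiffAt_chart {f : M → ℝ} (hf : ContMDiff (𝓡 7) 𝓘(ℝ, ℝ) ∞ f) (p : M) {z : E7}
    (hz : z ∈ (extChartAt (𝓡 7) p).target) :
    ContDiffAt ℝ ∞ (f ∘ (extChartAt (𝓡 7) p).symm) z :=
  (contMDiffAt_iff_chart p hz f).1 hf.contMDiffAt

theorem metric_weightedGradient_chart (h : IsG2Structure φ) {f : M → ℝ}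
    (hf : ContMDiff (𝓡 7) 𝓘(ℝ, ℝ) ∞ f) (p : M) {z : E7}
    (hz : z ∈ (extChartAt (𝓡 7) p).target) (w : E7) :
    metric (formInChart p φ z) (fieldInChart p (weightedGradient φ f) z) w =
      Real.exp (-(f ∘ (extChartAt (𝓡 7) p).symm) z) *
        fderiv ℝ (f ∘ (extChartAt (𝓡 7) p).symm) z w := by
  rw [metric_chart p h hz, chartEquiv_fieldInChart p hz,
    ← mfderiv_comp_chart p hz ((contDiffAt_chart hf p hz).differentiableAt (by simp))]
  exact gMetric_weightedGradient h f _ _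

theorem contDiffAt_weightedGradient (h : IsG2Structure φ) {f : M → ℝ}
    (hf : ContMDiff (𝓡 7) 𝓘(ℝ, ℝ) ∞ f) (p : M) {z : E7}
    (hz : z ∈ (extChartAt (𝓡 7) p).target) :
    ContDiffAt ℝ ∞ (fieldInChart p (weightedGradient φ f)) z := by
  set F := f ∘ (extChartAt (𝓡 7) p).symm with hF
  have hFs : ∀ y ∈ (extChartAt (𝓡 7) p).target, ContDiffAt ℝ ∞ F y := fun y hy =>
    contDiffAt_chart hf p hy
  have e : fieldInChart p (weightedGradient φ f) =ᶠ[𝓝 z] fun y =>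
      ∑ i : Fin 7, ∑ j : Fin 7, ((gram (formInChart p φ y))⁻¹ i j *
        (Real.exp (-F y) * fderiv ℝ F y (stdVec j))) • stdVec i := by
    filter_upwards [target_mem_nhds p hz] with y hy
    have : fieldInChart p (weightedGradient φ f) y =
        sharp (formInChart p φ y) (oneForm (Real.exp (-F y) • fderiv ℝ F y)) := by
      refine eq_of_metric_eq (isG2Form_chart p h hy) fun w => ?_
      rw [metric_sharp (isG2Form_chart p h hy), metric_weightedGradient_chart h hf p hy]
      rfl
    rw [this]
    rfl
  refine ContDiffAt.congr_of_eventuallyEq ?_ e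
  have hd : ContDiffAt ℝ ∞ (fderiv ℝ F) z := (hFs z hz).fderiv_right (by simp)
  refine ContDiffAt.sum fun i _ => ContDiffAt.sum fun j _ => ?_
  refine (ContinuousLinearMap.toSpanSingleton ℝ (stdVec i)).contDiff.contDiffAt.comp z
    (ContDiffAt.mul ?_ (ContDiffAt.mul ?_ ?_))
  · exact contDiffAt_gram_inv (contDiffAt_formInChart p h.smooth hz) (isG2Form_chart p h hz) i j
  · exact (hFs z hz).neg.exp
  · exact hd.clm_apply contDiffAt_const

theorem formInner_chart (h : IsG2Structure φ) {k : ℕ} (α β : DForm M k) (p : M) {z : E7}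
    (hz : z ∈ (extChartAt (𝓡 7) p).target) :
    formInner (formInChart p φ z) (formInChart p α z) (formInChart p β z) =
      formInner (φ ((extChartAt (𝓡 7) p).symm z)) (α ((extChartAt (𝓡 7) p).symm z))
        (β ((extChartAt (𝓡 7) p).symm z)) :=
  formInner_comp_equiv (h.isG2Form _) (chartEquiv p hz) _ _

theorem leeInv_chart (h : IsG2Structure φ) (p : M) {z : E7}
    (hz : z ∈ (extChartAt (𝓡 7) p).target) (w : E7) :
    leeInv (formInChart p φ z) (formInChart p H z) w =
      leeInv (φ ((extChartAt (𝓡 7) p).symm z)) (H ((extChartAt (𝓡 7) p).symm z))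
        (chartEquiv p hz w) :=
  leeInv_comp_equiv (h.isG2Form _) (chartEquiv p hz) _ _

theorem IsStrongTorsionG2.extDeriv_torsion (h : IsStrongTorsionG2 φ D H) (x : M) :
    extDeriv (formInChart x H) (extChartAt (𝓡 7) x x) = 0 := by
  rw [← extD_self]
  exact h.closed x

variable [T2Space M]

theorem IsStrongTorsionG2.contDiffAt_torsion (h : IsStrongTorsionG2 φ D H) (p : M) {z : E7}
    (hz : z ∈ (extChartAt (𝓡 7) p).target) : ContDiffAt ℝ ∞ (formInChart p H) z :=
  (h.isLocalG2 p hz).contDiffAt_torsion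

/-- The divergence of `e^{-f} ∇f` when the Lee form is `df`. -/
theorem IsStrongTorsionG2.divergence_weightedGradient (h : IsStrongTorsionG2 φ D H) {f : M → ℝ}
    (hf : ContMDiff (𝓡 7) 𝓘(ℝ, ℝ) ∞ f)
    (hlee : ∀ (x : M) (w : E7), leeInv (φ x) (H x) w = mvfderiv (𝓡 7) f x w) (x : M) :
    divergence D (weightedGradient φ f) x = Real.exp (-f x) *
      (formInner (φ x) (H x) (φ x) ^ 2 - formInner (φ x) (H x) (H x)) := by
  have hz := mem_extChartAt_target (I := 𝓡 7) x
  have hx := extChartAt_to_inv (I := 𝓡 7) x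
  have h1 := (h.isLocalG2 x hz).div_lee (h.extDeriv_torsion x)
    (f := f ∘ (extChartAt (𝓡 7) x).symm)
    ((contDiffAt_chart hf x hz).differentiableAt (by simp))
    (X := fieldInChart x (weightedGradient φ f))
    ((contDiffAt_weightedGradient h.isG2 hf x hz).differentiableAt (by simp))
    (by
      filter_upwards [target_mem_nhds x hz] with z hz w
      rw [leeInv_chart h.isG2 x hz, hlee, mfderiv_comp_chart x hz
        ((contDiffAt_chart hf x hz).differentiableAt (by simp))])
    (by
      filter_upwards [target_mem_nhds x hz] with z hz w
      exact metric_weightedGradient_chart h.isG2 hf x hz w)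
  rw [← divergence_chart D x hz ((contDiffAt_weightedGradient h.isG2 hf x hz).differentiableAt
    (by simp)), hx, formInChart_self, formInChart_self, Function.comp_apply, hx] at h1
  exact h1

/-- The function `⟨H, φ⟩` is constant. -/
theorem IsStrongTorsionG2.exists_formInner_eq [PreconnectedSpace M] [Nonempty M]
    (h : IsStrongTorsionG2 φ D H) : ∃ s : ℝ, ∀ x, formInner (φ x) (H x) (φ x) = s := by
  set s : M → ℝ := fun x => formInner (φ x) (H x) (φ x) with hs
  have e : ∀ (p : M), ∀ z ∈ (extChartAt (𝓡 7) p).target, (s ∘ (extChartAt (𝓡 7) p).symm) =ᶠ[𝓝 z]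
      fun y => formInner (formInChart p φ y) (formInChart p H y) (formInChart p φ y) := by
    intro p z hz
    filter_upwards [target_mem_nhds p hz] with y hy
    exact (formInner_chart h.isG2 H φ p hy).symm
  have hd : ∀ (p : M), ∀ z ∈ (extChartAt (𝓡 7) p).target,
      DifferentiableAt ℝ (s ∘ (extChartAt (𝓡 7) p).symm) z := by
    intro p z hz
    rw [(e p z hz).differentiableAt_iff]
    exact (contDiffAt_formInner (n := 1) ((contDiffAt_formInChart p h.isG2.smooth hz).of_le (by simp))
      (isG2Form_chart p h.isG2 hz) ((h.contDiffAt_torsion p hz).of_le (by simp))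
      ((contDiffAt_formInChart p h.isG2.smooth hz).of_le (by simp))).differentiableAt (by simp)
  have h0 : ∀ x : M, ∀ u : E7, mvfderiv (𝓡 7) s x u = 0 := by
    intro x u
    have hz := mem_extChartAt_target (I := 𝓡 7) x
    have h1 := mfderiv_comp_chart x hz (hd x _ hz) u
    rw [(e x _ hz).fderiv_eq, ((h.isLocalG2 x hz).fderiv_scalar (h.extDeriv_torsion x)).2,
      chartEquiv_self] at h1
    have h2 : ∀ q, q = x → (mvfderiv (𝓡 7) s q : E7 →L[ℝ] ℝ) u =
        (mvfderiv (𝓡 7) s x : E7 →L[ℝ] ℝ) u := by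
      rintro q rfl
      rfl
    exact (h2 _ (extChartAt_to_inv (I := 𝓡 7) x)).symm.trans h1
  -- the function has vanishing derivative in each chart
  have hloc : IsLocallyConstant s := by
    rw [IsLocallyConstant.iff_eventually_eq]
    intro x
    have hz := mem_extChartAt_target (I := 𝓡 7) x
    obtain ⟨r, hr, hball⟩ := Metric.mem_nhds_iff.1 (target_mem_nhds x hz)
    have hconst : ∀ z ∈ Metric.ball (extChartAt (𝓡 7) x x) r,
        (s ∘ (extChartAt (𝓡 7) x).symm) z =
          (s ∘ (extChartAt (𝓡 7) x).symm) (extChartAt (𝓡 7) x x) := by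
      intro z hzb
      refine (Metric.isOpen_ball (x := extChartAt (𝓡 7) x x) (ε := r)).is_const_of_fderiv_eq_zero
        (𝕜 := ℝ) (convex_ball _ _).isPreconnected
        (fun y hy => (hd x y (hball hy)).differentiableWithinAt) ?_ hzb (Metric.mem_ball_self hr)
      intro y hy
      ext u
      rw [← mfderiv_comp_chart x (hball hy) (hd x y (hball hy))]
      exact h0 _ _
    filter_upwards [(continuousAt_extChartAt (I := 𝓡 7) x).preimage_mem_nhds
      (Metric.ball_mem_nhds _ hr), extChartAt_source_mem_nhds (I := 𝓡 7) x] with q hq hqs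
    have := hconst _ hq
    simpa only [Function.comp_apply, (extChartAt (𝓡 7) x).left_inv hqs,
      extChartAt_to_inv] using this
  obtain ⟨x₀⟩ := ‹Nonempty M›
  exact ⟨s x₀, fun x => hloc.apply_eq_of_preconnectedSpace x x₀⟩

end

/-! ### The Riemannian measure in a chart -/

theorem measurableSet_inter_symm_preimage {M : Type*} [TopologicalSpace M] [ChartedSpace E7 M]
    [MeasurableSpace M] [BorelSpace M] (p : M) {A : Set M} (hA : MeasurableSet A) :
    MeasurableSet ((extChartAt (𝓡 7) p).target ∩ (extChartAt (𝓡 7) p).symm ⁻¹' A) := by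
  have ht : MeasurableSet (extChartAt (𝓡 7) p).target :=
    (isOpen_extChartAt_target p).measurableSet
  have hc : Continuous fun z : (extChartAt (𝓡 7) p).target => (extChartAt (𝓡 7) p).symm z :=
    continuousOn_iff_continuous_domRestrict.1 (continuousOn_extChartAt_symm p)
  have h := MeasurableSet.subtype_image ht (hc.measurable hA)
  convert h using 1
  ext z
  simp [and_comm]

theorem aemeasurable_symm {M : Type*} [TopologicalSpace M] [ChartedSpace E7 M]
    [MeasurableSpace M] [BorelSpace M] (p : M) : AEMeasurable (extChartAt (𝓡 7) p).symm
    ((volume : Measure E7).restrict (extChartAt (𝓡 7) p).target) := by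
  have ht : MeasurableSet (extChartAt (𝓡 7) p).target :=
    (isOpen_extChartAt_target p).measurableSet
  rw [aemeasurable_restrict_iff_comap_subtype ht]
  have hc : Continuous fun z : (extChartAt (𝓡 7) p).target => (extChartAt (𝓡 7) p).symm z :=
    continuousOn_iff_continuous_domRestrict.1 (continuousOn_extChartAt_symm p)
  exact hc.measurable.aemeasurable

section

variable {M : Type*} [TopologicalSpace M] [ChartedSpace E7 M] [IsManifold (𝓡 7) ∞ M]
  {φ : DForm M 3}

/-- The derivative of the transition map between the charts centred at `p` and `q`. -/
def transitionDeriv (p q : M) (z : E7) : E7 →L[ℝ] E7 :=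
  (mfderiv (𝓡 7) 𝓘(ℝ, E7) (extChartAt (𝓡 7) q) ((extChartAt (𝓡 7) p).symm z) : E7 →L[ℝ] E7).comp
    (mfderiv 𝓘(ℝ, E7) (𝓡 7) (extChartAt (𝓡 7) p).symm z : E7 →L[ℝ] E7)

theorem hasFDerivAt_transition {p q : M} {z : E7} (hz : z ∈ (extChartAt (𝓡 7) p).target)
    (hq : (extChartAt (𝓡 7) p).symm z ∈ (extChartAt (𝓡 7) q).source) :
    HasFDerivAt (extChartAt (𝓡 7) q ∘ (extChartAt (𝓡 7) p).symm) (transitionDeriv p q z) z := by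
  have : IsManifold (𝓡 7) 1 M := .of_le (n := ∞) (by simp)
  have h1 : MDifferentiableAt 𝓘(ℝ, E7) (𝓡 7) (extChartAt (𝓡 7) p).symm z := by
    have := mdifferentiableWithinAt_extChartAt_symm (I := 𝓡 7) hz
    rwa [ModelWithCorners.range_eq_univ, mdifferentiableWithinAt_univ] at this
  have h2 : MDifferentiableAt (𝓡 7) 𝓘(ℝ, E7) (extChartAt (𝓡 7) q) ((extChartAt (𝓡 7) p).symm z) :=
    mdifferentiableAt_extChartAt (by rwa [← extChartAt_source (𝓡 7)])
  exact (h2.hasMFDerivAt.comp z h1.hasMFDerivAt).hasFDerivAt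

theorem formInChart_transition {p q : M} {z : E7} {k : ℕ} (α : DForm M k)
    (hq : (extChartAt (𝓡 7) p).symm z ∈ (extChartAt (𝓡 7) q).source) :
    formInChart p α z = (formInChart q α
      ((extChartAt (𝓡 7) q ∘ (extChartAt (𝓡 7) p).symm) z)).compContinuousLinearMap
        (transitionDeriv p q z) := by
  have : IsManifold (𝓡 7) 1 M := .of_le (n := ∞) (by simp)
  set x := (extChartAt (𝓡 7) p).symm z with hx
  have h1 := mfderivWithin_extChartAt_symm_comp_mfderiv_extChartAt' (I := 𝓡 7) hq
  rw [ModelWithCorners.range_eq_univ, mfderivWithin_univ] at h1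
  have h2 : ∀ y, y = x → ∀ w : Fin k → E7, (α y : Form k) w = (α x : Form k) w := by
    rintro y rfl w
    rfl
  ext v
  refine Eq.trans ?_ (h2 _ ((extChartAt (𝓡 7) q).left_inv hq) _).symm
  refine congrArg (α x : Form k) (funext fun i => ?_)
  exact (congrArg (fun A : E7 →L[ℝ] E7 => A
    ((mfderiv 𝓘(ℝ, E7) (𝓡 7) (extChartAt (𝓡 7) p).symm z : E7 →L[ℝ] E7) (v i))) h1).symm

/-- The Riemannian density in a chart is the absolute value of the volume coefficient. -/
theorem sqrt_det_chart (h : IsG2Structure φ) (p : M) {z : E7}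
    (hz : z ∈ (extChartAt (𝓡 7) p).target) :
    Real.sqrt (Matrix.of fun i j : Fin 7 =>
        gMetric φ ((extChartAt (𝓡 7) p).symm z)
          (mfderiv 𝓘(ℝ, E7) (𝓡 7) (extChartAt (𝓡 7) p).symm z (stdVec i))
          (mfderiv 𝓘(ℝ, E7) (𝓡 7) (extChartAt (𝓡 7) p).symm z (stdVec j))).det =
      |volCoeff (formInChart p φ z)| := by
  rw [← Real.sqrt_sq_eq_abs, ← (isG2Form_chart p h hz).gram_det]
  congr 2
  ext i j
  exact (metric_chart p h hz (stdVec i) (stdVec j)).symm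

theorem contDiffAt_abs_volCoeff (h : IsG2Structure φ) (p : M) {z : E7}
    (hz : z ∈ (extChartAt (𝓡 7) p).target) :
    ContDiffAt ℝ ∞ (fun z => |volCoeff (formInChart p φ z)|) z :=
  (contDiffAt_volCoeff (contDiffAt_formInChart p h.smooth hz) (isG2Form_chart p h hz)).abs
    (isG2Form_chart p h hz).volCoeff_ne_zero

variable [MeasurableSpace M]

theorem chartVolume_eq (h : IsG2Structure φ) (p : M) : chartVolume φ p =
    Measure.map (extChartAt (𝓡 7) p).symm
      (((volume : Measure E7).restrict (extChartAt (𝓡 7) p).target).withDensity fun z =>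
        ENNReal.ofReal |volCoeff (formInChart p φ z)|) := by
  rw [chartVolume]
  congr 1
  refine withDensity_congr_ae ?_
  filter_upwards [ae_restrict_mem (isOpen_extChartAt_target p).measurableSet] with z hz
  rw [sqrt_det_chart h p hz]

variable [BorelSpace M]

theorem chartVolume_apply (h : IsG2Structure φ) (p : M) {A : Set M} (hA : MeasurableSet A) :
    chartVolume φ p A = ∫⁻ z in (extChartAt (𝓡 7) p).target ∩ (extChartAt (𝓡 7) p).symm ⁻¹' A,
      ENNReal.ofReal |volCoeff (formInChart p φ z)| := by
  rw [chartVolume_eq h, Measure.map_apply_of_aemeasurable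
    ((aemeasurable_symm p).mono_ac (withDensity_absolutelyContinuous _ _)) hA,
    withDensity_apply', Measure.restrict_restrict' (isOpen_extChartAt_target p).measurableSet,
    Set.inter_comm]

/-- The Riemannian measures of two charts agree on overlaps, by the change of variables formula. -/
theorem chartVolume_overlap (h : IsG2Structure φ) (p q : M) {A : Set M} (hA : MeasurableSet A)
    (hp : A ⊆ (extChartAt (𝓡 7) p).source) (hq : A ⊆ (extChartAt (𝓡 7) q).source) :
    chartVolume φ p A = chartVolume φ q A := by
  rw [chartVolume_apply h p hA, chartVolume_apply h q hA]
  set T := (extChartAt (𝓡 7) p).target ∩ (extChartAt (𝓡 7) p).symm ⁻¹' A with hT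
  set ψ := extChartAt (𝓡 7) q ∘ (extChartAt (𝓡 7) p).symm with hψ
  have himg : ψ '' T = (extChartAt (𝓡 7) q).target ∩ (extChartAt (𝓡 7) q).symm ⁻¹' A := by
    ext w
    constructor
    · rintro ⟨z, ⟨hz, hzA⟩, rfl⟩
      refine ⟨(extChartAt (𝓡 7) q).map_source (hq hzA), ?_⟩
      simp only [Set.mem_preimage, hψ, Function.comp_apply, (extChartAt (𝓡 7) q).left_inv (hq hzA)]
      exact hzA
    · rintro ⟨hw, hwA⟩
      refine ⟨extChartAt (𝓡 7) p ((extChartAt (𝓡 7) q).symm w),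
        ⟨(extChartAt (𝓡 7) p).map_source (hp hwA), ?_⟩, ?_⟩
      · rw [Set.mem_preimage, (extChartAt (𝓡 7) p).left_inv (hp hwA)]
        exact hwA
      · rw [hψ, Function.comp_apply, (extChartAt (𝓡 7) p).left_inv (hp hwA),
          (extChartAt (𝓡 7) q).right_inv hw]
  have hinj : Set.InjOn ψ T := by
    rintro z ⟨hz, hzA⟩ w ⟨hw, hwA⟩ hzw
    have := (extChartAt (𝓡 7) q).injOn (hq hzA) (hq hwA) hzw
    exact (extChartAt (𝓡 7) p).symm.injOn hz hw this
  rw [← himg, lintegral_image_eq_lintegral_abs_det_fderiv_mul volume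
    (measurableSet_inter_symm_preimage p hA)
    (fun z hz => (hasFDerivAt_transition hz.1 (hq hz.2)).hasFDerivWithinAt) hinj]
  refine setLIntegral_congr_fun (measurableSet_inter_symm_preimage p hA) ?_
  rintro z ⟨hz, hzA⟩
  have hz' : ψ z ∈ (extChartAt (𝓡 7) q).target := (extChartAt (𝓡 7) q).map_source (hq hzA)
  dsimp only
  rw [formInChart_transition φ (hq hzA), volCoeff_compCLM (isG2Form_chart q h hz'), abs_mul,
    mul_comm, ENNReal.ofReal_mul (abs_nonneg _)]

theorem chartVolume_compl_source (h : IsG2Structure φ) (p : M) {A : Set M} (hA : MeasurableSet A)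
    (hp : Disjoint A (extChartAt (𝓡 7) p).source) : chartVolume φ p A = 0 := by
  rw [chartVolume_apply h p hA]
  have : (extChartAt (𝓡 7) p).target ∩ (extChartAt (𝓡 7) p).symm ⁻¹' A = ∅ := by
    ext z
    simp only [Set.mem_inter_iff, Set.mem_preimage, Set.mem_empty_iff_false, iff_false, not_and]
    intro hz hzA
    exact Set.disjoint_left.1 hp hzA ((extChartAt (𝓡 7) p).map_target hz)
  rw [this, Measure.restrict_empty, lintegral_zero_measure]

/-- The Riemannian measure restricts to the Riemannian measure of each chart. -/
theorem riemVolume_apply (h : IsG2Structure φ) (p : M) {A : Set M} (hA : MeasurableSet A)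
    (hp : A ⊆ (extChartAt (𝓡 7) p).source) : riemVolume φ A = chartVolume φ p A := by
  have hS : ∀ q : M, MeasurableSet (extChartAt (𝓡 7) q).source := fun q =>
    (isOpen_extChartAt_source q).measurableSet
  refine le_antisymm ?_ (le_iSup (fun p => chartVolume φ p) p A)
  -- off the domain of the chart at `p` the right side dominates every chart measure, and on it
  -- the chart measures agree with that at `p`
  have key : riemVolume φ ≤ chartVolume φ p +
      (riemVolume φ).restrict (extChartAt (𝓡 7) p).sourceᶜ := by
    refine iSup_le fun q => Measure.le_iff.2 fun B hB => ?_
    rw [Measure.add_apply, Measure.restrict_apply hB,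
      ← measure_inter_add_sdiff B (hS p)]
    refine add_le_add ?_ (le_iSup (fun p => chartVolume φ p) q _)
    rw [← measure_inter_add_sdiff (B ∩ _) (hS q), chartVolume_compl_source h q
      ((hB.inter (hS p)).diff (hS q)) Set.disjoint_sdiff_left, add_zero,
      chartVolume_overlap h q p ((hB.inter (hS p)).inter (hS q)) Set.inter_subset_right
        (Set.inter_subset_left.trans Set.inter_subset_right)]
    exact measure_mono (Set.inter_subset_left.trans Set.inter_subset_left)
  refine (key A).trans ?_
  rw [Measure.add_apply, Measure.restrict_apply hA,
    (Set.disjoint_compl_right_iff_subset.2 hp).inter_eq, measure_empty, add_zero]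

theorem restrict_riemVolume (h : IsG2Structure φ) (p : M) :
    (riemVolume φ).restrict (extChartAt (𝓡 7) p).source = chartVolume φ p := by
  have hS := (isOpen_extChartAt_source (I := 𝓡 7) p).measurableSet
  refine Measure.ext fun A hA => ?_
  rw [Measure.restrict_apply hA, riemVolume_apply h p (hA.inter hS) Set.inter_subset_right,
    ← measure_inter_add_sdiff A hS, chartVolume_compl_source h p (hA.diff hS)
      Set.disjoint_sdiff_left, add_zero]

/-- The integral of a continuous function supported in a chart. -/
theorem integral_riemVolume (h : IsG2Structure φ) (p : M) {g : M → ℝ} (hg : Continuous g)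
    (hp : Function.support g ⊆ (extChartAt (𝓡 7) p).source) :
    ∫ x, g x ∂(riemVolume φ) = ∫ z in (extChartAt (𝓡 7) p).target,
      |volCoeff (formInChart p φ z)| * g ((extChartAt (𝓡 7) p).symm z) := by
  rw [← setIntegral_eq_integral_of_forall_compl_eq_zero (s := (extChartAt (𝓡 7) p).source)
    (fun x hx => by_contra fun h0 => hx (hp h0)), restrict_riemVolume h p, chartVolume_eq h,
    integral_map ((aemeasurable_symm p).mono_ac (withDensity_absolutelyContinuous _ _))
      hg.aestronglyMeasurable]
  have hm : AEMeasurable (fun z => ENNReal.ofReal |volCoeff (formInChart p φ z)|)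
      ((volume : Measure E7).restrict (extChartAt (𝓡 7) p).target) := by
    refine ENNReal.measurable_ofReal.comp_aemeasurable (ContinuousOn.aemeasurable
      (fun z hz => ?_) (isOpen_extChartAt_target p).measurableSet)
    exact (contDiffAt_abs_volCoeff h p hz).continuousAt.continuousWithinAt
  rw [integral_withDensity_eq_integral_toReal_smul₀ hm (by simp)]
  refine integral_congr_ae (Filter.Eventually.of_forall fun z => ?_)
  simp [ENNReal.toReal_ofReal]

end

/-! ### The divergence theorem -/

section

variable {M : Type*} [TopologicalSpace M] [ChartedSpace E7 M]

/-- A vector field is smooth if all its coordinate expressions are. -/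
def IsSmoothField (Y : VField M) : Prop :=
  ∀ (p : M), ∀ z ∈ (extChartAt (𝓡 7) p).target, ContDiffAt ℝ ∞ (fieldInChart p Y) z

theorem continuous_of_chart {g : M → ℝ}
    (h : ∀ p : M, ContinuousAt (g ∘ (extChartAt (𝓡 7) p).symm) (extChartAt (𝓡 7) p p)) :
    Continuous g := by
  refine continuous_iff_continuousAt.2 fun x => ?_
  refine ((h x).comp (continuousAt_extChartAt (I := 𝓡 7) x)).congr ?_
  filter_upwards [extChartAt_source_mem_nhds (I := 𝓡 7) x] with q hq
  exact congrArg g ((extChartAt (𝓡 7) x).left_inv hq)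

theorem fieldInChart_smul (p : M) (ρ : M → ℝ) (Y : VField M) (z : E7) :
    fieldInChart p (ρ • Y) z = ρ ((extChartAt (𝓡 7) p).symm z) • fieldInChart p Y z :=
  ContinuousLinearMap.map_smul
    (mfderiv (𝓡 7) 𝓘(ℝ, E7) (extChartAt (𝓡 7) p) ((extChartAt (𝓡 7) p).symm z) : E7 →L[ℝ] E7) _ _

variable [IsManifold (𝓡 7) ∞ M] {φ H : DForm M 3} {D : Connection M}

theorem IsSmoothField.smul {Y : VField M} (hY : IsSmoothField Y) {ρ : M → ℝ}
    (hρ : ContMDiff (𝓡 7) 𝓘(ℝ, ℝ) ∞ ρ) : IsSmoothField (ρ • Y) := by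
  intro p z hz
  have e : fieldInChart p (ρ • Y) = fun z => (ρ ∘ (extChartAt (𝓡 7) p).symm) z •
      fieldInChart p Y z := funext fun z => fieldInChart_smul p ρ Y z
  rw [e]
  exact (contDiffAt_chart hρ p hz).smul (hY p z hz)

theorem IsSmoothField.isDiffFieldAt {Y : VField M} (hY : IsSmoothField Y) (x : M) :
    IsDiffFieldAt Y x := by
  have h := (isDiffFieldAt_iff x (mem_extChartAt_target x) Y).2
    ((hY x _ (mem_extChartAt_target x)).differentiableAt (by simp))
  rwa [extChartAt_to_inv] at h

variable [T2Space M]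

theorem continuous_divergence (h : IsStrongTorsionG2 φ D H) {Y : VField M}
    (hY : IsSmoothField Y) : Continuous (divergence D Y) := by
  refine continuous_of_chart fun p => ?_
  have hz := mem_extChartAt_target (I := 𝓡 7) p
  have e : (divergence D Y ∘ (extChartAt (𝓡 7) p).symm) =ᶠ[𝓝 (extChartAt (𝓡 7) p p)] fun z =>
      ∑ m : Fin 7, (fderiv ℝ (fieldInChart p Y) z (stdVec m) +
        christoffel p D z (stdVec m) (fieldInChart p Y z)) m := by
    filter_upwards [target_mem_nhds p hz] with z hz
    rw [Function.comp_apply, divergence_chart D p hz ((hY p z hz).differentiableAt (by simp)),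
      trace_eq_sum]
    rfl
  refine ContinuousAt.congr ?_ e.symm
  have h1 : ContinuousAt (fderiv ℝ (fieldInChart p Y)) (extChartAt (𝓡 7) p p) :=
    ((hY p _ hz).fderiv_right (m := ∞) (by simp)).continuousAt
  have h2 := (h.isLocalG2 p hz).christoffel_smooth.continuousAt
  have h3 := (hY p _ hz).continuousAt
  refine tendsto_finsetSum _ fun m _ => ?_
  exact (EuclideanSpace.proj m : E7 →L[ℝ] ℝ).continuous.continuousAt.comp
    ((h1.clm_apply continuousAt_const).add ((h2.clm_apply continuousAt_const).clm_apply h3))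

variable [CompactSpace M] [MeasurableSpace M] [BorelSpace M]

/-- The divergence theorem for a vector field supported in a chart. -/
theorem integral_divergence_of_tsupport (h : IsStrongTorsionG2 φ D H) {Y : VField M}
    (hY : IsSmoothField Y) (p : M) {ρ : M → ℝ} (hρ : ContMDiff (𝓡 7) 𝓘(ℝ, ℝ) ∞ ρ)
    (hs : tsupport ρ ⊆ (extChartAt (𝓡 7) p).source) :
    ∫ x, divergence D (ρ • Y) x ∂(riemVolume φ) = 0 := by
  have hZ := hY.smul hρ
  have hsupp : Function.support (divergence D (ρ • Y)) ⊆ (extChartAt (𝓡 7) p).source := by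
    intro x hx
    by_contra hxs
    refine hx ?_
    have hx0 : x ∉ tsupport ρ := fun h => hxs (hs h)
    have : D (ρ • Y) x = 0 := by
      have h0 := D.isCovariantDerivativeOnUniv.congr_of_eventuallyEq (hZ.isDiffFieldAt x)
        (isDiffFieldAt_zero x) Filter.univ_mem (by
          filter_upwards [notMem_tsupport_iff_eventuallyEq.1 hx0] with q hq
          simp [hq])
      rw [h0]
      exact congrFun D.zero x
    rw [divergence, this]
    exact map_zero _
  rw [integral_riemVolume h.isG2 p (continuous_divergence h hZ) hsupp]
  set T := (extChartAt (𝓡 7) p).target with hT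
  have hTo : IsOpen T := isOpen_extChartAt_target p
  -- in the chart, the divergence becomes that of the density times the field, extended by zero
  set W : E7 → E7 := T.indicator fun z =>
    |volCoeff (formInChart p φ z)| • fieldInChart p (ρ • Y) z with hW
  have hWT : ∀ z ∈ T, W =ᶠ[𝓝 z] fun z =>
      |volCoeff (formInChart p φ z)| • fieldInChart p (ρ • Y) z := by
    intro z hz
    filter_upwards [hTo.mem_nhds hz] with y hy
    rw [hW, Set.indicator_of_mem hy]
  have hK : IsCompact (extChartAt (𝓡 7) p '' tsupport ρ) :=
    (isClosed_tsupport ρ).isCompact.image_of_continuousOn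
      ((continuousOn_extChartAt p).mono hs)
  have hW0 : ∀ z ∉ extChartAt (𝓡 7) p '' tsupport ρ, W z = 0 := by
    intro z hz
    by_cases hzT : z ∈ T
    · have h1 : (extChartAt (𝓡 7) p).symm z ∉ tsupport ρ := fun hm =>
        hz ⟨_, hm, (extChartAt (𝓡 7) p).right_inv hzT⟩
      rw [hW, Set.indicator_of_mem hzT, fieldInChart_smul, image_eq_zero_of_notMem_tsupport h1,
        zero_smul, smul_zero]
    · rw [hW, Set.indicator_of_notMem hzT]
  have hWc : HasCompactSupport W := HasCompactSupport.intro hK hW0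
  have hKT : extChartAt (𝓡 7) p '' tsupport ρ ⊆ T := by
    rintro _ ⟨x, hx, rfl⟩
    exact (extChartAt (𝓡 7) p).map_source (hs hx)
  have hW0' : ∀ z ∉ T, W =ᶠ[𝓝 z] fun _ => 0 := by
    intro z hz
    filter_upwards [hK.isClosed.isOpen_compl.mem_nhds fun hm => hz (hKT hm)] with y hy
    exact hW0 y hy
  have hWd : ContDiff ℝ 1 W := by
    refine contDiff_iff_contDiffAt.2 fun z => ?_
    by_cases hz : z ∈ T
    · refine ContDiffAt.congr_of_eventuallyEq ?_ (hWT z hz)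
      have hs : ContDiffAt ℝ ∞ (fun z => |volCoeff (formInChart p φ z)| •
          fieldInChart p (ρ • Y) z) z :=
        (contDiffAt_abs_volCoeff h.isG2 p hz).smul (hZ p z hz)
      exact hs.of_le (by simp)
    · exact contDiffAt_const.congr_of_eventuallyEq (hW0' z hz)
  refine Eq.trans ?_ (integral_trace_fderiv_eq_zero hWd hWc)
  rw [← setIntegral_eq_integral_of_forall_compl_eq_zero (s := T)
    (f := fun z => LinearMap.trace ℝ E7 (fderiv ℝ W z : E7 →ₗ[ℝ] E7))]
  · refine setIntegral_congr_fun hTo.measurableSet fun z hz => ?_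
    have hd : DifferentiableAt ℝ (fieldInChart p (ρ • Y)) z :=
      (hZ p z hz).differentiableAt (by simp)
    rw [divergence_chart D p hz hd, (hWT z hz).fderiv_eq,
      (h.isLocalG2 p hz).trace_fderiv_vol_smul hd]
  · intro z hz
    rw [(hW0' z hz).fderiv_eq]
    simp

/-- The divergence theorem on a compact manifold. -/
theorem integral_divergence (h : IsStrongTorsionG2 φ D H) [IsFiniteMeasure (riemVolume φ)]
    {Y : VField M} (hY : IsSmoothField Y) :
    ∫ x, divergence D Y x ∂(riemVolume φ) = 0 := by
  obtain ⟨t, ht⟩ := isCompact_univ.elim_finite_subcover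
    (fun p : M => (extChartAt (𝓡 7) p).source) (fun p => isOpen_extChartAt_source p)
    (fun x _ => Set.mem_iUnion.2 ⟨x, mem_extChartAt_source x⟩)
  obtain ⟨ρ, hρ⟩ := SmoothPartitionOfUnity.exists_isSubordinate (𝓡 7) (isClosed_univ (X := M))
    (fun p : t => (extChartAt (𝓡 7) (p : M)).source) (fun p => isOpen_extChartAt_source (p : M))
    (fun x hx => by
      obtain ⟨p, hp, hxp⟩ := Set.mem_iUnion₂.1 (ht hx)
      exact Set.mem_iUnion.2 ⟨⟨p, hp⟩, hxp⟩)
  have hsum : ∀ x, ∑ p : t, ρ p x = 1 := fun x => by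
    rw [← finsum_eq_sum_of_fintype]
    exact ρ.sum_eq_one (Set.mem_univ x)
  have hsm : ∀ p : t, ContMDiff (𝓡 7) 𝓘(ℝ, ℝ) ∞ (ρ p) := fun p => (ρ p).contMDiff
  have hYsum : Y = ∑ p : t, (ρ p : M → ℝ) • Y := by
    funext x
    rw [Finset.sum_apply]
    simp only [Pi.smul_apply']
    rw [← Finset.sum_smul, hsum, one_smul]
  have hdiv : ∀ x, divergence D Y x = ∑ p : t, divergence D ((ρ p : M → ℝ) • Y) x := by
    intro x
    have h1 := fun u => (conn_sum D Finset.univ (fun p : t => (ρ p : M → ℝ)) (fun _ => Y) (x := x)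
      (fun p => (hsm p).mdifferentiableAt (by simp)) (fun _ => hY.isDiffFieldAt x) u).2
    rw [← hYsum] at h1
    have h2 : (D Y x).toLinearMap = ∑ p : t, (D ((ρ p : M → ℝ) • Y) x).toLinearMap := by
      refine LinearMap.ext fun u => (h1 u).trans ?_
      rw [LinearMap.sum_apply]
      refine Finset.sum_congr rfl fun p _ => ?_
      have h3 := D.isCovariantDerivativeOnUniv.leibniz (hY.isDiffFieldAt x)
        ((hsm p).mdifferentiableAt (x := x) (by simp))
      exact (congrArg (fun A : E7 →L[ℝ] E7 => A u) h3).symm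
    rw [divergence, h2, map_sum]
    rfl
  have hint : ∀ p : t, Integrable (divergence D ((ρ p : M → ℝ) • Y)) (riemVolume φ) := fun p =>
    (continuous_divergence h (hY.smul (hsm p))).integrable_of_hasCompactSupport
      (HasCompactSupport.of_compactSpace _)
  simp_rw [hdiv]
  rw [integral_finsetSum _ fun p _ => hint p]
  exact Finset.sum_eq_zero fun p _ => integral_divergence_of_tsupport h hY p (hsm p) (hρ p)

end

/-! ### The weighted volume and the energy of the torsion -/

section

variable {M : Type*} [TopologicalSpace M] [ChartedSpace E7 M] {φ H : DForm M 3}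

/-- If the canonical field vanishes, then the Lee form is `df`. -/
theorem lee_eq_of_canonicalField_eq_zero (h : IsG2Structure φ) {τ₁ : DForm M 1} {f : M → ℝ} {x : M}
    (hV : canonicalField φ τ₁ f x = 0) (w : E7) :
    (leeForm τ₁ x : Form 1) (fun _ => w) = mvfderiv (𝓡 7) f x w := by
  have h1 : sharp (φ x) (leeForm τ₁ x) = sharp (φ x) (dFun f x) := sub_eq_zero.1 hV
  have h2 := metric_sharp (h.isG2Form x) (leeForm τ₁ x) w
  rw [h1] at h2
  exact h2.symm.trans (metric_sharp (h.isG2Form x) (dFun f x) w)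

variable [IsManifold (𝓡 7) ∞ M] {D : Connection M}

/-- The Riemannian measure charges every nonempty open set. -/
theorem isOpenPosMeasure_riemVolume [MeasurableSpace M] [BorelSpace M] (h : IsG2Structure φ) :
    (riemVolume φ).IsOpenPosMeasure := by
  refine ⟨fun U hU hne h0 => ?_⟩
  obtain ⟨x, hx⟩ := hne
  have hS := isOpen_extChartAt_source (I := 𝓡 7) x
  have h1 := measure_mono_null (Set.inter_subset_left (s := U)
    (t := (extChartAt (𝓡 7) x).source)) h0
  have hUS := (hU.inter hS).measurableSet
  rw [riemVolume_apply h x hUS Set.inter_subset_right, chartVolume_apply h x hUS] at h1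
  set T := (extChartAt (𝓡 7) x).target ∩
    (extChartAt (𝓡 7) x).symm ⁻¹' (U ∩ (extChartAt (𝓡 7) x).source) with hT
  have hTo : IsOpen T := (continuousOn_extChartAt_symm x).isOpen_inter_preimage
    (isOpen_extChartAt_target x) (hU.inter hS)
  have hxT : extChartAt (𝓡 7) x x ∈ T := by
    refine ⟨mem_extChartAt_target x, ?_⟩
    rw [Set.mem_preimage, extChartAt_to_inv]
    exact ⟨hx, mem_extChartAt_source x⟩
  refine (hTo.measure_pos volume ⟨_, hxT⟩).ne' ?_
  have hc : ContinuousOn (fun z => ENNReal.ofReal |volCoeff (formInChart x φ z)|) T :=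
    fun z hz => (ENNReal.continuous_ofReal.continuousAt.comp
      (contDiffAt_abs_volCoeff h x hz.1).continuousAt).continuousWithinAt
  have hm := hc.aemeasurable (μ := volume) hTo.measurableSet
  rw [lintegral_eq_zero_iff' hm] at h1
  have h2 : ∀ᵐ z ∂((volume : Measure E7).restrict T), False := by
    filter_upwards [h1, ae_restrict_mem hTo.measurableSet] with z hz hzT
    have := (isG2Form_chart x h hzT.1).volCoeff_ne_zero
    simp only [Pi.zero_apply, ENNReal.ofReal_eq_zero, abs_nonpos_iff] at hz
    exact this hz
  rwa [Filter.eventually_false_iff_eq_bot, ae_eq_bot, Measure.restrict_eq_zero] at h2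

theorem continuous_formInner_torsion [T2Space M] (h : IsStrongTorsionG2 φ D H) :
    Continuous fun x => formInner (φ x) (H x) (H x) := by
  refine continuous_of_chart fun p => ?_
  have hz := mem_extChartAt_target (I := 𝓡 7) p
  have e : ((fun x => formInner (φ x) (H x) (H x)) ∘ (extChartAt (𝓡 7) p).symm)
      =ᶠ[𝓝 (extChartAt (𝓡 7) p p)]
      fun y => formInner (formInChart p φ y) (formInChart p H y) (formInChart p H y) := by
    filter_upwards [target_mem_nhds p hz] with y hy
    exact (formInner_chart h.isG2 H H p hy).symm
  exact ContinuousAt.congr (contDiffAt_formInner (contDiffAt_formInChart p h.isG2.smooth hz)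
    (isG2Form_chart p h.isG2 hz) (h.contDiffAt_torsion p hz)
    (h.contDiffAt_torsion p hz)).continuousAt e.symm

/-- On a compact space the weight `e^{-f}` is bounded below by a positive constant, so its
integrability makes the measure finite; a nonzero Bochner integral entails integrability. -/
theorem isFiniteMeasure_of_integral_exp_ne_zero {X : Type*} [TopologicalSpace X] [CompactSpace X]
    [MeasurableSpace X] {μ : Measure X} {f : X → ℝ} (hf : Continuous f)
    (h : ∫ x, Real.exp (-f x) ∂μ ≠ 0) : IsFiniteMeasure μ := by
  have hi : Integrable (fun x => Real.exp (-f x)) μ := by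
    by_contra hn
    exact h (integral_undef hn)
  obtain ⟨B, hB⟩ := isCompact_univ.bddAbove_image hf.continuousOn
  have hc : Integrable (fun _ : X => Real.exp (-B)) μ := by
    refine hi.mono' aestronglyMeasurable_const (Filter.Eventually.of_forall fun x => ?_)
    rw [Real.norm_eq_abs, Real.abs_exp]
    exact Real.exp_le_exp.2 (neg_le_neg (hB ⟨x, Set.mem_univ x, rfl⟩))
  exact (integrable_const_iff.1 hc).resolve_left (Real.exp_ne_zero _)

/-- The energy identity: integrating the divergence of `e^{-f} ∇f`. -/
theorem integral_formInner_torsion [T2Space M] [CompactSpace M] [MeasurableSpace M] [BorelSpace M]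
    (h : IsStrongTorsionG2 φ D H) [IsFiniteMeasure (riemVolume φ)] {f : M → ℝ}
    (hf : ContMDiff (𝓡 7) 𝓘(ℝ, ℝ) ∞ f)
    (hlee : ∀ (x : M) (w : E7), leeInv (φ x) (H x) w = mvfderiv (𝓡 7) f x w) {s : ℝ}
    (hs : ∀ x, formInner (φ x) (H x) (φ x) = s) :
    ∫ x, Real.exp (-f x) * formInner (φ x) (H x) (H x) ∂(riemVolume φ) =
      s ^ 2 * ∫ x, Real.exp (-f x) ∂(riemVolume φ) := by
  have hY : IsSmoothField (weightedGradient φ f) := fun p z hz =>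
    contDiffAt_weightedGradient h.isG2 hf p hz
  have hce : Continuous fun x => Real.exp (-f x) := Real.continuous_exp.comp hf.continuous.neg
  set q : M → ℝ := fun x => formInner (φ x) (H x) (H x) with hq
  have hcq : Continuous q := continuous_formInner_torsion h
  have h0 : ∫ x, (Real.exp (-f x) * s ^ 2 - Real.exp (-f x) * q x) ∂(riemVolume φ) = 0 := by
    rw [← integral_divergence h hY]
    refine integral_congr_ae (Filter.Eventually.of_forall fun x => ?_)
    refine Eq.trans ?_ (h.divergence_weightedGradient hf hlee x).symm
    rw [hs, mul_sub]
  rw [integral_sub (f := fun x => Real.exp (-f x) * s ^ 2) (g := fun x => Real.exp (-f x) * q x)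
    ((hce.mul continuous_const).integrable_of_hasCompactSupport (HasCompactSupport.of_compactSpace _))
    ((hce.mul hcq).integrable_of_hasCompactSupport (HasCompactSupport.of_compactSpace _)),
    integral_mul_const] at h0
  linarith

theorem torsion_eq_zero_of_forall (h : IsStrongTorsionG2 φ D H) (h0 : ∀ x, H x = 0) (x : M) :
    D.torsion x = 0 := by
  have key : ∀ u v : E7, (D.torsion x u v : E7) = 0 := fun u v =>
    eq_of_metric_eq (h.isG2.isG2Form x) fun w => by
      have h1 := h.skewTorsion.torsion_eq x u v w
      rw [h0 x] at h1
      refine h1.trans ?_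
      have h2 := metric_sub_left (φ x) 0 0 w
      rw [sub_self, sub_self] at h2
      exact h2.symm
  ext u v : 2
  exact key u v

/-- If the torsion form vanishes then the characteristic connection is the Levi-Civita
connection. -/
theorem isParallelG2_of_torsion_eq_zero (h : IsStrongTorsionG2 φ D H) (h0 : ∀ x, H x = 0) :
    IsParallelG2 φ :=
  ⟨D, h.skewTorsion.smooth, h.skewTorsion.metric_parallel, torsion_eq_zero_of_forall h h0,
    h.skewTorsion.form_parallel⟩

end

end StrongG2

end

/-- Rigidity of compact strong torsion `G₂` structures with vanishing canonical field. -/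
theorem propositionp {M : Type*} [TopologicalSpace M] [T2Space M] [CompactSpace M]
    [ConnectedSpace M] [ChartedSpace StrongG2.E7 M] [IsManifold (𝓡 7) ∞ M]
    [MeasurableSpace M] [BorelSpace M]
    (φ : StrongG2.DForm M 3) (D : StrongG2.Connection M) (H : StrongG2.DForm M 3)
    (hφ : StrongG2.IsStrongTorsionG2 φ D H)
    (τ₀ : M → ℝ) (τ₁ : StrongG2.DForm M 1) (τ₂ : StrongG2.DForm M 2) (τ₃ : StrongG2.DForm M 3)
    (hτ : StrongG2.IsTorsionForms φ τ₀ τ₁ τ₂ τ₃)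
    (f : M → ℝ) (hf : StrongG2.IsSolitonPotential φ D f)
    (hV : ∀ x, StrongG2.canonicalField φ τ₁ f x = 0) :
    ∃ c : ℝ, (∀ x, τ₀ x = c) ∧
      ∫ x, Real.exp (-f x) * StrongG2.formInner (φ x) (H x) (H x) ∂(StrongG2.riemVolume φ) =
        49 / 36 * c ^ 2 * ∫ x, Real.exp (-f x) ∂(StrongG2.riemVolume φ) ∧
      (c = 0 ↔ (∀ x, H x = 0) ∧ StrongG2.IsParallelG2 φ) := by
  obtain ⟨s, hs⟩ := hφ.exists_formInner_eq
  have hlee : ∀ (x : M) (w : StrongG2.E7),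
      StrongG2.leeInv (φ x) (H x) w = mvfderiv (𝓡 7) f x w := fun x w =>
    ((hφ.torsion_forms hτ x).2 w).trans
      (StrongG2.lee_eq_of_canonicalField_eq_zero hφ.isG2 (hV x) w)
  have hfin : IsFiniteMeasure (StrongG2.riemVolume φ) :=
    StrongG2.isFiniteMeasure_of_integral_exp_ne_zero hf.smooth.continuous
      (by rw [hf.normalized]; exact one_ne_zero)
  have hE := StrongG2.integral_formInner_torsion hφ hf.smooth hlee hs
  refine ⟨6 / 7 * s, fun x => ?_, ?_, fun hc => ?_, fun hH => ?_⟩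
  · have h1 := (hφ.torsion_forms hτ x).1
    rw [hs] at h1
    linarith
  · rw [hE]
    ring
  · have hs0 : s = 0 := by linarith
    have hcont : Continuous fun x => Real.exp (-f x) * StrongG2.formInner (φ x) (H x) (H x) :=
      (Real.continuous_exp.comp hf.smooth.continuous.neg).mul
        (StrongG2.continuous_formInner_torsion hφ)
    rw [hs0, zero_pow two_ne_zero, zero_mul, integral_eq_zero_iff_of_nonneg
      (fun x => mul_nonneg (Real.exp_pos _).le
        (StrongG2.formInner_self_nonneg (hφ.isG2.isG2Form x) (H x)))
      (hcont.integrable_of_hasCompactSupport (HasCompactSupport.of_compactSpace _))] at hE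
    have hpos := StrongG2.isOpenPosMeasure_riemVolume hφ.isG2
    have hE' := (hcont.ae_eq_iff_eq (StrongG2.riemVolume φ) continuous_const).1 hE
    have hH : ∀ x, H x = 0 := fun x =>
      StrongG2.eq_zero_of_formInner_self (hφ.isG2.isG2Form x)
        ((mul_eq_zero.1 (congrFun hE' x)).resolve_left (Real.exp_ne_zero _))
    exact ⟨hH, StrongG2.isParallelG2_of_torsion_eq_zero hφ hH⟩
  · obtain ⟨x⟩ := (inferInstance : Nonempty M)
    have h1 : StrongG2.formInner (φ x) (0 : StrongG2.Form 3) (φ x) = 0 := by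
      simp [StrongG2.formInner]
    have h2 := hs x
    rw [hH.1 x] at h2
    rw [← h2]
    exact mul_eq_zero_of_right _ h1
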